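/- Let $\mathcal A$ be the mod 2 Steenrod algebra, and let $M$ be a finite-dimensional $\mathbb Z$-graded $\mathcal A$-module, for instance $M=H^*(X;\mathbb F_2)$ for a finite CW spectrum $X$. Let $\cdots\to F_1\to F_0\to\mathbb F_2$ be a graded free $\mathcal A$-resolution of finite type, with ordered homogeneous $\mathcal A$-bases $\{r^*_{s,j}\}_j$ of $F_s$ (finitely many in each degree), and let $\{e_k^*\}$ be an ordered homogeneous $\mathbb F_2$-basis of $M$ in which elements of lower degree come first. Let $\mathcal A$ act diagonally on $M\otimes F_s$, and let $C^s=\mathrm{Hom}_{\mathcal A}(M\otimes_{\mathbb F_2}F_s,\mathbb F_2)$. All Hom complexes are considered in each internal degree separately, where they are finite-dimensional in each cohomological degree $s$. *Curtis tables.* For a complex $X_0\to X_1\to\cdots$ of $\mathbb F_2$-vector spaces with ordered bases $\{x_{s,j}\}_j$, the leading term of an element is its largest basis element with nonzero coefficient. A Curtis table consists of lists $L_s$ of items, each of which is an element $x_{s,j}$ (untagged) or a tag $x_{s,j}\leftarrow x_{s-1,k}$, such that (i) each $x_{s,j}$ appears exactly once in the lists; (ii) an item $x_{s,j}$ or $x_{s,j}\leftarrow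 x_{s-1,k}$ is in $L_s$ if and only if some cycle of $X_s$ has leading term $x_{s,j}$; (iii) if $x_{s,j}\leftarrow x_{s-1,k}$ is a tag, then some element of $X_{s-1}$ with leading term $x_{s-1,k}$ has boundary with leading term $x_{s,j}$. *The spectral sequence.* Filter $C^*$ by $G_nC^s=\{\varphi:\varphi|_{M^{>n}\otimes F_s}=0\}$. The spectral sequence $(E_r,d_r)_{r\ge 0}$ of this filtered complex, $d_r:E_r^n\to E_r^{n-r}$, is the algebraic Atiyah–Hirzebruch spectral sequence (from $E_1=\bigoplus_n \mathrm{Ext}_{\mathcal A}(\mathbb F_2,\mathbb F_2)\otimes (M^n)^*$ on). Label its pages as follows: $E_0$ has the basis of the classes of the $e_k\otimes r_{s,j}$ (defined in the theorem), and $E_{r+1}=H(E_r,d_r)$ has the basis labelled by the untagged items $x$ of the Curtis table of $(E_r,d_r)$, where $x$ denotes the class of a homogeneous $d_r$-cycle with leading term $x$. The tags of the Curtis tables of $(E_r,d_r)$, $r\ge1$, form the table of algebraic Atiyah–Hirzebruch differentials. **Theorem.** The functionals $r_{s,j}$ and $e_k\otimes r_{s,j}$ dual to $r^*_{s,j}$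 and $e^*_k\otimes r^*_{s,j}$ exist and form bases of $\mathrm{Hom}_{\mathcal A}(F_s,\mathbb F_2)$ and of $C^s$; order the latter lexicographically. The complexes $\mathrm{Hom}_{\mathcal A}(F_*,\mathbb F_2)$ and $C^*$ have unique Curtis tables for these bases, labels on the pages as above exist, and for any such labels: 1. For every tag $a\leftarrow b$ in the Curtis table of $\mathrm{Hom}_{\mathcal A}(F_*,\mathbb F_2)$ and every $k$ there is a tag $e_k\otimes a\leftarrow e_k\otimes b$ in the Curtis table of $C^*$; these are exactly the tags of the page $(E_0,d_0)$. 2. The tags of the Curtis table of $C^*$ that are not of the form in 1 are exactly those in the table of algebraic Atiyah–Hirzebruch differentials; a tag of the table of $(E_r,d_r)$ lowers the degree of $e_k$ by $r$. 3. The labels that occur in no tag of 1 or 2 are exactly the untagged items of the Curtis table of $C^*$, and are exactly the labels that survive to every page $E_r$. They correspond to the permanent cycles: if $z_x$ is a cycle of $C^*$ with untagged leading term $x$, then the class of $z_x$ in $E_r$ has leading term $x$ for every $r$, and for any choice of one such cycle for each untagged $x$, the classes of the $z_x$ form a basis of $E_\infty$. -/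

import Mathlib

open scoped TensorProduct

namespace CurtisAHSS

universe u v w

/-! ### The mod 2 Steenrod algebra -/

/-- The relations `Sq⁰ = 1` and the Adem relations
`Sqᵃ Sqᵇ = ∑_j C(b-1-j, a-2j) Sqᵃ⁺ᵇ⁻ʲ Sqʲ` for `0 < a < 2b` (here `j ≤ a/2 < b`, so that no
subtraction is truncated). -/
inductive AdemRel : FreeAlgebra (ZMod 2) ℕ → FreeAlgebra (ZMod 2) ℕ → Prop
  | sq_zero : AdemRel (FreeAlgebra.ι (ZMod 2) 0) 1
  | adem (a b : ℕ) (ha : 0 < a) (hab : a < 2 * b) :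
      AdemRel (FreeAlgebra.ι (ZMod 2) a * FreeAlgebra.ι (ZMod 2) b)
        (∑ j ∈ Finset.range (a / 2 + 1), (Nat.choose (b - 1 - j) (a - 2 * j) : ZMod 2) •
          (FreeAlgebra.ι (ZMod 2) (a + b - j) * FreeAlgebra.ι (ZMod 2) j))

/-- The mod 2 Steenrod algebra: generators `Sqⁱ`, Adem relations. -/
abbrev SteenrodAlgebra : Type := RingQuot AdemRel

/-- The Steenrod square `Sqⁱ`. -/
noncomputable def Sq (i : ℕ) : SteenrodAlgebra :=
  RingQuot.mkAlgHom (ZMod 2) AdemRel (FreeAlgebra.ι (ZMod 2) i)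

/-- The action of `Sqⁱ` on a module over the Steenrod algebra, as an `𝔽₂`-linear map. -/
noncomputable def sqEnd (N : Type*) [AddCommGroup N] [Module (ZMod 2) N]
    [Module SteenrodAlgebra N] [IsScalarTower (ZMod 2) SteenrodAlgebra N] (i : ℕ) :
    N →ₗ[ZMod 2] N :=
  Algebra.lsmul (ZMod 2) (ZMod 2) N (Sq i)

/-- The diagonal action of `Sqⁱ` on `M ⊗ N`, given by the Cartan formula
`Sqⁱ (m ⊗ n) = ∑_{p+q=i} Sqᵖ m ⊗ Sq^q n`. -/
noncomputable def sqTensor (M N : Type*) [AddCommGroup M] [Module (ZMod 2) M]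
    [Module SteenrodAlgebra M] [IsScalarTower (ZMod 2) SteenrodAlgebra M]
    [AddCommGroup N] [Module (ZMod 2) N]
    [Module SteenrodAlgebra N] [IsScalarTower (ZMod 2) SteenrodAlgebra N] (i : ℕ) :
    M ⊗[ZMod 2] N →ₗ[ZMod 2] M ⊗[ZMod 2] N :=
  ∑ p ∈ Finset.HasAntidiagonal.antidiagonal i, TensorProduct.map (sqEnd M p.1) (sqEnd N p.2)

/-- `𝓜` makes `M` a `ℤ`-graded module over the Steenrod algebra, `Sqⁱ` having degree `i`. -/
structure IsGradedModule {M : Type*} [AddCommGroup M] [Module (ZMod 2) M]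
    [Module SteenrodAlgebra M] (𝓜 : ℤ → Submodule (ZMod 2) M) : Prop where
  isInternal : DirectSum.IsInternal 𝓜
  sq_mem : ∀ (i : ℕ) (n : ℤ) (x : M), x ∈ 𝓜 n → Sq i • x ∈ 𝓜 (n + i)

/-- A graded free resolution `⋯ → F₁ → F₀ → 𝔽₂` of `𝔽₂` (placed in degree `0`) over the Steenrod
algebra, of finite type, together with ordered homogeneous bases `r*_{s,j}` of the `F_s`.
The positive-degree squares act trivially on `𝔽₂`, and the squares generate the algebra, so
the linearity of the augmentation says that it kills the image of every `Sqⁱ`, `i > 0`. -/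
structure FreeResolution where
  F : ℕ → Type v
  [addCommGroup : ∀ s, AddCommGroup (F s)]
  [moduleF2 : ∀ s, Module (ZMod 2) (F s)]
  [moduleA : ∀ s, Module SteenrodAlgebra (F s)]
  [tower : ∀ s, IsScalarTower (ZMod 2) SteenrodAlgebra (F s)]
  grading : ∀ s, ℤ → Submodule (ZMod 2) (F s)
  isGraded : ∀ s, IsGradedModule (grading s)
  bd : ∀ s, F (s + 1) →ₗ[SteenrodAlgebra] F s
  bd_mem : ∀ s n x, x ∈ grading (s + 1) n → bd s x ∈ grading s n
  aug : F 0 →ₗ[ZMod 2] ZMod 2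
  aug_sq : ∀ i, 0 < i → ∀ x, aug (Sq i • x) = 0
  aug_degree : ∀ n, n ≠ 0 → ∀ x ∈ grading 0 n, aug x = 0
  aug_surjective : Function.Surjective aug
  exact_zero : Function.Exact (bd 0) aug
  exact_succ : ∀ s, Function.Exact (bd (s + 1)) (bd s)
  J : ℕ → Type w
  [order : ∀ s, LinearOrder (J s)]
  basis : ∀ s, Module.Basis (J s) SteenrodAlgebra (F s)
  deg : ∀ s, J s → ℤ
  basis_mem : ∀ s j, basis s j ∈ grading s (deg s j)
  finite_type : ∀ s n, {j | deg s j = n}.Finite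

attribute [instance] FreeResolution.addCommGroup FreeResolution.moduleF2
  FreeResolution.moduleA FreeResolution.tower FreeResolution.order

/-! ### Curtis tables -/

section Curtis

/-- `b i` is the leading term of `x`: the largest basis element with nonzero coefficient
(over `𝔽₂` that coefficient is `1`). -/
def IsLeading {X I : Type*} [AddCommMonoid X] [Module (ZMod 2) X] [LinearOrder I]
    (b : Module.Basis I (ZMod 2) X) (x : X) (i : I) : Prop :=
  b.repr x i ≠ 0 ∧ ∀ j, i < j → b.repr x j = 0

/-- The items of a Curtis table: an untagged label `x`, or a tag `a ← b`. -/
inductive Item (P : Type*)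
  | untagged (x : P)
  | tag (a b : P)

/-- The label by which an item stands in its list: `x` for `x`, and `a` for `a ← b`. -/
def Item.head {P : Type*} : Item P → P
  | .untagged x => x
  | .tag a _ => a

/-- The label `y` appears in the item. -/
def Item.Contains {P : Type*} : Item P → P → Prop
  | .untagged x, y => y = x
  | .tag a b, y => y = a ∨ y = b

/-- `T` is a Curtis table of the complex `X₀ → X₁ → ⋯` with ordered bases `b s`. The list
`L_s` consists of the items of `T` whose head is a label of `X_s`. -/
structure IsCurtisTable {X : ℕ → Type*} [∀ s, AddCommMonoid (X s)] [∀ s, Module (ZMod 2) (X s)]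
    (d : ∀ s, X s →ₗ[ZMod 2] X (s + 1)) {I : ℕ → Type*} [∀ s, LinearOrder (I s)]
    (b : ∀ s, Module.Basis (I s) (ZMod 2) (X s)) (T : Set (Item (Σ s, I s))) : Prop where
  degree : ∀ a c, Item.tag a c ∈ T → a.1 = c.1 + 1
  once : ∀ x : Σ s, I s, ∃! it : Item (Σ s, I s), it ∈ T ∧ it.Contains x
  head_iff : ∀ x : Σ s, I s, (∃ it ∈ T, it.head = x) ↔
    ∃ z : X x.1, d x.1 z = 0 ∧ IsLeading (b x.1) z x.2
  tag_lift : ∀ (s : ℕ) (a : I (s + 1)) (c : I s), Item.tag ⟨s + 1, a⟩ ⟨s, c⟩ ∈ T →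
    ∃ y : X s, IsLeading (b s) y c ∧ IsLeading (b (s + 1)) (d s y) a

end Curtis

/-! ### The spectral sequence of a filtered complex -/

/-- A cochain complex of `𝔽₂`-vector spaces with an increasing filtration by subcomplexes. -/
structure FilteredComplex where
  X : ℕ → Type u
  [addCommGroup : ∀ s, AddCommGroup (X s)]
  [module : ∀ s, Module (ZMod 2) (X s)]
  d : ∀ s, X s →ₗ[ZMod 2] X (s + 1)
  d_d : ∀ s x, d (s + 1) (d s x) = 0
  fil : ℤ → ∀ s, Submodule (ZMod 2) (X s)
  fil_mono : ∀ m n, m ≤ n → ∀ s, fil m s ≤ fil n s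
  d_mem : ∀ n s x, x ∈ fil n s → d s x ∈ fil n (s + 1)

attribute [instance] FilteredComplex.addCommGroup FilteredComplex.module

namespace FilteredComplex

variable (C : FilteredComplex.{u})

/-- The image of `W` under the differential, in each degree. -/
def boundaries (W : ∀ s, Submodule (ZMod 2) (C.X s)) : ∀ s, Submodule (ZMod 2) (C.X s)
  | 0 => ⊥
  | s + 1 => (W s).map (C.d s)

/-- `Z_r^n = {x ∈ G_n : d x ∈ G_{n-r}}`. -/
def Z (r n : ℤ) (s : ℕ) : Submodule (ZMod 2) (C.X s) :=
  C.fil n s ⊓ (C.fil (n - r) (s + 1)).comap (C.d s)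

/-- `Z_{r-1}^{n-1} + d Z_{r-1}^{n+r-1}`. -/
def D (r n : ℤ) (s : ℕ) : Submodule (ZMod 2) (C.X s) :=
  C.Z (r - 1) (n - 1) s ⊔ C.boundaries (C.Z (r - 1) (n + r - 1)) s

/-- `E_r^n = Z_r^n / (Z_{r-1}^{n-1} + d Z_{r-1}^{n+r-1})`. -/
abbrev E (r n : ℤ) (s : ℕ) : Type u := ↥(C.Z r n s) ⧸ (C.D r n s).submoduleOf (C.Z r n s)

/-- `d` restricted to `Z_r^n → Z_r^{n-r}`. -/
def dZ (r n : ℤ) (s : ℕ) : C.Z r n s →ₗ[ZMod 2] C.Z r (n - r) (s + 1) :=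
  (C.d s).restrict fun x hx => by
    refine ⟨hx.2, ?_⟩
    simp [C.d_d]

theorem dZ_mem (r n : ℤ) (s : ℕ) :
    (C.D r n s).submoduleOf (C.Z r n s) ≤
      ((C.D r (n - r) (s + 1)).submoduleOf (C.Z r (n - r) (s + 1))).comap (C.dZ r n s) := by
  intro x hx
  change C.d s x.1 ∈ C.D r (n - r) (s + 1)
  change x.1 ∈ C.D r n s at hx
  obtain ⟨y, hy, z, hz, hyz⟩ := Submodule.mem_sup.1 hx
  have h0 : C.d s z = 0 := by
    cases s with
    | zero =>
      have : z = 0 := by simpa [boundaries] using hz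
      simp [this]
    | succ s =>
      obtain ⟨w, -, rfl⟩ := hz
      exact C.d_d _ _
  rw [← hyz, map_add, h0, add_zero]
  refine Submodule.mem_sup_right ?_
  have he : n - r + r - 1 = n - 1 := by ring
  exact ⟨y, by rw [he]; exact hy, rfl⟩

/-- The differential `d_r : E_r^n → E_r^{n-r}`. -/
def dE (r n : ℤ) (s : ℕ) : C.E r n s →ₗ[ZMod 2] C.E r (n - r) (s + 1) :=
  Submodule.mapQ _ _ (C.dZ r n s) (C.dZ_mem r n s)

/-- The whole page `E_r = ⨁_n E_r^n` in cohomological degree `s`. -/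
abbrev Page (r : ℤ) (s : ℕ) : Type u := DirectSum ℤ fun n => C.E r n s

/-- The differential `d_r` on the whole page. -/
noncomputable def dPage (r : ℤ) (s : ℕ) : C.Page r s →ₗ[ZMod 2] C.Page r (s + 1) :=
  DirectSum.toModule (ZMod 2) ℤ _ fun n =>
    DirectSum.lof (ZMod 2) ℤ (fun n => C.E r n (s + 1)) (n - r) ∘ₗ C.dE r n s

/-- The class in `E_r^n ⊆ E_r` of an element of `Z_r^n`. -/
noncomputable def cls (r n : ℤ) (s : ℕ) : C.Z r n s →ₗ[ZMod 2] C.Page r s :=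
  DirectSum.lof (ZMod 2) ℤ (fun n => C.E r n s) n ∘ₗ Submodule.mkQ _

/-- `Z_∞^n`: the cycles in `G_n`. -/
def Zinf (n : ℤ) (s : ℕ) : Submodule (ZMod 2) (C.X s) := C.fil n s ⊓ LinearMap.ker (C.d s)

/-- `E_∞^n = Z_∞^n / (Z_∞^{n-1} + G_n ∩ im d)`. -/
abbrev Einf (n : ℤ) (s : ℕ) : Type u :=
  ↥(C.Zinf n s) ⧸
    (C.Zinf (n - 1) s ⊔ C.fil n s ⊓ C.boundaries (fun _ => ⊤) s).submoduleOf (C.Zinf n s)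

/-- Compatible labels on the pages of the spectral sequence, with Curtis tables for all pages.
`wt i` is the filtration degree of the basis element `b s i`.
On `E₀` the labels are all basis elements, which represent themselves. The labels of `E_{r+1}` are
the untagged items of a Curtis table of `(E_r, d_r)`, and the label `i` denotes in
`E_{r+1} = H(E_r, d_r)` the class of a homogeneous `d_r`-cycle with leading term `i`
(such a cycle is the class of an element of `Z_{r+1}`). -/
structure LabelledPages {I : ℕ → Type w} [∀ s, LinearOrder (I s)]
    (b : ∀ s, Module.Basis (I s) (ZMod 2) (C.X s)) (wt : ∀ s, I s → ℤ) where
  U : ℕ → ∀ s, Set (I s)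
  β : ∀ (r s : ℕ), Module.Basis (U r s) (ZMod 2) (C.Page r s)
  T : ∀ r : ℕ, Set (Item (Σ s, U r s))
  U_zero : ∀ s, U 0 s = Set.univ
  β_zero : ∀ (s : ℕ) (i : U 0 s), ∃ h : b s i ∈ C.Z (0 : ℕ) (wt s i) s,
    β 0 s i = C.cls (0 : ℕ) (wt s i) s ⟨b s i, h⟩
  isCurtisTable : ∀ r : ℕ, IsCurtisTable (C.dPage r) (β r) (T r)
  U_succ : ∀ (r s : ℕ) (i : I s),
    i ∈ U (r + 1) s ↔ ∃ h : i ∈ U r s, Item.untagged ⟨s, ⟨i, h⟩⟩ ∈ T r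
  β_succ : ∀ (r s : ℕ) (i : U (r + 1) s),
    ∃ (h : i.1 ∈ U r s) (x : C.X s) (hx : x ∈ C.Z r (wt s i) s)
      (hx' : x ∈ C.Z (r + 1 : ℕ) (wt s i) s),
      IsLeading (β r s) (C.cls r (wt s i) s ⟨x, hx⟩) ⟨i.1, h⟩ ∧
      β (r + 1) s i = C.cls (r + 1 : ℕ) (wt s i) s ⟨x, hx'⟩

/-- The tags in the Curtis table of `(E_r, d_r)`: the table of the differential `d_r`. -/
def LabelledPages.tags {C : FilteredComplex.{u}} {I : ℕ → Type w} [∀ s, LinearOrder (I s)]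
    {b : ∀ s, Module.Basis (I s) (ZMod 2) (C.X s)} {wt : ∀ s, I s → ℤ}
    (P : C.LabelledPages b wt) (r : ℕ) : Set (Item (Σ s, I s)) :=
  {it | ∃ a c : Σ s, P.U r s, Item.tag a c ∈ P.T r ∧ it = Item.tag ⟨a.1, a.2.1⟩ ⟨c.1, c.2.1⟩}

end FilteredComplex

/-! ### The complexes `Hom_A(F_*, 𝔽₂)` and `Hom_A(M ⊗ F_*, 𝔽₂)` -/

namespace FreeResolution

variable (R : FreeResolution.{v, w})

/-- `Hom_A(F_s, 𝔽₂)` in internal degree `n`: the functionals on `F_s` that vanish on the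
image of `Sqⁱ` for `i > 0` and on the homogeneous elements of degree other than `n`. -/
def hom (n : ℤ) (s : ℕ) : Submodule (ZMod 2) (Module.Dual (ZMod 2) (R.F s)) where
  carrier := {φ | (∀ i, 0 < i → ∀ x, φ (sqEnd (R.F s) i x) = 0) ∧
    ∀ p, p ≠ n → ∀ x ∈ R.grading s p, φ x = 0}
  add_mem' {φ ψ} hφ hψ := ⟨fun i hi x => by simp [hφ.1 i hi x, hψ.1 i hi x],
    fun p hp x hx => by simp [hφ.2 p hp x hx, hψ.2 p hp x hx]⟩
  zero_mem' := by simp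
  smul_mem' c φ hφ := ⟨fun i hi x => by simp [hφ.1 i hi x],
    fun p hp x hx => by simp [hφ.2 p hp x hx]⟩

/-- The differential of `F_*` as an `𝔽₂`-linear map. -/
def bd₂ (s : ℕ) : R.F (s + 1) →ₗ[ZMod 2] R.F s := (R.bd s).restrictScalars (ZMod 2)

theorem bd₂_sq (s i : ℕ) : R.bd₂ s ∘ₗ sqEnd (R.F (s + 1)) i = sqEnd (R.F s) i ∘ₗ R.bd₂ s := by
  ext x
  exact map_smul (R.bd s) (Sq i) x

/-- The differential `φ ↦ φ ∘ ∂` of `Hom_A(F_*, 𝔽₂)`. -/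
def homD (n : ℤ) (s : ℕ) : R.hom n s →ₗ[ZMod 2] R.hom n (s + 1) :=
  (R.bd₂ s).dualMap.restrict fun φ hφ => by
    refine ⟨fun i hi x => ?_, fun p hp x hx => hφ.2 p hp _ (R.bd_mem s p x hx)⟩
    have := LinearMap.congr_fun (R.bd₂_sq s i) x
    simp only [LinearMap.comp_apply] at this
    rw [LinearMap.dualMap_apply, this]
    exact hφ.1 i hi _

/-- Labels of the dual basis `r_{s,j}` in internal degree `n`. -/
abbrev HomIndex (n : ℤ) (s : ℕ) : Type w := {j : R.J s // R.deg s j = n}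

/-- `ρ` is the basis `r_{s,j}` of `Hom_A(F_s, 𝔽₂)` dual to `r*_{s,j}`. -/
def IsDualHomBasis (ρ : ∀ n s, Module.Basis (R.HomIndex n s) (ZMod 2) (R.hom n s)) : Prop :=
  ∀ n s (j : R.HomIndex n s) (j' : R.J s),
    ((j.1 = j') → (ρ n s j).1 (R.basis s j') = 1) ∧
    ((j.1 ≠ j') → (ρ n s j).1 (R.basis s j') = 0)

variable {M : Type u} [AddCommGroup M] [Module (ZMod 2) M] [Module SteenrodAlgebra M]
  [IsScalarTower (ZMod 2) SteenrodAlgebra M] (𝓜 : ℤ → Submodule (ZMod 2) M)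

/-- `Hom_A(M ⊗ F_s, 𝔽₂)` in internal degree `t`, where the Steenrod algebra acts diagonally on
`M ⊗ F_s`: the functionals that vanish on the image of `Sqⁱ` for `i > 0` and on the homogeneous
elements of total degree other than `t`. -/
def cochain (t : ℤ) (s : ℕ) : Submodule (ZMod 2) (Module.Dual (ZMod 2) (M ⊗[ZMod 2] R.F s)) where
  carrier := {φ | (∀ i, 0 < i → ∀ x, φ (sqTensor M (R.F s) i x) = 0) ∧
    ∀ p q, p + q ≠ t → ∀ m ∈ 𝓜 p, ∀ f ∈ R.grading s q, φ (m ⊗ₜ f) = 0}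
  add_mem' {φ ψ} hφ hψ := ⟨fun i hi x => by simp [hφ.1 i hi x, hψ.1 i hi x],
    fun p q h m hm f hf => by simp [hφ.2 p q h m hm f hf, hψ.2 p q h m hm f hf]⟩
  zero_mem' := by simp
  smul_mem' c φ hφ := ⟨fun i hi x => by simp [hφ.1 i hi x],
    fun p q h m hm f hf => by simp [hφ.2 p q h m hm f hf]⟩

theorem lTensor_sq (s i : ℕ) :
    (R.bd₂ s).lTensor M ∘ₗ sqTensor M (R.F (s + 1)) i =
      sqTensor M (R.F s) i ∘ₗ (R.bd₂ s).lTensor M := by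
  ext x y
  have h := fun p : ℕ => LinearMap.congr_fun (R.bd₂_sq s p) y
  simp only [LinearMap.comp_apply] at h
  simp [sqTensor, h]

/-- The differential `φ ↦ φ ∘ (1 ⊗ ∂)` of `Hom_A(M ⊗ F_*, 𝔽₂)`. -/
noncomputable def cochainD (t : ℤ) (s : ℕ) :
    R.cochain 𝓜 t s →ₗ[ZMod 2] R.cochain 𝓜 t (s + 1) :=
  ((R.bd₂ s).lTensor M).dualMap.restrict fun φ hφ => by
    refine ⟨fun i hi x => ?_, fun p q h m hm f hf => ?_⟩
    · have := LinearMap.congr_fun (R.lTensor_sq (M := M) s i) x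
      simp only [LinearMap.comp_apply] at this
      rw [LinearMap.dualMap_apply, this]
      exact hφ.1 i hi _
    · rw [LinearMap.dualMap_apply, LinearMap.lTensor_tmul]
      exact hφ.2 p q h m hm _ (R.bd_mem s q f hf)

/-- The complex `Hom_A(M ⊗ F_*, 𝔽₂)` in internal degree `t`, filtered by the degree in `M`: the
`n`-th stage consists of the functionals that vanish on `M^{>n} ⊗ F_*`. Its spectral
sequence is the algebraic Atiyah–Hirzebruch spectral sequence of `M`. -/
noncomputable def ahComplex (t : ℤ) : FilteredComplex where
  X s := R.cochain 𝓜 t s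
  d s := R.cochainD 𝓜 t s
  d_d s φ := by
    ext x y
    have h : R.bd s (R.bd (s + 1) y) = 0 := (R.exact_succ s).apply_apply_eq_zero y
    change φ.1 ((R.bd₂ s).lTensor M ((R.bd₂ (s + 1)).lTensor M (x ⊗ₜ y))) = 0
    rw [LinearMap.lTensor_tmul, LinearMap.lTensor_tmul]
    change φ.1 (x ⊗ₜ R.bd s (R.bd (s + 1) y)) = 0
    rw [h, TensorProduct.tmul_zero, map_zero]
  fil n s :=
    { carrier := {φ | ∀ p, n < p → ∀ m ∈ 𝓜 p, ∀ f, φ.1 (m ⊗ₜ f) = 0}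
      add_mem' := fun {φ ψ} hφ hψ p hp m hm f => by simp [hφ p hp m hm f, hψ p hp m hm f]
      zero_mem' := by simp
      smul_mem' := fun c φ hφ p hp m hm f => by simp [hφ p hp m hm f] }
  fil_mono m n h s φ hφ p hp := hφ p (lt_of_le_of_lt h hp)
  d_mem n s φ hφ p hp m hm f := by
    change φ.1 ((R.bd₂ s).lTensor M (m ⊗ₜ f)) = 0
    rw [LinearMap.lTensor_tmul]
    exact hφ p hp m hm _

/-- Labels of the dual basis `e_k ⊗ r_{s,j}` in internal degree `t`, in lexicographic order;
`degM k` is the degree of `e_k`. -/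
abbrev Index {K : Type*} (degM : K → ℤ) (t : ℤ) (s : ℕ) : Type _ :=
  {p : K ×ₗ R.J s // degM (ofLex p).1 + R.deg s (ofLex p).2 = t}

/-- The filtration degree of `e_k ⊗ r_{s,j}`: the degree of `e_k`. -/
def wt {K : Type*} (degM : K → ℤ) (t : ℤ) (s : ℕ) (p : R.Index degM t s) : ℤ :=
  degM (ofLex p.1).1

/-- `β` is the basis `e_k ⊗ r_{s,j}` of `Hom_A(M ⊗ F_s, 𝔽₂)` dual to `e*_k ⊗ r*_{s,j}`. -/
def IsDualBasis {K : Type*} (e : Module.Basis K (ZMod 2) M) (degM : K → ℤ)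
    (β : ∀ t s, Module.Basis (R.Index degM t s) (ZMod 2) ((R.ahComplex 𝓜 t).X s)) : Prop :=
  ∀ t s (p : R.Index degM t s) (k' : K) (j' : R.J s),
    ((ofLex p.1 = (k', j')) →
      (show R.cochain 𝓜 t s from β t s p).1 (e k' ⊗ₜ R.basis s j') = 1) ∧
    ((ofLex p.1 ≠ (k', j')) →
      (show R.cochain 𝓜 t s from β t s p).1 (e k' ⊗ₜ R.basis s j') = 0)

/-- The tags `e_k ⊗ a ← e_k ⊗ c` in internal degree `t`, for the tags `a ← c` in the Curtis
tables `TF n` of `Hom_A(F_*, 𝔽₂)` (one for each internal degree `n`). -/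
def resolutionTags {K : Type*} (degM : K → ℤ) (TF : ∀ n, Set (Item (Σ s, R.HomIndex n s)))
    (t : ℤ) : Set (Item (Σ s, R.Index degM t s)) :=
  {it | ∃ (k : K) (n : ℤ) (h : degM k + n = t) (a c : Σ s, R.HomIndex n s),
    Item.tag a c ∈ TF n ∧
    it = Item.tag ⟨a.1, toLex (k, a.2.1), by simpa [a.2.2] using h⟩
      ⟨c.1, toLex (k, c.2.1), by simpa [c.2.2] using h⟩}

end FreeResolution

end CurtisAHSS

/-! A Curtis table records Gaussian elimination with respect to an ordered basis. Given a table,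
there is a triangular change of basis after which the differential sends the source of each tag to
its head and every other basis element to zero (`IsCurtisTable.exists_isAdapted`). Hence the sources
are the labels that lead no cycle, and the head of the tag with source `c` is the least leading term
of `d y` over all `y` with leading term `c`. This description does not refer to the table, so tables
are unique; taken as a definition, it also gives existence (`exists_isCurtisTable`).

For the spectral sequence, the point is that the basis is ordered first by the degree of `e_k`, so
the leading term of an element determines its exact filtration. Induction over the pages shows that
leading terms on `E_r` are leading terms in the complex: each label is represented by an element of
`Z_r` with this leading term, and the leading terms of boundaries that are already zero on `E_r` are
no longer labels. Therefore a tag on a page lifts to an element and its boundary with the same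
leading terms. The tags of all pages, together with the labels that survive to every page, satisfy
the axioms of a Curtis table of the complex itself (`isCurtisTable_totalTable`), and uniqueness
identifies this table with the given one. Lifts of tags can be chosen homogeneous, so a tag on `E_r`
lowers the degree by exactly `r`. Conversely, labels exist because an adapted basis splits the
complex into lines and pairs, whose pages can be written down.

It remains to recognise `E₀`. The dual functional is `m ⊗ f ↦ e_k (χ(f_j) m)`, where `χ` is
conjugation. Between basis elements of equal degree `χ(a)` acts through the augmentation, so the
matrix of `d₀` consists of one copy of the matrix of `Hom_A(F_*, 𝔽₂)` for each `k`
(`isCurtisTable_blockTable`).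

The conjugation has to be constructed from the presentation. The Adem relations are equivalent to
the Bullett–Macdonald identity of generating series; inverting both sides shows that the
coefficients of the inverse of the total square satisfy the Adem relations in the opposite algebra.
-/

namespace CurtisAHSS

/-! ### The Adem relations and the Bullett–Macdonald identity -/

/-! ### Conjugation in the Steenrod algebra, built from the presentation -/

section BullettMacdonald

open Polynomial Finset

variable {B : Type*} [AddCommGroup B] [Module (ZMod 2) B]

/-- The degree `n` part of the Bullett–Macdonald identity
`P(s² + s) P(1) = P(1 + s) P(s²)` for a family `x (a, b)` in place of the products
`Sqᵃ Sqᵇ`, compared coefficient by coefficient in `s`. -/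
def BullettMacdonald (x : ℕ × ℕ → B) (n : ℕ) : Prop :=
  ∀ i, ∑ p ∈ antidiagonal n, ((X + X ^ 2 : (ZMod 2)[X]) ^ p.1).coeff i • x p =
    ∑ p ∈ antidiagonal n, ((1 + X : (ZMod 2)[X]) ^ p.1 * X ^ (2 * p.2)).coeff i • x p

/-- The Adem relation for a family `x (a, b)` in place of the products `Sqᵃ Sqᵇ`. -/
def AdemAt (x : ℕ × ℕ → B) (a b : ℕ) : Prop :=
  x (a, b) = ∑ j ∈ range (a / 2 + 1),
    (Nat.choose (b - 1 - j) (a - 2 * j) : ZMod 2) • x (a + b - j, j)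

/-- In characteristic 2 the geometric series inverts `1 + X`; its powers serve as the negative
powers of `1 + X` below. -/
theorem one_add_X_mul_mk_one :
    (1 + PowerSeries.X : PowerSeries (ZMod 2)) * PowerSeries.mk 1 = 1 := by
  have h := PowerSeries.mk_one_mul_one_sub_eq_one (ZMod 2)
  have e : (1 - PowerSeries.X : PowerSeries (ZMod 2)) = 1 + PowerSeries.X := by
    ext n
    rw [map_sub, map_add, CharTwo.sub_eq_add]
  rwa [e, mul_comm] at h

theorem one_add_X_pow_mul_mk_one_pow (k l : ℕ) :
    (1 + PowerSeries.X : PowerSeries (ZMod 2)) ^ k * PowerSeries.mk 1 ^ (k + l) =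
      PowerSeries.mk 1 ^ l := by
  rw [pow_add, ← mul_assoc, ← mul_pow, one_add_X_mul_mk_one, one_pow, one_mul]

theorem one_add_X_pow_add_mul_mk_one_pow (k l : ℕ) :
    (1 + PowerSeries.X : PowerSeries (ZMod 2)) ^ (l + k) * PowerSeries.mk 1 ^ k =
      (1 + PowerSeries.X) ^ l := by
  rw [pow_add, mul_assoc, ← mul_pow, one_add_X_mul_mk_one, one_pow, mul_one]

/-- A residue computation: in `𝔽₂⟦s⟧`, the coefficient of `s^a` in
`(s + s²)^k (1 + s)^(-a-1)` is the Kronecker delta. -/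
theorem coeff_residue (a k : ℕ) :
    PowerSeries.coeff a ((((X + X ^ 2) ^ k : (ZMod 2)[X]) : PowerSeries (ZMod 2)) *
      PowerSeries.mk 1 ^ (a + 1)) = if k = a then 1 else 0 := by
  have hu : (X + X ^ 2 : (ZMod 2)[X]) = X * (1 + X) := by ring
  have hc : (((X + X ^ 2 : (ZMod 2)[X]) ^ k : (ZMod 2)[X]) : PowerSeries (ZMod 2)) =
      PowerSeries.X ^ k * (1 + PowerSeries.X) ^ k := by
    rw [hu, mul_pow]; simp
  rw [hc, mul_assoc, PowerSeries.coeff_X_pow_mul']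
  rcases lt_trichotomy k a with h | rfl | h
  · obtain ⟨m, rfl⟩ := Nat.exists_eq_add_of_lt h
    rw [if_pos (by omega), if_neg (by omega)]
    have e1 : k + m + 1 + 1 = k + (m + 1 + 1) := by ring
    have e2 : k + m + 1 - k = m + 1 := by omega
    rw [e1, one_add_X_pow_mul_mk_one_pow, PowerSeries.mk_one_pow_eq_mk_choose_add, e2,
      PowerSeries.coeff_mk]
    -- For `k < a` the coefficient is the central binomial coefficient of `a - k`, which is even.
    have h2 := Nat.two_dvd_centralBinom_of_one_le (n := m + 1) (by omega)
    rw [Nat.centralBinom_eq_two_mul_choose, two_mul] at h2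
    exact (ZMod.natCast_eq_zero_iff _ 2).2 h2
  · rw [if_pos le_rfl, if_pos rfl, one_add_X_pow_mul_mk_one_pow]
    simp
  · rw [if_neg (by omega), if_neg (by omega)]

/-- A coefficient of `f V` is a fixed linear combination of the coefficients of `f`, so an identity
that holds coefficient by coefficient may be multiplied by a power series, in particular by a
negative power of `1 + s`. -/
theorem coeff_mul_smul_sum {n : ℕ} {x : ℕ × ℕ → B} {f g : ℕ × ℕ → (ZMod 2)[X]}
    (h : ∀ i, ∑ p ∈ antidiagonal n, (f p).coeff i • x p =
      ∑ p ∈ antidiagonal n, (g p).coeff i • x p) (V : PowerSeries (ZMod 2)) (a : ℕ) :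
    ∑ p ∈ antidiagonal n, PowerSeries.coeff a ((f p : PowerSeries (ZMod 2)) * V) • x p =
      ∑ p ∈ antidiagonal n, PowerSeries.coeff a ((g p : PowerSeries (ZMod 2)) * V) • x p := by
  have key : ∀ f : ℕ × ℕ → (ZMod 2)[X],
      ∑ p ∈ antidiagonal n, PowerSeries.coeff a ((f p : PowerSeries (ZMod 2)) * V) • x p =
      ∑ q ∈ antidiagonal a, PowerSeries.coeff q.2 V •
        ∑ p ∈ antidiagonal n, (f p).coeff q.1 • x p := by
    intro f
    simp only [PowerSeries.coeff_mul, Finset.sum_smul, Finset.smul_sum, Polynomial.coeff_coe]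
    rw [Finset.sum_comm]
    simp only [smul_smul, mul_comm]
  rw [key, key]
  simp only [h]

/-- Multiply by `(1 + s)^(-a-1)` and take the coefficient of `s^a`. The residue computation isolates
`x (a, b)` on the left. On the right, `s^(2j) (1 + s)^(b-1-j)` contributes the binomial coefficient
of the Adem relation; the exponent is nonnegative whenever the term matters, since `j ≤ a/2 < b`. -/
theorem BullettMacdonald.ademAt {x : ℕ × ℕ → B} {a b : ℕ} (h : BullettMacdonald x (a + b))
    (hab : a < 2 * b) : AdemAt x a b := by
  have h1 := coeff_mul_smul_sum h (PowerSeries.mk 1 ^ (a + 1)) a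
  simp only [coeff_residue] at h1
  rw [Finset.sum_eq_single (a, b) ?_ (by simp)] at h1
  swap
  · rintro ⟨k, l⟩ hk hne
    rw [if_neg, zero_smul]
    rintro rfl
    simp at hk
    exact hne (by simp [hk])
  rw [if_pos rfl, one_smul] at h1
  rw [AdemAt, h1]
  have hco : ∀ p ∈ antidiagonal (a + b), PowerSeries.coeff a
      ((((1 + X : (ZMod 2)[X]) ^ p.1 * X ^ (2 * p.2) : (ZMod 2)[X]) : PowerSeries (ZMod 2)) *
        PowerSeries.mk 1 ^ (a + 1)) • x p =
      if p.2 < a / 2 + 1 then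
        (Nat.choose (b - 1 - p.2) (a - 2 * p.2) : ZMod 2) • x (a + b - p.2, p.2) else 0 := by
    rintro ⟨k, j⟩ hk
    simp only [HasAntidiagonal.mem_antidiagonal] at hk
    have hc : (((1 + X : (ZMod 2)[X]) ^ k * X ^ (2 * j) : (ZMod 2)[X]) : PowerSeries (ZMod 2)) =
        PowerSeries.X ^ (2 * j) * (1 + PowerSeries.X) ^ k := by
      simp [mul_comm]
    simp only [hc, mul_assoc, PowerSeries.coeff_X_pow_mul']
    by_cases hj : 2 * j ≤ a
    · rw [if_pos hj, if_pos (by omega)]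
      have e1 : k = (b - 1 - j) + (a + 1) := by omega
      have e2 : a + b - j = k := by omega
      rw [e2]
      conv_lhs => rw [e1, one_add_X_pow_add_mul_mk_one_pow]
      have e3 : ((1 + PowerSeries.X : PowerSeries (ZMod 2)) ^ (b - 1 - j)) =
          (((1 + X : (ZMod 2)[X]) ^ (b - 1 - j) : (ZMod 2)[X]) : PowerSeries (ZMod 2)) := by simp
      rw [e3, Polynomial.coeff_coe, Polynomial.coeff_one_add_X_pow, ← e1]
    · rw [if_neg hj, if_neg (by omega), zero_smul]
  rw [Finset.sum_congr rfl hco, ← Finset.sum_filter]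
  refine Finset.sum_nbij' (fun p => p.2) (fun j => (a + b - j, j)) ?_ ?_ ?_ ?_ ?_
  · simp
  · intro j hj
    simp only [Finset.mem_range] at hj
    simp only [mem_filter, HasAntidiagonal.mem_antidiagonal]
    omega
  · rintro ⟨k, j⟩ hk
    simp only [mem_filter, HasAntidiagonal.mem_antidiagonal] at hk
    simp only [Prod.mk.injEq, and_true]
    omega
  · simp
  · simp

/-- The coefficient of `Aᵃ Bᵇ` in `(A + B)^(n-3j) (A²B)^j`, where `a + b = n`. -/
def dicksonCoeff (n j : ℕ) (p : ℕ × ℕ) : ZMod 2 :=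
  if j ≤ p.2 then (Nat.choose (n - 3 * j) (p.2 - j) : ZMod 2) else 0

theorem sum_dicksonCoeff {n j : ℕ} (hj : 3 * j ≤ n) (f g : (ZMod 2)[X]) :
    ∑ p ∈ antidiagonal n, C (dicksonCoeff n j p) * (f ^ p.1 * g ^ p.2) =
      (f + g) ^ (n - 3 * j) * (f ^ (2 * j) * g ^ j) := by
  rw [add_comm f g, (Commute.all g f).add_pow', Finset.sum_mul]
  symm
  refine Finset.sum_of_injOn (fun p => (p.2 + 2 * j, p.1 + j)) ?_ ?_ ?_ ?_
  · rintro ⟨a, b⟩ _ ⟨c, d⟩ _ h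
    simp only [Prod.mk.injEq] at h ⊢
    omega
  · rintro ⟨a, b⟩ h
    simp only [mem_coe, HasAntidiagonal.mem_antidiagonal] at h ⊢
    omega
  · rintro ⟨a, b⟩ h hn
    simp only [HasAntidiagonal.mem_antidiagonal] at h
    rw [dicksonCoeff]
    split_ifs with hb
    · simp only at hb
      rw [Nat.choose_eq_zero_of_lt, Nat.cast_zero, C_0, zero_mul]
      by_contra hc
      push Not at hc
      refine hn ⟨(b - j, a - 2 * j), ?_, ?_⟩
      · simp only at hc
        simp only [mem_coe, HasAntidiagonal.mem_antidiagonal]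
        omega
      · simp only at hc
        simp only [Prod.mk.injEq]
        omega
    · simp
  · rintro ⟨a, b⟩ h
    simp only [HasAntidiagonal.mem_antidiagonal] at h
    simp only [dicksonCoeff, le_add_iff_nonneg_left, zero_le, if_true, Nat.add_sub_cancel]
    rw [nsmul_eq_mul, pow_add, pow_add]
    simp only [map_natCast]
    ring

/-- The substitutions `(A, B) = (s + s², 1)` and `(1 + s, s²)` give the same value `1 + s + s²` to
`A + B` and the same value `s² (1 + s)²` to `A² B`. The coefficients of any polynomial in these two
expressions therefore solve the identity. -/
theorem bullettMacdonald_dicksonCoeff {n j : ℕ} (hj : 3 * j ≤ n) :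
    BullettMacdonald (dicksonCoeff n j) n := by
  have h1 := sum_dicksonCoeff hj (X + X ^ 2) 1
  have h2 := sum_dicksonCoeff hj (1 + X) (X ^ 2)
  have h3 : (X + X ^ 2 + 1 : (ZMod 2)[X]) ^ (n - 3 * j) * ((X + X ^ 2) ^ (2 * j) * 1 ^ j) =
      (1 + X + X ^ 2) ^ (n - 3 * j) * ((1 + X) ^ (2 * j) * (X ^ 2) ^ j) := by
    have e1 : (X + X ^ 2 + 1 : (ZMod 2)[X]) = 1 + X + X ^ 2 := by ring
    have e2 : (X + X ^ 2 : (ZMod 2)[X]) = (1 + X) * X := by ring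
    rw [e1, e2, mul_pow, one_pow, mul_one, ← pow_mul]
  intro i
  have h4 := congrArg (fun q => q.coeff i) (h1.trans (h3.trans h2.symm))
  simp only [finsetSum_coeff, coeff_C_mul, one_pow, mul_one, ← pow_mul] at h4
  simpa only [smul_eq_mul, mul_comm] using h4

/-- Solution of a unitriangular system of linear equations. -/
noncomputable def triangularSolution (c : ℕ → ℕ → ZMod 2) (z : ℕ → B) : ℕ → B
  | m => z m - ∑ j : Fin m, c m j • triangularSolution c z j

theorem sum_triangularSolution (c : ℕ → ℕ → ZMod 2) (hc : ∀ m, c m m = 1) (z : ℕ → B) (m : ℕ) :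
    ∑ j ∈ range (m + 1), c m j • triangularSolution c z j = z m := by
  rw [Finset.sum_range_succ, hc, one_smul, triangularSolution.eq_def c z m,
    Finset.sum_range (fun j => c m j • triangularSolution c z j)]
  exact add_sub_cancel _ _

theorem BullettMacdonald.smul_const {f : ℕ × ℕ → ZMod 2} {n : ℕ} (h : BullettMacdonald f n)
    (y : B) : BullettMacdonald (fun p => f p • y) n := by
  intro i
  have := congrArg (fun c : ZMod 2 => c • y) (h i)
  simpa only [Finset.sum_smul, smul_assoc] using this

theorem BullettMacdonald.sum {ι : Type*} (S : Finset ι) {x : ι → ℕ × ℕ → B} {n : ℕ}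
    (h : ∀ j ∈ S, BullettMacdonald (x j) n) : BullettMacdonald (fun p => ∑ j ∈ S, x j p) n := by
  intro i
  simp only [Finset.smul_sum]
  rw [Finset.sum_comm, Finset.sum_comm (s := antidiagonal n)]
  exact Finset.sum_congr rfl fun j hj => h j hj i

/-- The Adem relations imply the Bullett–Macdonald identity. -/
theorem bullettMacdonald_of_ademAt {x : ℕ × ℕ → B} {n : ℕ}
    (h : ∀ a b, a + b = n → a < 2 * b → AdemAt x a b) : BullettMacdonald x n := by
  -- On the admissible pairs `(n - m, m)`, `3m ≤ n`, the `j`-th solution is `0` for `m < j` and `1`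
  -- for `m = j`. By this triangularity some combination `w` of the solutions agrees with `x` on all
  -- admissible pairs.
  set y := triangularSolution (fun m j => dicksonCoeff n j (n - m, m)) fun m => x (n - m, m)
    with hy
  set w : ℕ × ℕ → B := fun p => ∑ j ∈ range (n / 3 + 1), dicksonCoeff n j p • y j with hw
  have hwBM : BullettMacdonald w n := BullettMacdonald.sum _ fun j hj =>
    (bullettMacdonald_dicksonCoeff (by simp only [Finset.mem_range] at hj; omega)).smul_const _
  have hadm : ∀ m, 3 * m ≤ n → w (n - m, m) = x (n - m, m) := by
    intro m hm
    have h1 := sum_triangularSolution (fun m j => dicksonCoeff n j (n - m, m))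
      (by simp [dicksonCoeff]) (fun m => x (n - m, m)) m
    rw [← h1, hw]
    symm
    refine Finset.sum_subset ?_ ?_
    · intro j; simp only [Finset.mem_range]; omega
    · intro j _ hj
      simp only [Finset.mem_range] at hj
      simp only [dicksonCoeff]
      rw [if_neg (by omega), zero_smul]
  -- The Adem relations express every other pair through admissible ones. They hold for `x` by
  -- hypothesis and for `w` because `w` solves the identity.
  have hall : ∀ p ∈ antidiagonal n, w p = x p := by
    rintro ⟨a, b⟩ hp
    simp only [HasAntidiagonal.mem_antidiagonal] at hp
    by_cases hab : a < 2 * b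
    · have h1 : AdemAt w a b := by
        refine BullettMacdonald.ademAt ?_ hab
        rwa [hp]
      rw [h a b hp hab, h1]
      refine Finset.sum_congr rfl fun j hj => ?_
      simp only [Finset.mem_range] at hj
      rw [hp, hadm j (by omega)]
    · have e : a = n - b := by omega
      rw [e]
      exact hadm b (by omega)
  intro i
  have h1 := hwBM i
  have key : ∀ f : ℕ × ℕ → ZMod 2,
      ∑ p ∈ antidiagonal n, f p • w p = ∑ p ∈ antidiagonal n, f p • x p := fun f =>
    Finset.sum_congr rfl fun p hp => by rw [hall p hp]
  rwa [key, key] at h1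

end BullettMacdonald

/-! ### The antipode of the Steenrod algebra -/

section Antipode

open Polynomial Finset

/-- The series `∑ aₙ uⁿ τⁿ` for central `u`. -/
noncomputable def scaledSeries {A : Type*} [Ring A] [Algebra (ZMod 2) A] (a : ℕ → A)
    (u : (ZMod 2)[X]) : PowerSeries A[X] :=
  PowerSeries.mk fun n => C (a n) * (u ^ n).map (algebraMap (ZMod 2) A)

variable {A : Type*} [Ring A] [Algebra (ZMod 2) A]

theorem commute_map_algebraMap (u : (ZMod 2)[X]) (f : A[X]) :
    Commute (u.map (algebraMap (ZMod 2) A)) f := by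
  induction u using Polynomial.induction_on' with
  | add p q hp hq => rw [Polynomial.map_add]; exact hp.add_left hq
  | monomial n r =>
    rw [Polynomial.map_monomial, ← C_mul_X_pow_eq_monomial]
    refine Commute.mul_left ?_ ((commute_X f).pow_left n)
    rw [← Polynomial.algebraMap_apply]
    exact Algebra.commutes r f

theorem coeff_scaledSeries_mul (a b : ℕ → A) (u v : (ZMod 2)[X]) (n : ℕ) :
    PowerSeries.coeff n (scaledSeries a u * scaledSeries b v) =
      ∑ p ∈ antidiagonal n, C (a p.1 * b p.2) *
        (u ^ p.1 * v ^ p.2).map (algebraMap (ZMod 2) A) := by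
  rw [PowerSeries.coeff_mul]
  refine Finset.sum_congr rfl fun p _ => ?_
  simp only [scaledSeries, PowerSeries.coeff_mk]
  rw [mul_assoc, ← mul_assoc _ (C (b p.2)), (commute_map_algebraMap _ (C (b p.2))).eq,
    Polynomial.map_mul, C_mul]
  simp only [mul_assoc]

theorem coeff_C_mul_map (x : A) (w : (ZMod 2)[X]) (i : ℕ) :
    (C x * w.map (algebraMap (ZMod 2) A)).coeff i = w.coeff i • x := by
  rw [coeff_C_mul, coeff_map, Algebra.smul_def, Algebra.commutes]

theorem scaledSeries_mul_eq_iff (a b a' b' : ℕ → A) (u v u' v' : (ZMod 2)[X]) :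
    scaledSeries a u * scaledSeries b v = scaledSeries a' u' * scaledSeries b' v' ↔
      ∀ n i, ∑ p ∈ antidiagonal n, (u ^ p.1 * v ^ p.2).coeff i • (a p.1 * b p.2) =
        ∑ p ∈ antidiagonal n, (u' ^ p.1 * v' ^ p.2).coeff i • (a' p.1 * b' p.2) := by
  simp only [PowerSeries.ext_iff, Polynomial.ext_iff, coeff_scaledSeries_mul, finsetSum_coeff,
    coeff_C_mul_map]

/-- Substituting `u τ` for `τ` with `u` central is multiplicative, hence preserves inverses. -/
theorem scaledSeries_mul_eq_one {a b : ℕ → A}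
    (h : PowerSeries.mk a * PowerSeries.mk b = 1) (u : (ZMod 2)[X]) :
    scaledSeries a u * scaledSeries b u = 1 := by
  ext n : 1
  rw [coeff_scaledSeries_mul]
  have h1 := congrArg (PowerSeries.coeff n) h
  simp only [PowerSeries.coeff_mul, PowerSeries.coeff_mk, PowerSeries.coeff_one] at h1
  have h2 : ∑ p ∈ antidiagonal n, C (a p.1 * b p.2) *
        (u ^ p.1 * u ^ p.2).map (algebraMap (ZMod 2) A) =
      C (∑ p ∈ antidiagonal n, a p.1 * b p.2) * (u ^ n).map (algebraMap (ZMod 2) A) := by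
    rw [map_sum, Finset.sum_mul]
    refine Finset.sum_congr rfl fun p hp => ?_
    rw [← pow_add, HasAntidiagonal.mem_antidiagonal.1 hp]
  rw [h2, h1, PowerSeries.coeff_one]
  split_ifs with hn
  · simp [hn]
  · simp

theorem Sq_zero : Sq 0 = 1 := by
  rw [Sq, RingQuot.mkAlgHom_rel (ZMod 2) AdemRel.sq_zero, map_one]

theorem ademAt_Sq {a b : ℕ} (hab : a < 2 * b) :
    AdemAt (fun p : ℕ × ℕ => Sq p.1 * Sq p.2) a b := by
  rw [AdemAt]
  rcases Nat.eq_zero_or_pos a with rfl | ha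
  · simp [Sq_zero]
  · have h := RingQuot.mkAlgHom_rel (ZMod 2) (AdemRel.adem a b ha hab)
    simpa only [map_mul, map_sum, map_smul, Sq] using h

/-- The total square `∑ Sqⁿ τⁿ`. -/
noncomputable def totalSq : PowerSeries SteenrodAlgebra := PowerSeries.mk Sq

/-- The conjugate square: the coefficients of the inverse of the total square. -/
noncomputable def conjSq (n : ℕ) : SteenrodAlgebra :=
  PowerSeries.coeff n (PowerSeries.invOfUnit totalSq 1)

theorem constantCoeff_totalSq : PowerSeries.constantCoeff totalSq = ((1 : SteenrodAlgebraˣ) :) := by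
  rw [← PowerSeries.coeff_zero_eq_constantCoeff_apply, totalSq, PowerSeries.coeff_mk, Sq_zero,
    Units.val_one]

theorem mk_conjSq : PowerSeries.mk conjSq = PowerSeries.invOfUnit totalSq 1 := by
  ext n
  simp [conjSq]

theorem mk_Sq_mul_mk_conjSq : PowerSeries.mk Sq * PowerSeries.mk conjSq = 1 := by
  rw [mk_conjSq]
  exact PowerSeries.mul_invOfUnit _ _ constantCoeff_totalSq

theorem mk_conjSq_mul_mk_Sq : PowerSeries.mk conjSq * PowerSeries.mk Sq = 1 := by
  rw [mk_conjSq]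
  exact PowerSeries.invOfUnit_mul _ _ constantCoeff_totalSq

theorem conjSq_zero : conjSq 0 = 1 := by
  have h := congrArg (PowerSeries.coeff 0) mk_Sq_mul_mk_conjSq
  simpa [PowerSeries.coeff_mul, Sq_zero] using h

theorem sum_conjSq_mul_Sq {n : ℕ} (hn : 0 < n) :
    ∑ p ∈ antidiagonal n, conjSq p.1 * Sq p.2 = 0 := by
  have h := congrArg (PowerSeries.coeff n) mk_conjSq_mul_mk_Sq
  simpa only [PowerSeries.coeff_mul, PowerSeries.coeff_mk, PowerSeries.coeff_one, hn.ne',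
    if_false] using h

theorem scaledSeries_Sq :
    scaledSeries Sq (X + X ^ 2) * scaledSeries Sq 1 =
      scaledSeries Sq (1 + X) * scaledSeries Sq (X ^ 2) := by
  rw [scaledSeries_mul_eq_iff]
  intro n i
  have h := bullettMacdonald_of_ademAt (n := n) (fun a b _ hab => ademAt_Sq hab) i
  simpa only [one_pow, mul_one, ← pow_mul] using h

/-- Both sides are inverses of the series in `scaledSeries_Sq`: inversion replaces squares by
conjugate squares and reverses each product. -/
theorem scaledSeries_conjSq :
    scaledSeries conjSq 1 * scaledSeries conjSq (X + X ^ 2) =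
      scaledSeries conjSq (X ^ 2) * scaledSeries conjSq (1 + X) := by
  have hr := scaledSeries_mul_eq_one mk_Sq_mul_mk_conjSq
  have hl := scaledSeries_mul_eq_one mk_conjSq_mul_mk_Sq
  refine left_inv_eq_right_inv (a := scaledSeries Sq (X + X ^ 2) * scaledSeries Sq 1) ?_ ?_
  · rw [mul_assoc, ← mul_assoc _ (scaledSeries Sq (X + X ^ 2)), hl, one_mul, hl]
  · rw [scaledSeries_Sq, mul_assoc, ← mul_assoc (scaledSeries Sq (X ^ 2)), hr, one_mul, hr]

/-- The reversal of factors makes `scaledSeries_conjSq` the Bullett–Macdonald identity in the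
opposite algebra. This is what makes the antipode well defined. -/
theorem ademAt_conjSq {a b : ℕ} (hab : a < 2 * b) :
    AdemAt (fun p : ℕ × ℕ => conjSq p.2 * conjSq p.1) a b := by
  refine BullettMacdonald.ademAt ?_ hab
  intro i
  have h := (scaledSeries_mul_eq_iff _ _ _ _ _ _ _ _).1 scaledSeries_conjSq (a + b) i
  rw [← Finset.Nat.sum_antidiagonal_swap, ← Finset.Nat.sum_antidiagonal_swap (n := a + b)
    (f := fun p => (((X ^ 2) ^ p.1 * (1 + X) ^ p.2 : (ZMod 2)[X]).coeff i) •
      (conjSq p.1 * conjSq p.2))] at h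
  simpa only [Prod.fst_swap, Prod.snd_swap, one_pow, one_mul, ← pow_mul,
    mul_comm (X ^ _) ((1 + X : (ZMod 2)[X]) ^ _)] using h

/-- The antipode of the Steenrod algebra, as a homomorphism to the opposite algebra. -/
noncomputable def antipode : SteenrodAlgebra →ₐ[ZMod 2] SteenrodAlgebraᵐᵒᵖ :=
  RingQuot.liftAlgHom (ZMod 2) ⟨FreeAlgebra.lift (ZMod 2) fun i => MulOpposite.op (conjSq i), by
    intro x y hxy
    cases hxy with
    | sq_zero => simp [conjSq_zero]
    | adem a b ha hab =>
      have h := congrArg MulOpposite.op (ademAt_conjSq hab)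
      rw [MulOpposite.op_mul] at h
      simp only [map_mul, map_sum, map_smul, FreeAlgebra.lift_ι_apply, h]
      simp⟩

theorem antipode_Sq (i : ℕ) : antipode (Sq i) = MulOpposite.op (conjSq i) := by
  rw [antipode, Sq, RingQuot.liftAlgHom_mkAlgHom_apply, FreeAlgebra.lift_ι_apply]

/-- The augmentation of the Steenrod algebra. -/
noncomputable def augmentation : SteenrodAlgebra →ₐ[ZMod 2] ZMod 2 :=
  RingQuot.liftAlgHom (ZMod 2) ⟨FreeAlgebra.lift (ZMod 2) fun i => if i = 0 then 1 else 0, by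
    intro x y hxy
    cases hxy with
    | sq_zero => simp
    | adem a b ha hab =>
      simp only [map_mul, map_sum, map_smul, FreeAlgebra.lift_ι_apply]
      rw [if_neg ha.ne', zero_mul, Finset.sum_eq_zero]
      intro j hj
      simp only [Finset.mem_range] at hj
      rw [if_neg (by omega), zero_mul, smul_zero]⟩

theorem augmentation_Sq {i : ℕ} (hi : 0 < i) : augmentation (Sq i) = 0 := by
  rw [augmentation, Sq, RingQuot.liftAlgHom_mkAlgHom_apply, FreeAlgebra.lift_ι_apply,
    if_neg hi.ne']

end Antipode

end CurtisAHSS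

/-! ### Homogeneity and the dual bases of the two Hom complexes -/

namespace CurtisAHSS

/-! ### Monomials in the Steenrod squares and graded modules -/

section Monomials

/-- `a` is a product of Steenrod squares of total degree `n`. -/
inductive IsMonomial : ℕ → SteenrodAlgebra → Prop
  | one : IsMonomial 0 1
  | sq_mul (i : ℕ) {n : ℕ} {a : SteenrodAlgebra} (h : IsMonomial n a) :
      IsMonomial (i + n) (Sq i * a)

/-- No grading of the Steenrod algebra itself is used; degree arguments are reduced to monomials
through this spanning set. -/
theorem span_isMonomial : Submodule.span (ZMod 2) {a | ∃ n, IsMonomial n a} = ⊤ := by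
  set S := Submodule.span (ZMod 2) {a | ∃ n, IsMonomial n a} with hS
  have hSq : ∀ i, ∀ a ∈ S, Sq i * a ∈ S := by
    intro i a ha
    induction ha using Submodule.span_induction with
    | mem x hx =>
      obtain ⟨n, hn⟩ := hx
      exact Submodule.subset_span ⟨_, hn.sq_mul i⟩
    | zero => simp
    | add x y _ _ hx hy => rw [mul_add]; exact add_mem hx hy
    | smul c x _ hx => rw [mul_smul_comm]; exact S.smul_mem c hx
  have key : ∀ w : FreeAlgebra (ZMod 2) ℕ, ∀ a ∈ S, RingQuot.mkAlgHom (ZMod 2) AdemRel w * a ∈ S := by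
    intro w
    induction w using FreeAlgebra.induction with
    | grade0 r =>
      intro a ha
      rw [AlgHom.commutes, ← Algebra.smul_def]
      exact S.smul_mem r ha
    | grade1 i => exact hSq i
    | mul x y hx hy =>
      intro a ha
      rw [map_mul, mul_assoc]
      exact hx _ (hy _ ha)
    | add x y hx hy =>
      intro a ha
      rw [map_add, add_mul]
      exact add_mem (hx _ ha) (hy _ ha)
  rw [eq_top_iff]
  rintro a -
  obtain ⟨w, rfl⟩ := RingQuot.mkAlgHom_surjective (ZMod 2) AdemRel a
  rw [← mul_one (RingQuot.mkAlgHom (ZMod 2) AdemRel w)]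
  exact key w 1 (Submodule.subset_span ⟨0, .one⟩)

/-- Linear maps that agree on the monomials are equal. -/
theorem linearMap_ext_monomial {N : Type*} [AddCommGroup N] [Module (ZMod 2) N]
    {f g : SteenrodAlgebra →ₗ[ZMod 2] N} (h : ∀ n a, IsMonomial n a → f a = g a) : f = g :=
  LinearMap.ext_on span_isMonomial fun a ⟨n, hn⟩ => h n a hn

theorem IsMonomial.eq_one {n : ℕ} {a : SteenrodAlgebra} (h : IsMonomial n a) (hn : n = 0) :
    a = 1 := by
  induction h with
  | one => rfl
  | @sq_mul i n a h ih =>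
    obtain ⟨rfl, rfl⟩ : i = 0 ∧ n = 0 := by omega
    rw [ih rfl, Sq_zero, one_mul]

theorem IsMonomial.augmentation_eq_zero {n : ℕ} {a : SteenrodAlgebra} (h : IsMonomial n a)
    (hn : n ≠ 0) : augmentation a = 0 := by
  induction h with
  | one => exact absurd rfl hn
  | @sq_mul i n a h ih =>
    rw [map_mul]
    rcases Nat.eq_zero_or_pos i with rfl | hi
    · rw [ih (by omega), mul_zero]
    · rw [augmentation_Sq hi, zero_mul]

/-- Conjugation in the Steenrod algebra, as a linear map. -/
noncomputable def conj : SteenrodAlgebra →ₗ[ZMod 2] SteenrodAlgebra :=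
  (MulOpposite.opLinearEquiv (ZMod 2)).symm.toLinearMap ∘ₗ antipode.toLinearMap

theorem conj_one : conj 1 = 1 := by simp [conj]

theorem conj_mul (a b : SteenrodAlgebra) : conj (a * b) = conj b * conj a := by simp [conj]

theorem conj_Sq (i : ℕ) : conj (Sq i) = conjSq i := by simp [conj, antipode_Sq]

variable {M : Type*} [AddCommGroup M] [Module (ZMod 2) M] [Module SteenrodAlgebra M]
  {𝓜 : ℤ → Submodule (ZMod 2) M}

/-- For `i > 0` the relation `∑ χ(Sqᵃ) Sqᵇ = 0` expresses `χ(Sqⁱ)` through `χ(Sqᵃ) Sqᵇ` with `a <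
i`, which allows induction. -/
theorem IsGradedModule.conjSq_smul_mem (h : IsGradedModule 𝓜) (i : ℕ) :
    ∀ {p : ℤ} {x : M}, x ∈ 𝓜 p → conjSq i • x ∈ 𝓜 (p + i) := by
  induction i using Nat.strong_induction_on with
  | _ i ih =>
    intro p x hx
    rcases Nat.eq_zero_or_pos i with rfl | hi
    · simpa [conjSq_zero] using hx
    have h1 := sum_conjSq_mul_Sq hi
    have h0 : (i, 0) ∈ Finset.HasAntidiagonal.antidiagonal i := by simp
    rw [← Finset.add_sum_erase _ _ h0, Sq_zero, mul_one] at h1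
    rw [eq_neg_of_add_eq_zero_left h1, neg_smul, Finset.sum_smul]
    refine Submodule.neg_mem _ (Submodule.sum_mem _ ?_)
    rintro ⟨a, b⟩ hab
    simp only [Finset.mem_erase, Finset.HasAntidiagonal.mem_antidiagonal, ne_eq,
      Prod.mk.injEq] at hab
    have h2 := ih a (by omega) (h.sq_mem b p x hx)
    rw [mul_smul]
    have e : p + (b : ℤ) + (a : ℤ) = p + i := by rw [← hab.2]; push_cast; ring
    rwa [e] at h2

theorem IsMonomial.smul_mem (h : IsGradedModule 𝓜) {n : ℕ} {a : SteenrodAlgebra}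
    (ha : IsMonomial n a) {p : ℤ} {x : M} (hx : x ∈ 𝓜 p) : a • x ∈ 𝓜 (p + n) := by
  induction ha with
  | one => simpa using hx
  | @sq_mul i n a _ ih =>
    have h2 := h.sq_mem i _ _ ih
    rw [mul_smul]
    have e : p + (n : ℤ) + (i : ℤ) = p + ((i + n : ℕ) : ℤ) := by push_cast; ring
    rwa [e] at h2

theorem IsMonomial.conj_smul_mem (h : IsGradedModule 𝓜) {n : ℕ} {a : SteenrodAlgebra}
    (ha : IsMonomial n a) {p : ℤ} {x : M} (hx : x ∈ 𝓜 p) : conj a • x ∈ 𝓜 (p + n) := by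
  induction ha generalizing p x with
  | one => simpa [conj_one] using hx
  | @sq_mul i n a _ ih =>
    have h2 := ih (h.conjSq_smul_mem i hx)
    rw [conj_mul, conj_Sq, mul_smul]
    have e : p + (i : ℤ) + (n : ℤ) = p + ((i + n : ℕ) : ℤ) := by push_cast; ring
    rwa [e] at h2

/-- A linear map vanishes in degree `p` if it vanishes on the elements of degree `p` of a
spanning set of homogeneous elements. -/
theorem eq_zero_of_span_homogeneous {V W : Type*} [AddCommGroup V] [Module (ZMod 2) V]
    [AddCommGroup W] [Module (ZMod 2) W] {𝓖 : ℤ → Submodule (ZMod 2) V}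
    (h : DirectSum.IsInternal 𝓖) {S : Set V} (hS : Submodule.span (ZMod 2) S = ⊤)
    (φ : V →ₗ[ZMod 2] W) (p : ℤ) (hφ : ∀ x ∈ S, ∃ q, x ∈ 𝓖 q ∧ (q = p → φ x = 0))
    {x : V} (hx : x ∈ 𝓖 p) : φ x = 0 := by
  classical
  let := h.chooseDecomposition
  have key : ∀ y : V, φ (DirectSum.decompose 𝓖 y p) = 0 := by
    intro y
    have hy : y ∈ Submodule.span (ZMod 2) S := hS ▸ Submodule.mem_top
    induction hy using Submodule.span_induction with
    | mem y hy =>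
      obtain ⟨q, hq, hz⟩ := hφ y hy
      by_cases hqp : q = p
      · subst hqp
        rw [DirectSum.decompose_of_mem_same 𝓖 hq, hz rfl]
      · rw [DirectSum.decompose_of_mem_ne 𝓖 hq hqp, map_zero]
    | zero => simp
    | add y z _ _ hy hz => simp [hy, hz]
    | smul c y _ hy =>
      rw [DirectSum.decompose_smul]
      change φ (c • (DirectSum.decompose 𝓖 y p : V)) = 0
      rw [map_smul, hy, smul_zero]
  have := key x
  rwa [DirectSum.decompose_of_mem_same 𝓖 hx] at this

theorem span_monomial_smul [IsScalarTower (ZMod 2) SteenrodAlgebra M] {J : Type*}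
    (b : Module.Basis J SteenrodAlgebra M) :
    Submodule.span (ZMod 2) {x | ∃ n a j, IsMonomial n a ∧ x = a • b j} = ⊤ := by
  rw [eq_top_iff]
  rintro x -
  rw [← b.linearCombination_repr x, Finsupp.linearCombination_apply]
  refine Submodule.sum_mem _ fun j _ => ?_
  dsimp only
  generalize b.repr x j = a
  have ha : a ∈ Submodule.span (ZMod 2) {a | ∃ n, IsMonomial n a} :=
    span_isMonomial ▸ Submodule.mem_top
  induction ha using Submodule.span_induction with
  | mem a ha =>
    obtain ⟨n, hn⟩ := ha
    exact Submodule.subset_span ⟨n, a, j, hn, rfl⟩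
  | zero => simp
  | add y z _ _ hy hz => rw [add_smul]; exact add_mem hy hz
  | smul c y _ hy => rw [smul_assoc]; exact Submodule.smul_mem _ c hy

variable {K : Type*} {e : Module.Basis K (ZMod 2) M} {degM : K → ℤ}

theorem coord_eq_zero_of_mem (h𝓜 : IsGradedModule 𝓜) (he : ∀ k, e k ∈ 𝓜 (degM k)) {k : K}
    {p : ℤ} (hp : degM k ≠ p) {m : M} (hm : m ∈ 𝓜 p) : e.coord k m = 0 := by
  refine eq_zero_of_span_homogeneous h𝓜.isInternal e.span_eq (e.coord k) p ?_ hm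
  rintro _ ⟨l, rfl⟩
  refine ⟨degM l, he l, fun hl => ?_⟩
  have : l ≠ k := by rintro rfl; exact hp hl
  simp [Module.Basis.coord_apply, this]

/-- Modulo higher degrees, conjugates act through the augmentation. -/
theorem coord_conj_smul [IsScalarTower (ZMod 2) SteenrodAlgebra M]
    (h𝓜 : IsGradedModule 𝓜) (he : ∀ k, e k ∈ 𝓜 (degM k)) {k l : K}
    (hkl : degM k ≤ degM l) (a : SteenrodAlgebra) :
    e.coord k (conj a • e l) = augmentation a * e.coord k (e l) := by
  have h : e.coord k ∘ₗ (LinearMap.toSpanSingleton SteenrodAlgebra M (e l)).restrictScalars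
      (ZMod 2) ∘ₗ conj = (augmentation.toLinearMap).smulRight (e.coord k (e l)) := by
    refine linearMap_ext_monomial fun n a ha => ?_
    simp only [LinearMap.comp_apply, LinearMap.restrictScalars_apply,
      LinearMap.toSpanSingleton_apply, LinearMap.smulRight_apply, AlgHom.toLinearMap_apply,
      smul_eq_mul]
    -- A conjugate of a monomial of positive degree moves `e l` strictly above degree `degM k`,
    -- where the coordinate of `e k` vanishes, as the augmentation does.
    by_cases hn : n = 0
    · rw [ha.eq_one hn, conj_one, one_smul, map_one, one_mul]
    · rw [ha.augmentation_eq_zero hn, zero_mul]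
      exact coord_eq_zero_of_mem h𝓜 he (by omega) (ha.conj_smul_mem h𝓜 (he l))
  exact LinearMap.congr_fun h a

end Monomials

namespace FreeResolution

variable (R : FreeResolution)

/-! ### The dual basis of `Hom_A(F_s, 𝔽₂)` -/

section Hom

variable (n : ℤ) (s : ℕ)

instance finite_homIndex : Finite (R.HomIndex n s) := (R.finite_type s n).to_subtype

/-- The coefficient of `r*_j`, as an `𝔽₂`-linear map. -/
noncomputable def coeffMap (j : R.J s) : R.F s →ₗ[ZMod 2] SteenrodAlgebra :=
  ((R.basis s).coord j).restrictScalars (ZMod 2)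

theorem coeffMap_smul (j : R.J s) (a : SteenrodAlgebra) (x : R.F s) :
    R.coeffMap s j (a • x) = a * R.coeffMap s j x :=
  map_smul ((R.basis s).coord j) a x

theorem coeffMap_basis_self (j : R.J s) : R.coeffMap s j (R.basis s j) = 1 := by
  simp [coeffMap]

theorem coeffMap_basis_of_ne {j l : R.J s} (h : l ≠ j) : R.coeffMap s j (R.basis s l) = 0 := by
  simp [coeffMap, h]

/-- The functional `r_j` on `F_s` dual to `r*_j`. -/
noncomputable def homFunctional (j : R.J s) : Module.Dual (ZMod 2) (R.F s) :=
  augmentation.toLinearMap ∘ₗ R.coeffMap s j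

/-- Invariance holds because the augmentation is multiplicative and kills `Sqⁱ` for `i > 0`.
Homogeneity holds because it kills every monomial of positive degree, so among the `a r*_l` only
`r*_j` itself contributes. -/
theorem homFunctional_mem (j : R.J s) : R.homFunctional s j ∈ R.hom (R.deg s j) s := by
  refine ⟨fun i hi x => ?_, fun p hp x hx => ?_⟩
  · change augmentation (R.coeffMap s j (Sq i • x)) = 0
    rw [coeffMap_smul, map_mul, augmentation_Sq hi, zero_mul]
  · refine eq_zero_of_span_homogeneous (R.isGraded s).isInternal
      (span_monomial_smul (R.basis s)) (R.homFunctional s j) p ?_ hx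
    rintro _ ⟨n, a, l, ha, rfl⟩
    refine ⟨_, ha.smul_mem (R.isGraded s) (R.basis_mem s l), fun hq => ?_⟩
    change augmentation (R.coeffMap s j (a • R.basis s l)) = 0
    rw [coeffMap_smul, map_mul]
    by_cases hl : l = j
    · subst hl
      rw [ha.augmentation_eq_zero (by rintro rfl; simp at hq; omega), zero_mul]
    · rw [R.coeffMap_basis_of_ne s hl, map_zero, mul_zero]

/-- Evaluation of the functionals in `Hom_A(F_s, 𝔽₂)` at the elements `r*_j`. -/
noncomputable def homEval : R.hom n s →ₗ[ZMod 2] (R.HomIndex n s → ZMod 2) where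
  toFun φ j := φ.1 (R.basis s j.1)
  map_add' _ _ := rfl
  map_smul' _ _ := rfl

/-- A monomial multiple of `r*_j` is either `r*_j` or in the image of some `Sqⁱ` with `i > 0`, where
invariant functionals vanish. -/
theorem homEval_injective : Function.Injective (R.homEval n s) := by
  rw [injective_iff_map_eq_zero]
  intro φ hφ
  have h0 : ∀ j, φ.1 (R.basis s j) = 0 := by
    intro j
    by_cases hj : R.deg s j = n
    · exact congrFun hφ ⟨j, hj⟩
    · exact φ.2.2 _ hj _ (R.basis_mem s j)
  refine Subtype.ext (LinearMap.ext_on (span_monomial_smul (R.basis s)) ?_)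
  rintro _ ⟨n, a, j, ha, rfl⟩
  change φ.1 _ = 0
  induction ha with
  | one => rw [one_smul, h0]
  | @sq_mul i n a _ ih =>
    rcases Nat.eq_zero_or_pos i with rfl | hi
    · rwa [Sq_zero, one_mul]
    · rw [mul_smul]
      exact φ.2.1 i hi _

theorem homFunctional_basis (j l : R.J s) :
    ((j = l) → R.homFunctional s j (R.basis s l) = 1) ∧
      ((j ≠ l) → R.homFunctional s j (R.basis s l) = 0) := by
  constructor
  · rintro rfl
    simp [homFunctional, coeffMap_basis_self]
  · intro h
    simp [homFunctional, R.coeffMap_basis_of_ne s h.symm]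

/-- The functional `r_j` as an element of `Hom_A(F_s, 𝔽₂)`. -/
noncomputable def homElement (j : R.HomIndex n s) : R.hom n s :=
  ⟨R.homFunctional s j.1, by
    have h := R.homFunctional_mem s j.1
    rwa [j.2] at h⟩

open Classical in
theorem homEval_homElement (j : R.HomIndex n s) :
    R.homEval n s (R.homElement n s j) = Pi.single j 1 := by
  ext l
  change R.homFunctional s j.1 (R.basis s l.1) = _
  by_cases h : j = l
  · subst h
    rw [(R.homFunctional_basis s _ _).1 rfl, Pi.single_eq_same]
  · rw [(R.homFunctional_basis s _ _).2 fun hh => h (Subtype.ext hh),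
      Pi.single_eq_of_ne (Ne.symm h)]

theorem homEval_surjective : Function.Surjective (R.homEval n s) := by
  classical
  have := Fintype.ofFinite (R.HomIndex n s)
  intro v
  refine ⟨∑ j, v j • R.homElement n s j, ?_⟩
  rw [map_sum]
  simp only [map_smul, homEval_homElement]
  exact (pi_eq_sum_univ' v).symm ▸ (by
    refine Finset.sum_congr rfl fun j _ => ?_
    ext l
    simp [Pi.single_apply, eq_comm])

/-- The basis `r_j` of `Hom_A(F_s, 𝔽₂)` in internal degree `n`. -/
noncomputable def homBasis : Module.Basis (R.HomIndex n s) (ZMod 2) (R.hom n s) :=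
  Module.Basis.ofEquivFun
    (LinearEquiv.ofBijective (R.homEval n s) ⟨R.homEval_injective n s, R.homEval_surjective n s⟩)

theorem homBasis_repr (φ : R.hom n s) (j : R.HomIndex n s) :
    (R.homBasis n s).repr φ j = φ.1 (R.basis s j.1) := rfl

theorem homBasis_apply (j : R.HomIndex n s) : R.homBasis n s j = R.homElement n s j := by
  classical
  rw [homBasis, Module.Basis.coe_ofEquivFun, LinearEquiv.symm_apply_eq]
  exact (R.homEval_homElement n s j).symm

theorem isDualHomBasis_homBasis : R.IsDualHomBasis R.homBasis := by
  intro n s j l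
  rw [homBasis_apply]
  exact R.homFunctional_basis s j.1 l

theorem homBasis_repr_homD (c : R.HomIndex n s) (a : R.HomIndex n (s + 1)) :
    (R.homBasis n (s + 1)).repr (R.homD n s (R.homBasis n s c)) a =
      augmentation (R.coeffMap s c.1 (R.bd s (R.basis (s + 1) a.1))) := by
  rw [homBasis_repr, homBasis_apply]
  rfl

theorem homD_homD (x : R.hom n s) : R.homD n (s + 1) (R.homD n s x) = 0 := by
  ext y
  change x.1 (R.bd s (R.bd (s + 1) y)) = 0
  rw [(R.exact_succ s).apply_apply_eq_zero y, map_zero]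

end Hom

/-! ### The dual basis of `Hom_A(M ⊗ F_s, 𝔽₂)` -/

section Cochain

variable {M : Type*} [AddCommGroup M] [Module (ZMod 2) M] [Module SteenrodAlgebra M]
  [IsScalarTower (ZMod 2) SteenrodAlgebra M] {𝓜 : ℤ → Submodule (ZMod 2) M}
  (h𝓜 : IsGradedModule 𝓜) {K : Type*} (e : Module.Basis K (ZMod 2) M)
  {degM : K → ℤ} (he : ∀ k, e k ∈ 𝓜 (degM k)) (t : ℤ) (s : ℕ)

theorem sqTensor_tmul {N : Type*} [AddCommGroup N] [Module (ZMod 2) N] [Module SteenrodAlgebra N]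
    [IsScalarTower (ZMod 2) SteenrodAlgebra N] (i : ℕ) (m : M) (x : N) :
    sqTensor M N i (m ⊗ₜ x) =
      ∑ p ∈ Finset.HasAntidiagonal.antidiagonal i, (Sq p.1 • m) ⊗ₜ[ZMod 2] (Sq p.2 • x) := by
  simp [sqTensor, sqEnd]

/-- A functional on `M ⊗ N` that is linear over the Steenrod algebra satisfies
`φ (m ⊗ a x) = φ (χ(a) m ⊗ x)`. -/
theorem apply_tmul_smul {N : Type*} [AddCommGroup N] [Module (ZMod 2) N]
    [Module SteenrodAlgebra N] [IsScalarTower (ZMod 2) SteenrodAlgebra N]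
    {φ : Module.Dual (ZMod 2) (M ⊗[ZMod 2] N)}
    (hφ : ∀ i, 0 < i → ∀ x, φ (sqTensor M N i x) = 0) (a : SteenrodAlgebra) (m : M) (x : N) :
    φ (m ⊗ₜ (a • x)) = φ ((conj a • m) ⊗ₜ x) := by
  have hSq : ∀ i m x, φ (m ⊗ₜ (Sq i • x)) = φ ((conjSq i • m) ⊗ₜ x) := by
    intro i
    induction i using Nat.strong_induction_on with
    | _ i ih =>
      intro m x
      rcases Nat.eq_zero_or_pos i with rfl | hi
      · rw [Sq_zero, conjSq_zero, one_smul, one_smul]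
      have h1 := hφ i hi (m ⊗ₜ x)
      rw [sqTensor_tmul, map_sum] at h1
      -- This sum vanishes for every `m` and `x`. Compared with the Cartan formula, its terms with
      -- `q < i` agree by induction, which leaves the term `(0, i)`.
      have h2 : ∑ p ∈ Finset.HasAntidiagonal.antidiagonal i,
          φ ((conjSq p.2 • Sq p.1 • m) ⊗ₜ[ZMod 2] x) = 0 := by
        rw [← map_sum, ← TensorProduct.sum_tmul, ← Finset.Nat.sum_antidiagonal_swap]
        simp only [Prod.fst_swap, Prod.snd_swap, ← mul_smul]
        rw [← Finset.sum_smul, sum_conjSq_mul_Sq hi, zero_smul, TensorProduct.zero_tmul, map_zero]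
      have h3 := sub_eq_zero.2 (h1.trans h2.symm)
      rw [← Finset.sum_sub_distrib, Finset.sum_eq_single (0, i)] at h3
      · simpa only [Sq_zero, one_smul, sub_eq_zero] using h3
      · rintro ⟨p, q⟩ hp hne
        rw [sub_eq_zero]
        simp only [Finset.HasAntidiagonal.mem_antidiagonal] at hp
        refine ih q ?_ _ _
        by_contra hq
        exact hne (by simp only [Prod.mk.injEq]; omega)
      · intro h
        simp at h
  have hmon : ∀ n a, IsMonomial n a → ∀ m x, φ (m ⊗ₜ (a • x)) = φ ((conj a • m) ⊗ₜ x) := by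
    intro n a ha
    induction ha with
    | one => simp [conj_one]
    | @sq_mul i n a _ ih =>
      intro m x
      rw [mul_smul, hSq, ih, conj_mul, conj_Sq, mul_smul]
  have ha : a ∈ Submodule.span (ZMod 2) {a | ∃ n, IsMonomial n a} :=
    span_isMonomial ▸ Submodule.mem_top
  induction ha using Submodule.span_induction with
  | mem a ha => exact hmon _ a ha.choose_spec m x
  | zero => simp
  | add a b _ _ ha hb =>
    rw [add_smul, TensorProduct.tmul_add, map_add, ha, hb, map_add conj, add_smul,
      TensorProduct.add_tmul, map_add]
  | smul c a _ ha =>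
    rw [smul_assoc, TensorProduct.tmul_smul, map_smul, ha, map_smul conj, smul_assoc,
      ← TensorProduct.smul_tmul' c, map_smul]

/-- The functional `e_k ⊗ r_j` on `M ⊗ F_s`: `m ⊗ f ↦ e_k (χ(f_j) m)`. -/
noncomputable def cochainFunctional (k : K) (j : R.J s) :
    Module.Dual (ZMod 2) (M ⊗[ZMod 2] R.F s) :=
  TensorProduct.lift (((Algebra.lsmul (ZMod 2) (ZMod 2) M).toLinearMap ∘ₗ conj ∘ₗ
    R.coeffMap s j).flip.compr₂ (e.coord k))

theorem cochainFunctional_tmul (k : K) (j : R.J s) (m : M) (f : R.F s) :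
    R.cochainFunctional e s k j (m ⊗ₜ f) = e.coord k (conj (R.coeffMap s j f) • m) := rfl

/-- The coefficient of `r*_j` in `Sq^q f` is `Sq^q f_j`, so the Cartan sum becomes `χ(f_j) ∑ χ(Sq^q)
Sqᵖ m`, and the inner sum is zero. -/
theorem cochainFunctional_mem (h𝓜 : IsGradedModule 𝓜)
    (he : ∀ k, e k ∈ 𝓜 (degM k)) (k : K) (j : R.J s) :
    R.cochainFunctional e s k j ∈ R.cochain 𝓜 (degM k + R.deg s j) s := by
  refine ⟨fun i hi x => ?_, fun p q hpq m hm f hf => ?_⟩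
  · induction x using TensorProduct.induction_on with
    | zero => simp
    | add x y hx hy => rw [map_add, map_add, hx, hy, add_zero]
    | tmul m f =>
      rw [sqTensor_tmul, map_sum]
      simp only [cochainFunctional_tmul, coeffMap_smul, conj_mul, conj_Sq]
      rw [← map_sum]
      simp only [← mul_smul, mul_assoc]
      rw [← Finset.sum_smul, ← Finset.mul_sum, ← Finset.Nat.sum_antidiagonal_swap]
      simp only [Prod.fst_swap, Prod.snd_swap]
      rw [sum_conjSq_mul_Sq hi, mul_zero, zero_smul, map_zero]
  · refine eq_zero_of_span_homogeneous (R.isGraded s).isInternal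
      (span_monomial_smul (R.basis s))
      (R.cochainFunctional e s k j ∘ₗ TensorProduct.mk (ZMod 2) M (R.F s) m) q ?_ hf
    rintro _ ⟨n, a, l, ha, rfl⟩
    refine ⟨_, ha.smul_mem (R.isGraded s) (R.basis_mem s l), fun hq => ?_⟩
    change R.cochainFunctional e s k j (m ⊗ₜ (a • R.basis s l)) = 0
    rw [cochainFunctional_tmul, coeffMap_smul]
    by_cases hl : l = j
    · subst hl
      rw [R.coeffMap_basis_self, mul_one]
      exact coord_eq_zero_of_mem h𝓜 he (by omega) (ha.conj_smul_mem h𝓜 hm)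
    · rw [R.coeffMap_basis_of_ne s hl, mul_zero, map_zero, zero_smul, map_zero]

instance finite_index [Finite K] : Finite (R.Index degM t s) := by
  have h : Set.Finite {p : K ×ₗ R.J s | degM (ofLex p).1 + R.deg s (ofLex p).2 = t} := by
    have h1 : Set.Finite (⋃ k : K, (fun j => toLex (k, j)) '' {j | R.deg s j = t - degM k}) :=
      Set.finite_iUnion fun k => (R.finite_type s _).image _
    refine h1.subset fun p hp => ?_
    simp only [Set.mem_iUnion, Set.mem_image]
    refine ⟨(ofLex p).1, (ofLex p).2, ?_, rfl⟩
    have hp' : degM (ofLex p).1 + R.deg s (ofLex p).2 = t := hp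
    change R.deg s (ofLex p).2 = t - degM (ofLex p).1
    omega
  exact h.to_subtype

variable (𝓜 degM) in
/-- Evaluation of the functionals in `Hom_A(M ⊗ F_s, 𝔽₂)` at the elements `e*_k ⊗ r*_j`. -/
noncomputable def cochainEval : R.cochain 𝓜 t s →ₗ[ZMod 2] (R.Index degM t s → ZMod 2) where
  toFun φ p := φ.1 (e (ofLex p.1).1 ⊗ₜ R.basis s (ofLex p.1).2)
  map_add' _ _ := rfl
  map_smul' _ _ := rfl

variable {R t s} in
theorem cochain_apply_eq_zero (he : ∀ k, e k ∈ 𝓜 (degM k))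
    {φ : R.cochain 𝓜 t s} {k : K}
    (hφ : ∀ p : R.Index degM t s, (ofLex p.1).1 = k →
      φ.1 (e (ofLex p.1).1 ⊗ₜ R.basis s (ofLex p.1).2) = 0) (j : R.J s) :
    φ.1 (e k ⊗ₜ R.basis s j) = 0 := by
  by_cases h : degM k + R.deg s j = t
  · exact hφ ⟨toLex (k, j), h⟩ rfl
  · exact φ.2.2 _ _ h _ (he k) _ (R.basis_mem s j)

/-- By `apply_tmul_smul` the algebra can be moved to the left factor, so the values at `m ⊗ r*_j`
determine the functional; those at `e_k ⊗ r*_j` suffice by linearity, and they vanish off total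
degree `t`. -/
theorem cochainEval_injective (he : ∀ k, e k ∈ 𝓜 (degM k)) :
    Function.Injective (R.cochainEval 𝓜 e degM t s) := by
  rw [injective_iff_map_eq_zero]
  intro φ hφ
  have h0 : ∀ k j, φ.1 (e k ⊗ₜ R.basis s j) = 0 := fun k =>
    cochain_apply_eq_zero e he fun p _ => congrFun hφ p
  have h1 : ∀ m j, φ.1 (m ⊗ₜ R.basis s j) = 0 := by
    intro m j
    have : φ.1 ∘ₗ (TensorProduct.mk (ZMod 2) M (R.F s)).flip (R.basis s j) = 0 :=
      e.ext fun k => h0 k j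
    exact LinearMap.congr_fun this m
  refine Subtype.ext (TensorProduct.ext' fun m f => ?_)
  have h2 : φ.1 ∘ₗ TensorProduct.mk (ZMod 2) M (R.F s) m = 0 := by
    refine LinearMap.ext_on (span_monomial_smul (R.basis s)) ?_
    rintro _ ⟨n, a, j, -, rfl⟩
    exact (apply_tmul_smul φ.2.1 a m _).trans (h1 _ j)
  exact LinearMap.congr_fun h2 f

theorem cochainFunctional_basis (k k' : K) (j j' : R.J s) :
    (((k, j) = (k', j')) → R.cochainFunctional e s k j (e k' ⊗ₜ R.basis s j') = 1) ∧
      (((k, j) ≠ (k', j')) → R.cochainFunctional e s k j (e k' ⊗ₜ R.basis s j') = 0) := by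
  rw [cochainFunctional_tmul]
  by_cases hj : j' = j
  · subst hj
    rw [R.coeffMap_basis_self, conj_one, one_smul, Module.Basis.coord_apply]
    constructor
    · intro h
      simp only [Prod.mk.injEq, and_true] at h
      simp [h]
    · intro h
      have : k' ≠ k := by rintro rfl; exact h rfl
      simp [this]
  · rw [R.coeffMap_basis_of_ne s hj, map_zero, zero_smul, map_zero]
    exact ⟨fun h => absurd (congrArg Prod.snd h).symm hj, fun _ => rfl⟩

/-- The functional `e_k ⊗ r_j` as an element of `Hom_A(M ⊗ F_s, 𝔽₂)`. -/
noncomputable def cochainElement (p : R.Index degM t s) : R.cochain 𝓜 t s :=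
  ⟨R.cochainFunctional e s (ofLex p.1).1 (ofLex p.1).2,
    by
      have h := R.cochainFunctional_mem e s h𝓜 he (ofLex p.1).1 (ofLex p.1).2
      rwa [p.2] at h⟩

open Classical in
theorem cochainEval_cochainElement (p : R.Index degM t s) :
    R.cochainEval 𝓜 e degM t s (R.cochainElement h𝓜 e he t s p) = Pi.single p 1 := by
  ext q
  change R.cochainFunctional e s (ofLex p.1).1 (ofLex p.1).2
    (e (ofLex q.1).1 ⊗ₜ R.basis s (ofLex q.1).2) = _
  by_cases h : p = q
  · subst h
    rw [(R.cochainFunctional_basis e s _ _ _ _).1 rfl, Pi.single_eq_same]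
  · rw [Pi.single_eq_of_ne (Ne.symm h)]
    exact (R.cochainFunctional_basis e s _ _ _ _).2 fun hh => h (Subtype.ext hh)

theorem cochainEval_surjective [Finite K] (h𝓜 : IsGradedModule 𝓜)
    (he : ∀ k, e k ∈ 𝓜 (degM k)) :
    Function.Surjective (R.cochainEval 𝓜 e degM t s) := by
  classical
  have := Fintype.ofFinite (R.Index degM t s)
  intro v
  refine ⟨∑ p, v p • R.cochainElement h𝓜 e he t s p, ?_⟩
  rw [map_sum]
  simp only [map_smul, cochainEval_cochainElement]
  exact (pi_eq_sum_univ' v).symm ▸ (by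
    refine Finset.sum_congr rfl fun j _ => ?_
    ext l
    simp [Pi.single_apply, eq_comm])

variable [Finite K]

/-- The basis `e_k ⊗ r_j` of `Hom_A(M ⊗ F_s, 𝔽₂)` in internal degree `t`. -/
noncomputable def homTensorBasis :
    Module.Basis (R.Index degM t s) (ZMod 2) (R.cochain 𝓜 t s) :=
  Module.Basis.ofEquivFun (LinearEquiv.ofBijective (R.cochainEval 𝓜 e degM t s)
    ⟨R.cochainEval_injective e t s he, R.cochainEval_surjective e t s h𝓜 he⟩)

theorem homTensorBasis_apply (p : R.Index degM t s) :
    R.homTensorBasis h𝓜 e he t s p = R.cochainElement h𝓜 e he t s p := by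
  classical
  rw [homTensorBasis, Module.Basis.coe_ofEquivFun, LinearEquiv.symm_apply_eq]
  exact (R.cochainEval_cochainElement h𝓜 e he t s p).symm

/-- The basis `e_k ⊗ r_j` as a basis of the filtered complex. -/
noncomputable def cochainBasis :
    Module.Basis (R.Index degM t s) (ZMod 2) ((R.ahComplex 𝓜 t).X s) :=
  R.homTensorBasis h𝓜 e he t s

theorem cochainBasis_apply (p : R.Index degM t s) :
    R.cochainBasis h𝓜 e he t s p = R.cochainElement h𝓜 e he t s p :=
  R.homTensorBasis_apply h𝓜 e he t s p

theorem isDualBasis_cochainBasis : R.IsDualBasis 𝓜 e degM (fun t s => R.cochainBasis h𝓜 e he t s) := by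
  intro t s p k' j'
  rw [cochainBasis_apply]
  exact R.cochainFunctional_basis e s _ k' _ j'

theorem cochainBasis_repr_d (c : R.Index degM t s) (a : R.Index degM t (s + 1)) :
    (R.cochainBasis h𝓜 e he t (s + 1)).repr
        ((R.ahComplex 𝓜 t).d s (R.cochainBasis h𝓜 e he t s c)) a =
      e.coord (ofLex c.1).1 (conj (R.coeffMap s (ofLex c.1).2
        (R.bd s (R.basis (s + 1) (ofLex a.1).2))) • e (ofLex a.1).1) := by
  rw [cochainBasis_apply]
  rfl

/-- The filtration of `Hom_A(M ⊗ F_s, 𝔽₂)` in terms of the basis `e_k ⊗ r_j`. -/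
theorem mem_fil_iff (n : ℤ) (φ : (R.ahComplex 𝓜 t).X s) :
    φ ∈ (R.ahComplex 𝓜 t).fil n s ↔ ∀ p : R.Index degM t s, n < R.wt degM t s p →
      (R.cochainBasis h𝓜 e he t s).repr φ p = 0 := by
  constructor
  · intro h p hp
    exact h _ hp _ (he _) _
  · intro h q hq m hm f
    change R.cochain 𝓜 t s at φ
    have h0 : ∀ k, n < degM k → ∀ j, φ.1 (e k ⊗ₜ R.basis s j) = 0 := by
      intro k hk
      refine cochain_apply_eq_zero e he fun p hp => ?_
      refine h p ?_
      change n < degM (ofLex p.1).1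
      rwa [hp]
    have h1 : ∀ l, n < l → ∀ m ∈ 𝓜 l, ∀ j, φ.1 (m ⊗ₜ R.basis s j) = 0 := by
      intro l hl m hm j
      refine eq_zero_of_span_homogeneous h𝓜.isInternal e.span_eq
        (φ.1 ∘ₗ (TensorProduct.mk (ZMod 2) M (R.F s)).flip (R.basis s j)) l ?_ hm
      rintro _ ⟨k, rfl⟩
      exact ⟨degM k, he k, fun hk => h0 k (hk ▸ hl) j⟩
    -- Moving `a` to the left factor replaces `m` by `χ(a) m`, whose degree is still greater than
    -- `n`.
    have h2 : φ.1 ∘ₗ TensorProduct.mk (ZMod 2) M (R.F s) m = 0 := by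
      refine LinearMap.ext_on (span_monomial_smul (R.basis s)) ?_
      rintro _ ⟨i, a, j, ha, rfl⟩
      exact (apply_tmul_smul φ.2.1 a m _).trans
        (h1 _ (by omega) _ (ha.conj_smul_mem h𝓜 hm) j)
    exact LinearMap.congr_fun h2 f

end Cochain

end FreeResolution

end CurtisAHSS

/-! ### Linear algebra of leading terms and Curtis tables -/

namespace CurtisAHSS

/-! ### Leading terms -/

section Leading

variable {X I : Type*} [AddCommGroup X] [Module (ZMod 2) X] [LinearOrder I]
  {b : Module.Basis I (ZMod 2) X} {x y : X} {i j : I}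

theorem zmod_two_eq_one {c : ZMod 2} (h : c ≠ 0) : c = 1 := by
  revert c; decide

theorem IsLeading.unique (hi : IsLeading b x i) (hj : IsLeading b x j) : i = j := by
  rcases lt_trichotomy i j with h | h | h
  · exact absurd (hi.2 j h) hj.1
  · exact h
  · exact absurd (hj.2 i h) hi.1

theorem IsLeading.ne_zero (h : IsLeading b x i) : x ≠ 0 := by
  rintro rfl
  exact h.1 (by simp)

theorem exists_isLeading (b : Module.Basis I (ZMod 2) X) (hx : x ≠ 0) :
    ∃ i, IsLeading b x i := by
  have hne : (b.repr x).support.Nonempty := by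
    rw [Finsupp.support_nonempty_iff]
    simpa using hx
  refine ⟨(b.repr x).support.max' hne, ?_, fun j hj => ?_⟩
  · exact Finsupp.mem_support_iff.1 (Finset.max'_mem _ hne)
  · by_contra h
    exact absurd (Finset.le_max' _ j (Finsupp.mem_support_iff.2 h)) (not_le.2 hj)

theorem exists_isLeading_ge (h : b.repr x i ≠ 0) : ∃ j, i ≤ j ∧ IsLeading b x j := by
  obtain ⟨j, hj⟩ := exists_isLeading b (x := x) (by rintro rfl; simp at h)
  refine ⟨j, ?_, hj⟩
  by_contra hlt
  exact h (hj.2 i (not_le.1 hlt))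

theorem isLeading_self (b : Module.Basis I (ZMod 2) X) (i : I) : IsLeading b (b i) i := by
  refine ⟨by simp, fun j hj => ?_⟩
  simp [hj.ne]

theorem IsLeading.add_of_forall_eq_zero (h : IsLeading b x i)
    (hy : ∀ j, i ≤ j → b.repr y j = 0) : IsLeading b (x + y) i := by
  refine ⟨?_, fun j hj => ?_⟩
  · rw [map_add, Finsupp.add_apply, hy i le_rfl, add_zero]
    exact h.1
  · rw [map_add, Finsupp.add_apply, hy j hj.le, h.2 j hj, add_zero]

/-- Leading coefficients over `𝔽₂` are both `1`, so equal leading terms cancel in a sum: the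
elimination step. -/
theorem IsLeading.repr_add_eq_zero (hx : IsLeading b x i) (hy : IsLeading b y i) (hij : i ≤ j) :
    b.repr (x + y) j = 0 := by
  rw [map_add, Finsupp.add_apply]
  rcases hij.eq_or_lt with rfl | h
  · rw [zmod_two_eq_one hx.1, zmod_two_eq_one hy.1]
    decide
  · rw [hx.2 j h, hy.2 j h, add_zero]

theorem IsLeading.neg (h : IsLeading b x i) : IsLeading b (-x) i := by
  refine ⟨by simpa using h.1, fun j hj => by simpa using h.2 j hj⟩

/-- Among the nonzero values of a nonzero finite family there is one with the largest index. -/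
theorem exists_last_ne_zero {ι : Type*} [LinearOrder ι] [Finite ι] {c : ι → ZMod 2}
    (hc : c ≠ 0) : ∃ i, c i ≠ 0 ∧ ∀ j, i < j → c j = 0 := by
  obtain ⟨i₀, hi₀⟩ := Function.ne_iff.1 hc
  obtain ⟨i, hi, hmax⟩ := (Set.toFinite {i | c i ≠ 0}).exists_maximal ⟨i₀, hi₀⟩
  refine ⟨i, hi, fun j hj => ?_⟩
  by_contra h
  exact absurd (hmax h hj.le) (not_le.2 hj)

/-- Distinct leading terms cannot cancel, so the last nonzero coefficient decides. -/
theorem isLeading_sum {ι : Type*} [LinearOrder ι] [Fintype ι] {f : ι → I} (hf : StrictMono f)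
    {g : ι → X} (hg : ∀ i, IsLeading b (g i) (f i)) {c : ι → ZMod 2} {i : ι}
    (hi : c i ≠ 0) (hc : ∀ j, i < j → c j = 0) : IsLeading b (∑ j, c j • g j) (f i) := by
  refine ⟨?_, fun k hk => ?_⟩
  · rw [map_sum, Finsupp.finsetSum_apply, Finset.sum_eq_single i]
    · simpa using ⟨hi, (hg i).1⟩
    · intro j _ hj
      rcases lt_or_gt_of_ne hj with h | h
      · simp [(hg j).2 _ (hf h)]
      · simp [hc j h]
    · simp
  · rw [map_sum, Finsupp.finsetSum_apply, Finset.sum_eq_zero]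
    intro j _
    rcases lt_or_ge i j with h | h
    · simp [hc j h]
    · simp [(hg j).2 k ((hf.monotone h).trans_lt hk)]

theorem linearIndependent_of_isLeading {ι : Type*} [LinearOrder ι] [Finite ι] {f : ι → I}
    (hf : StrictMono f) {g : ι → X} (hg : ∀ i, IsLeading b (g i) (f i)) :
    LinearIndependent (ZMod 2) g := by
  have := Fintype.ofFinite ι
  rw [Fintype.linearIndependent_iff]
  intro c hc
  by_contra! hne
  obtain ⟨i₀, hi₀⟩ := hne
  obtain ⟨i, hi, hmax⟩ := exists_last_ne_zero (c := c) (by rintro rfl; exact hi₀ rfl)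
  exact (isLeading_sum hf hg hi hmax).ne_zero hc

/-- A family with distinct leading terms, one for each basis element, is a basis. -/
theorem exists_basis_of_isLeading [Finite I] {g : I → X} (hg : ∀ i, IsLeading b (g i) i) :
    ∃ g' : Module.Basis I (ZMod 2) X, ∀ i, g' i = g i := by
  have := Fintype.ofFinite I
  have hli : LinearIndependent (ZMod 2) g := linearIndependent_of_isLeading strictMono_id hg
  have hspan : ⊤ ≤ Submodule.span (ZMod 2) (Set.range g) := by
    have := Module.Finite.of_basis b
    exact (hli.span_eq_top_of_card_eq_finrank' (Module.finrank_eq_card_basis b).symm).ge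
  exact ⟨Module.Basis.mk hli hspan, fun i => Module.Basis.mk_apply hli hspan i⟩

/-- A triangular change of basis leaves leading terms alone, so adapted bases may replace the given
ones in all arguments about tables. -/
theorem isLeading_iff_of_triangular [Finite I] {g : Module.Basis I (ZMod 2) X}
    (hg : ∀ i, IsLeading b (g i) i) : IsLeading g x i ↔ IsLeading b x i := by
  have := Fintype.ofFinite I
  have key : ∀ i, IsLeading g x i → IsLeading b x i := by
    intro i hi
    have := isLeading_sum strictMono_id hg hi.1 hi.2
    rwa [g.sum_repr] at this
  refine ⟨key i, fun hi => ?_⟩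
  obtain ⟨j, hj⟩ := exists_isLeading g hi.ne_zero
  rwa [hi.unique (key j hj)]

end Leading

/-! ### Curtis tables: adapted bases, existence and uniqueness -/

section Table

variable {X : ℕ → Type*} [∀ s, AddCommGroup (X s)] [∀ s, Module (ZMod 2) (X s)]
  {d : ∀ s, X s →ₗ[ZMod 2] X (s + 1)} {I : ℕ → Type*} [∀ s, LinearOrder (I s)]
  {b : ∀ s, Module.Basis (I s) (ZMod 2) (X s)} {T T' : Set (Item (Σ s, I s))}

namespace IsCurtisTable

theorem eq_of_contains (hT : IsCurtisTable d b T) {it it' : Item (Σ s, I s)} {x : Σ s, I s}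
    (h : it ∈ T) (hx : it.Contains x) (h' : it' ∈ T) (hx' : it'.Contains x) : it = it' :=
  (hT.once x).unique ⟨h, hx⟩ ⟨h', hx'⟩

/-- Otherwise both items contain `c` and coincide, but the head and the source of a tag lie in
different degrees. -/
theorem head_ne_source (hT : IsCurtisTable d b T) {a c : Σ s, I s} (h : Item.tag a c ∈ T)
    {it : Item (Σ s, I s)} (h' : it ∈ T) : it.head ≠ c := by
  intro hc
  have hcont : it.Contains c := by
    subst hc
    cases it with
    | untagged x => rfl
    | tag a c => exact Or.inl rfl
  have he := hT.eq_of_contains h (Or.inr rfl) h' hcont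
  subst he
  have := hT.degree _ _ h
  change a = c at hc
  subst hc
  omega

theorem not_untagged_head (hT : IsCurtisTable d b T) {a c : Σ s, I s} (h : Item.tag a c ∈ T) :
    Item.untagged a ∉ T := fun h' => by
  have := hT.eq_of_contains h (x := a) (Or.inl rfl) h' rfl
  cases this

theorem not_untagged_source (hT : IsCurtisTable d b T) {a c : Σ s, I s} (h : Item.tag a c ∈ T) :
    Item.untagged c ∉ T := fun h' => hT.head_ne_source h h' rfl

theorem head_unique (hT : IsCurtisTable d b T) {a a' c : Σ s, I s} (h : Item.tag a c ∈ T)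
    (h' : Item.tag a' c ∈ T) : a = a' := by
  have := hT.eq_of_contains h (x := c) (Or.inr rfl) h' (Or.inr rfl)
  cases this
  rfl

theorem source_unique (hT : IsCurtisTable d b T) {a c c' : Σ s, I s} (h : Item.tag a c ∈ T)
    (h' : Item.tag a c' ∈ T) : c = c' := by
  have := hT.eq_of_contains h (x := a) (Or.inl rfl) h' (Or.inl rfl)
  cases this
  rfl

theorem cases_label (hT : IsCurtisTable d b T) (x : Σ s, I s) :
    Item.untagged x ∈ T ∨ (∃ c, Item.tag x c ∈ T) ∨ ∃ a, Item.tag a x ∈ T := by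
  obtain ⟨it, ⟨h, hx⟩, -⟩ := hT.once x
  cases it with
  | untagged y =>
    obtain rfl : x = y := hx
    exact Or.inl h
  | tag a c =>
    rcases hx with rfl | rfl
    · exact Or.inr (Or.inl ⟨c, h⟩)
    · exact Or.inr (Or.inr ⟨a, h⟩)

theorem exists_head_eq (hT : IsCurtisTable d b T) {a : Σ s, I s} {s : ℕ} {c : I s}
    (h : Item.tag a ⟨s, c⟩ ∈ T) : ∃ a' : I (s + 1), a = ⟨s + 1, a'⟩ := by
  obtain ⟨u, a⟩ := a
  have := hT.degree _ _ h
  change u = s + 1 at this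
  subst this
  exact ⟨a, rfl⟩

end IsCurtisTable

/-- A basis adapted to a Curtis table: it is triangular with respect to the given basis, and the
differential takes the source of each tag to its head and all other basis elements to zero. -/
structure IsAdapted (d : ∀ s, X s →ₗ[ZMod 2] X (s + 1))
    (b : ∀ s, Module.Basis (I s) (ZMod 2) (X s)) (T : Set (Item (Σ s, I s)))
    (g : ∀ s, Module.Basis (I s) (ZMod 2) (X s)) : Prop where
  leading : ∀ s i, IsLeading (b s) (g s i) i
  untagged : ∀ s i, Item.untagged ⟨s, i⟩ ∈ T → d s (g s i) = 0
  tag : ∀ s a c, Item.tag ⟨s + 1, a⟩ ⟨s, c⟩ ∈ T → d s (g s c) = g (s + 1) a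
  head : ∀ s i c, Item.tag ⟨s, i⟩ c ∈ T → d s (g s i) = 0

/-- For each tag `a ← c` choose `y` as in (iii) and put `y` at `c` and `d y` at `a`; at untagged
labels put cycles from (ii). Each label occurs in exactly one item, so there are no conflicts, and
the family is triangular, hence a basis. -/
theorem IsCurtisTable.exists_isAdapted [∀ s, Finite (I s)] (hT : IsCurtisTable d b T)
    (hdd : ∀ s x, d (s + 1) (d s x) = 0) : ∃ g, IsAdapted d b T g := by
  have hY : ∀ x : Σ s, I s, ∃ y : X x.1, ∀ a, Item.tag ⟨x.1 + 1, a⟩ x ∈ T →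
      IsLeading (b x.1) y x.2 ∧ IsLeading (b (x.1 + 1)) (d x.1 y) a := by
    rintro ⟨s, c⟩
    by_cases h : ∃ a, Item.tag ⟨s + 1, a⟩ ⟨s, c⟩ ∈ T
    · obtain ⟨a, ha⟩ := h
      obtain ⟨y, hy⟩ := hT.tag_lift s a c ha
      refine ⟨y, fun a' ha' => ?_⟩
      obtain rfl : a = a' := by
        have := hT.head_unique ha ha'
        cases this
        rfl
      exact hy
    · exact ⟨0, fun a ha => absurd ⟨a, ha⟩ h⟩
  choose Y hY using hY
  -- The last clause is an equality of pairs because `s = c.1 + 1` is only a propositional equality.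
  have hG : ∀ s (i : I s), ∃ v : X s, IsLeading (b s) v i ∧
      (Item.untagged ⟨s, i⟩ ∈ T → d s v = 0) ∧
      (∀ a, Item.tag a ⟨s, i⟩ ∈ T → v = Y ⟨s, i⟩) ∧
      (∀ c : Σ s, I s, Item.tag ⟨s, i⟩ c ∈ T →
        (⟨s, v⟩ : Σ s, X s) = ⟨c.1 + 1, d c.1 (Y c)⟩) := by
    intro s i
    rcases hT.cases_label ⟨s, i⟩ with h | ⟨c, h⟩ | ⟨a, h⟩
    · obtain ⟨z, hz, hzi⟩ := (hT.head_iff ⟨s, i⟩).1 ⟨_, h, rfl⟩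
      exact ⟨z, hzi, fun _ => hz, fun a ha => absurd h (hT.not_untagged_source ha),
        fun c hc => absurd h (hT.not_untagged_head hc)⟩
    · have hs := hT.degree _ _ h
      change s = c.1 + 1 at hs
      subst hs
      refine ⟨d c.1 (Y c), (hY c i h).2, fun h' => absurd h' (hT.not_untagged_head h),
        fun a ha => absurd rfl (hT.head_ne_source ha h), fun c' hc' => ?_⟩
      rw [hT.source_unique h hc']
    · obtain ⟨a, rfl⟩ := hT.exists_head_eq h
      exact ⟨Y ⟨s, i⟩, (hY ⟨s, i⟩ a h).1, fun h' => absurd h' (hT.not_untagged_source h),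
        fun _ _ => rfl, fun c' hc' => absurd rfl (hT.head_ne_source h hc')⟩
  choose G hlead hunt hsrc hhead using hG
  choose g hg using fun s => exists_basis_of_isLeading (b := b s) (hlead s)
  have htag : ∀ s a c, Item.tag ⟨s + 1, a⟩ ⟨s, c⟩ ∈ T → d s (G s c) = G (s + 1) a := by
    intro s a c h
    have h1 := hhead _ _ _ h
    rw [hsrc s c _ h]
    exact (eq_of_heq (Sigma.mk.inj h1).2).symm
  refine ⟨g, fun s i => hg s i ▸ hlead s i, fun s i h => hg s i ▸ hunt s i h,
    fun s a c h => ?_, fun s i c h => ?_⟩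
  · rw [hg, hg, htag s a c h]
  · have hs := hT.degree _ _ h
    obtain ⟨u, c⟩ := c
    change s = u + 1 at hs
    subst hs
    rw [hg, ← htag u i c h, hdd]

namespace IsAdapted

variable {g : ∀ s, Module.Basis (I s) (ZMod 2) (X s)}

/-- In an adapted basis the matrix of the differential is a partial permutation matrix. -/
theorem repr_d_of_tag (hg : IsAdapted d b T g) (hT : IsCurtisTable d b T) {s : ℕ} {a : I (s + 1)}
    {c : I s} (h : Item.tag ⟨s + 1, a⟩ ⟨s, c⟩ ∈ T) (y : X s) :
    (g (s + 1)).repr (d s y) a = (g s).repr y c := by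
  have key : (g (s + 1)).coord a ∘ₗ d s = (g s).coord c := by
    refine (g s).ext fun i => ?_
    simp only [LinearMap.comp_apply, Module.Basis.coord_apply]
    rcases hT.cases_label ⟨s, i⟩ with h' | ⟨c', h'⟩ | ⟨a', h'⟩
    · have : i ≠ c := by rintro rfl; exact hT.not_untagged_source h h'
      simp [hg.untagged s i h', this]
    · have : i ≠ c := by rintro rfl; exact hT.head_ne_source h h' rfl
      simp [hg.head s i c' h', this]
    · obtain ⟨a', rfl⟩ := hT.exists_head_eq h'
      rw [hg.tag s a' i h']
      by_cases hic : i = c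
      · subst hic
        have := hT.head_unique h h'
        cases this
        simp
      · have : a' ≠ a := by
          rintro rfl
          have := hT.source_unique h h'
          cases this
          exact hic rfl
        simp [hic, this]
  exact LinearMap.congr_fun key y

theorem repr_d_of_not_head (hg : IsAdapted d b T g) (hT : IsCurtisTable d b T) {s : ℕ}
    {a : I (s + 1)} (h : ∀ c : I s, Item.tag ⟨s + 1, a⟩ ⟨s, c⟩ ∉ T) (y : X s) :
    (g (s + 1)).repr (d s y) a = 0 := by
  have key : (g (s + 1)).coord a ∘ₗ d s = 0 := by
    refine (g s).ext fun i => ?_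
    simp only [LinearMap.comp_apply, Module.Basis.coord_apply, LinearMap.zero_apply]
    rcases hT.cases_label ⟨s, i⟩ with h' | ⟨c', h'⟩ | ⟨a', h'⟩
    · simp [hg.untagged s i h']
    · simp [hg.head s i c' h']
    · obtain ⟨a', rfl⟩ := hT.exists_head_eq h'
      rw [hg.tag s a' i h']
      have : a' ≠ a := by rintro rfl; exact h i h'
      simp [this]
  exact LinearMap.congr_fun key y

theorem isLeading_iff [∀ s, Finite (I s)] (hg : IsAdapted d b T g) {s : ℕ} {x : X s} {i : I s} :
    IsLeading (g s) x i ↔ IsLeading (b s) x i :=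
  isLeading_iff_of_triangular (hg.leading s)

end IsAdapted

namespace IsCurtisTable

/-- The leading terms of boundaries are the heads of the tags. -/
theorem exists_tag_of_isLeading_d [∀ s, Finite (I s)] (hT : IsCurtisTable d b T)
    (hdd : ∀ s x, d (s + 1) (d s x) = 0) {s : ℕ} {y : X s} {a : I (s + 1)}
    (ha : IsLeading (b (s + 1)) (d s y) a) : ∃ c : I s, Item.tag ⟨s + 1, a⟩ ⟨s, c⟩ ∈ T := by
  obtain ⟨g, hg⟩ := hT.exists_isAdapted hdd
  by_contra! h
  exact (hg.isLeading_iff.2 ha).1 (hg.repr_d_of_not_head hT h y)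

/-- In an adapted basis the coordinate of `d y` at the head is that of `y` at the source, so it is
nonzero. The head is thus the least possible leading term of a boundary `d y`, and so is determined
by the source. -/
theorem exists_isLeading_d_ge [∀ s, Finite (I s)] (hT : IsCurtisTable d b T)
    (hdd : ∀ s x, d (s + 1) (d s x) = 0) {s : ℕ} {a : I (s + 1)} {c : I s}
    (h : Item.tag ⟨s + 1, a⟩ ⟨s, c⟩ ∈ T) {y : X s} (hy : IsLeading (b s) y c) :
    ∃ a', a ≤ a' ∧ IsLeading (b (s + 1)) (d s y) a' := by
  obtain ⟨g, hg⟩ := hT.exists_isAdapted hdd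
  have h1 : (g (s + 1)).repr (d s y) a ≠ 0 := by
    rw [hg.repr_d_of_tag hT h]
    exact (hg.isLeading_iff.2 hy).1
  obtain ⟨a', ha', hl⟩ := exists_isLeading_ge h1
  exact ⟨a', ha', hg.isLeading_iff.1 hl⟩

/-- Sources are exactly the labels that lead no cycle, a condition independent of the table. -/
theorem exists_tag_of_tag (hT : IsCurtisTable d b T) (hT' : IsCurtisTable d b T')
    {x c : Σ s, I s} (h : Item.tag x c ∈ T) : ∃ a, Item.tag a c ∈ T' := by
  have hc : ¬ ∃ it ∈ T', it.head = c := by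
    rw [hT'.head_iff, ← hT.head_iff]
    rintro ⟨it, hit, he⟩
    exact hT.head_ne_source h hit he
  rcases hT'.cases_label c with h' | ⟨c', h'⟩ | h'
  · exact absurd ⟨_, h', rfl⟩ hc
  · exact absurd ⟨_, h', rfl⟩ hc
  · exact h'

theorem tag_mem_of_tag_mem [∀ s, Finite (I s)] (hT : IsCurtisTable d b T) (hT' : IsCurtisTable d b T')
    (hdd : ∀ s x, d (s + 1) (d s x) = 0) {x c : Σ s, I s} (h : Item.tag x c ∈ T) :
    Item.tag x c ∈ T' := by
  obtain ⟨x', h'⟩ := hT.exists_tag_of_tag hT' h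
  obtain ⟨s, c⟩ := c
  obtain ⟨a, rfl⟩ := hT.exists_head_eq h
  obtain ⟨a', rfl⟩ := hT'.exists_head_eq h'
  obtain ⟨y, hy, hya⟩ := hT.tag_lift s a c h
  obtain ⟨y', hy', hya'⟩ := hT'.tag_lift s a' c h'
  obtain ⟨a₁, h₁, hl₁⟩ := hT.exists_isLeading_d_ge hdd h hy'
  obtain ⟨a₂, h₂, hl₂⟩ := hT'.exists_isLeading_d_ge hdd h' hy
  rw [hl₁.unique hya'] at h₁
  rw [hl₂.unique hya] at h₂
  rwa [le_antisymm h₁ h₂]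

theorem subset_of_isCurtisTable [∀ s, Finite (I s)] (hT : IsCurtisTable d b T) (hT' : IsCurtisTable d b T')
    (hdd : ∀ s x, d (s + 1) (d s x) = 0) : T ⊆ T' := by
  intro it hit
  cases it with
  | tag a c => exact hT.tag_mem_of_tag_mem hT' hdd hit
  | untagged x =>
    rcases hT'.cases_label x with h | ⟨c, h⟩ | ⟨a, h⟩
    · exact h
    · exact absurd hit (hT.not_untagged_head (hT'.tag_mem_of_tag_mem hT hdd h))
    · exact absurd hit (hT.not_untagged_source (hT'.tag_mem_of_tag_mem hT hdd h))

theorem unique [∀ s, Finite (I s)] (hT : IsCurtisTable d b T) (hT' : IsCurtisTable d b T')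
    (hdd : ∀ s x, d (s + 1) (d s x) = 0) : T = T' :=
  (hT.subset_of_isCurtisTable hT' hdd).antisymm (hT'.subset_of_isCurtisTable hT hdd)

end IsCurtisTable

/-- `a` is the smallest leading term of the boundaries of elements with leading term `c`, all of
which are nonzero. -/
def IsMinTag (d : ∀ s, X s →ₗ[ZMod 2] X (s + 1))
    (b : ∀ s, Module.Basis (I s) (ZMod 2) (X s)) (s : ℕ) (a : I (s + 1)) (c : I s) : Prop :=
  (∃ y, IsLeading (b s) y c ∧ IsLeading (b (s + 1)) (d s y) a) ∧
    ∀ y, IsLeading (b s) y c → ∃ a', a ≤ a' ∧ IsLeading (b (s + 1)) (d s y) a'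

/-- Some cycle has leading term `x`. -/
def IsCycleLeading (d : ∀ s, X s →ₗ[ZMod 2] X (s + 1))
    (b : ∀ s, Module.Basis (I s) (ZMod 2) (X s)) (x : Σ s, I s) : Prop :=
  ∃ z : X x.1, d x.1 z = 0 ∧ IsLeading (b x.1) z x.2

/-- The minimal tags as a relation on labels. -/
def MinTag (d : ∀ s, X s →ₗ[ZMod 2] X (s + 1))
    (b : ∀ s, Module.Basis (I s) (ZMod 2) (X s)) (x y : Σ s, I s) : Prop :=
  ∃ s a c, x = ⟨s + 1, a⟩ ∧ y = ⟨s, c⟩ ∧ IsMinTag d b s a c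

theorem MinTag.not_isCycleLeading {x y : Σ s, I s} (h : MinTag d b x y) :
    ¬ IsCycleLeading d b y := by
  obtain ⟨s, a, c, rfl, rfl, h⟩ := h
  rintro ⟨z, hz, hzc⟩
  obtain ⟨a', -, ha'⟩ := h.2 z hzc
  exact ha'.ne_zero hz

theorem MinTag.isCycleLeading (hdd : ∀ s x, d (s + 1) (d s x) = 0) {x y : Σ s, I s}
    (h : MinTag d b x y) : IsCycleLeading d b x := by
  obtain ⟨s, a, c, rfl, rfl, ⟨y, -, hy⟩, -⟩ := h
  exact ⟨d s y, hdd s y, hy⟩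

theorem exists_minTag [∀ s, Finite (I s)] {y : Σ s, I s} (h : ¬ IsCycleLeading d b y) : ∃ x, MinTag d b x y := by
  obtain ⟨s, c⟩ := y
  have hne : ∀ y, IsLeading (b s) y c → ∃ a, IsLeading (b (s + 1)) (d s y) a := fun y hy =>
    exists_isLeading _ fun h0 => h ⟨y, h0, hy⟩
  obtain ⟨a₀, ha₀⟩ := hne _ (isLeading_self (b s) c)
  obtain ⟨a, ⟨y, hy, hya⟩, hmin⟩ := (Set.toFinite
    {a | ∃ y, IsLeading (b s) y c ∧ IsLeading (b (s + 1)) (d s y) a}).exists_minimal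
      ⟨a₀, _, isLeading_self (b s) c, ha₀⟩
  refine ⟨_, s, a, c, rfl, rfl, ⟨y, hy, hya⟩, fun y' hy' => ?_⟩
  obtain ⟨a', ha'⟩ := hne y' hy'
  refine ⟨a', ?_, ha'⟩
  rcases le_total a a' with h | h
  · exact h
  · exact hmin ⟨y', hy', ha'⟩ h

theorem MinTag.head_unique {x x' y : Σ s, I s} (h : MinTag d b x y) (h' : MinTag d b x' y) :
    x = x' := by
  obtain ⟨s, a, c, rfl, rfl, ⟨y, hy, hya⟩, hmin⟩ := h
  obtain ⟨s', a', c', rfl, he, ⟨y', hy', hya'⟩, hmin'⟩ := h'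
  cases he
  obtain ⟨a₁, h₁, hl₁⟩ := hmin y' hy'
  obtain ⟨a₂, h₂, hl₂⟩ := hmin' y hy
  rw [hl₁.unique hya'] at h₁
  rw [hl₂.unique hya] at h₂
  rw [le_antisymm h₁ h₂]

/-- If `c < c'`, then `y' + y` still has leading term `c'`, but the leading terms `a` of the two
boundaries cancel, against the minimality of `a` for `c'`. -/
theorem IsMinTag.not_lt {s : ℕ} {a : I (s + 1)} {c c' : I s} (h : IsMinTag d b s a c)
    (h' : IsMinTag d b s a c') : ¬ c < c' := by
  intro hlt
  obtain ⟨y, hy, hya⟩ := h.1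
  obtain ⟨y', hy', hya'⟩ := h'.1
  obtain ⟨a₁, h₁, hl₁⟩ := h'.2 (y' + y)
    (hy'.add_of_forall_eq_zero fun j hj => hy.2 j (hlt.trans_le hj))
  refine hl₁.1 ?_
  rw [map_add (d s)]
  exact hya'.repr_add_eq_zero hya h₁

theorem MinTag.source_unique {x y y' : Σ s, I s} (h : MinTag d b x y) (h' : MinTag d b x y') :
    y = y' := by
  obtain ⟨s, a, c, rfl, rfl, h⟩ := h
  obtain ⟨s', a', c', he, rfl, h'⟩ := h'
  cases he
  rw [le_antisymm (not_lt.1 (h'.not_lt h)) (not_lt.1 (h.not_lt h'))]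

/-- The tags are the minimal tags. Each label that leads no cycle is the source of exactly one of
them, each label is the head of at most one, and the remaining labels are left untagged. -/
theorem exists_isCurtisTable [∀ s, Finite (I s)] (b : ∀ s, Module.Basis (I s) (ZMod 2) (X s))
    (hdd : ∀ s x, d (s + 1) (d s x) = 0) : ∃ T, IsCurtisTable d b T := by
  refine ⟨{it | (∃ x, it = .untagged x ∧ IsCycleLeading d b x ∧ ∀ c, ¬ MinTag d b x c) ∨
    ∃ x c, it = .tag x c ∧ MinTag d b x c}, ?_, ?_, ?_, ?_⟩
  · rintro a c (⟨x, he, -⟩ | ⟨x, y, he, s, a', c', rfl, rfl, -⟩)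
    · cases he
    · cases he
      rfl
  · intro x
    by_cases hx : IsCycleLeading d b x
    · by_cases hc : ∃ c, MinTag d b x c
      · obtain ⟨c, hc⟩ := hc
        refine ⟨.tag x c, ⟨Or.inr ⟨x, c, rfl, hc⟩, Or.inl rfl⟩, ?_⟩
        rintro it ⟨⟨y, rfl, -, hy⟩ | ⟨y, c', rfl, hy⟩, hcont⟩
        · obtain rfl : x = y := hcont
          exact absurd hc (hy c)
        · rcases hcont with rfl | rfl
          · rw [hy.source_unique hc]
          · exact absurd hx hy.not_isCycleLeading
      · push Not at hc
        refine ⟨.untagged x, ⟨Or.inl ⟨x, rfl, hx, hc⟩, rfl⟩, ?_⟩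
        rintro it ⟨⟨y, rfl, -, hy⟩ | ⟨y, c', rfl, hy⟩, hcont⟩
        · obtain rfl : x = y := hcont
          rfl
        · rcases hcont with rfl | rfl
          · exact absurd hy (hc c')
          · exact absurd hx hy.not_isCycleLeading
    · obtain ⟨a, ha⟩ := exists_minTag hx
      refine ⟨.tag a x, ⟨Or.inr ⟨a, x, rfl, ha⟩, Or.inr rfl⟩, ?_⟩
      rintro it ⟨⟨y, rfl, hyc, -⟩ | ⟨y, c', rfl, hy⟩, hcont⟩
      · obtain rfl : x = y := hcont
        exact absurd hyc hx
      · rcases hcont with rfl | rfl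
        · exact absurd (hy.isCycleLeading hdd) hx
        · rw [hy.head_unique ha]
  · intro x
    constructor
    · rintro ⟨it, ⟨y, rfl, hy, -⟩ | ⟨y, c', rfl, hy⟩, rfl⟩
      · exact hy
      · exact hy.isCycleLeading hdd
    · intro hx
      by_cases hc : ∃ c, MinTag d b x c
      · obtain ⟨c, hc⟩ := hc
        exact ⟨.tag x c, Or.inr ⟨x, c, rfl, hc⟩, rfl⟩
      · push Not at hc
        exact ⟨.untagged x, Or.inl ⟨x, rfl, hx, hc⟩, rfl⟩
  · rintro s a c (⟨x, he, -⟩ | ⟨x, y, he, s', a', c', rfl, rfl, h⟩)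
    · cases he
    · cases he
      exact h.1

theorem existsUnique_isCurtisTable [∀ s, Finite (I s)] (b : ∀ s, Module.Basis (I s) (ZMod 2) (X s))
    (hdd : ∀ s x, d (s + 1) (d s x) = 0) : ∃! T, IsCurtisTable d b T := by
  obtain ⟨T, hT⟩ := exists_isCurtisTable b hdd
  exact ⟨T, hT, fun T' hT' => hT'.unique hT hdd⟩

/-- A Curtis table depends on the bases only through the leading terms. -/
theorem IsCurtisTable.congr {b' : ∀ s, Module.Basis (I s) (ZMod 2) (X s)}
    (h : ∀ s x i, IsLeading (b s) x i ↔ IsLeading (b' s) x i) (hT : IsCurtisTable d b T) :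
    IsCurtisTable d b' T where
  degree := hT.degree
  once := hT.once
  head_iff x := by simpa only [h] using hT.head_iff x
  tag_lift := by simpa only [h] using hT.tag_lift

/-- The table of a matching of the labels. -/
def matchingTable {P : Type*} (τ : P → P → Prop) : Set (Item P) :=
  {it | (∃ x, it = .untagged x ∧ ∀ y, ¬ τ x y ∧ ¬ τ y x) ∨ ∃ a c, it = .tag a c ∧ τ a c}

theorem tag_mem_matchingTable {P : Type*} {τ : P → P → Prop} {a c : P} :
    Item.tag a c ∈ matchingTable τ ↔ τ a c := by
  constructor
  · rintro (⟨x, he, -⟩ | ⟨a, c, he, h⟩)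
    · cases he
    · cases he
      exact h
  · exact fun h => Or.inr ⟨a, c, rfl, h⟩

theorem untagged_mem_matchingTable {P : Type*} {τ : P → P → Prop} {x : P} :
    Item.untagged x ∈ matchingTable τ ↔ ∀ y, ¬ τ x y ∧ ¬ τ y x := by
  constructor
  · rintro (⟨x, he, h⟩ | ⟨a, c, he, h⟩)
    · cases he
      exact h
    · cases he
  · exact fun h => Or.inl ⟨x, rfl, h⟩

/-- If the differential matches basis elements with basis elements, then this matching is a
Curtis table. -/
theorem isCurtisTable_matchingTable {τ : (Σ s, I s) → (Σ s, I s) → Prop}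
    (hdeg : ∀ a c, τ a c → a.1 = c.1 + 1) (hhead : ∀ a a' c, τ a c → τ a' c → a = a')
    (hsource : ∀ a c c', τ a c → τ a c' → c = c') (hdisj : ∀ a c c', τ a c → ¬ τ c c')
    (hd : ∀ s a c, τ ⟨s + 1, a⟩ ⟨s, c⟩ → d s (b s c) = b (s + 1) a)
    (hd₀ : ∀ s c, (∀ a, ¬ τ a ⟨s, c⟩) → d s (b s c) = 0) :
    IsCurtisTable d b (matchingTable τ) where
  degree a c h := hdeg a c (tag_mem_matchingTable.1 h)
  once x := by
    by_cases h1 : ∃ c, τ x c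
    · obtain ⟨c, hc⟩ := h1
      refine ⟨.tag x c, ⟨tag_mem_matchingTable.2 hc, Or.inl rfl⟩, ?_⟩
      rintro (y | ⟨a, c'⟩) ⟨hit, hcont⟩
      · obtain rfl : x = y := hcont
        exact absurd hc (untagged_mem_matchingTable.1 hit c).1
      · rw [tag_mem_matchingTable] at hit
        rcases hcont with rfl | rfl
        · rw [hsource _ _ _ hc hit]
        · exact absurd hc (hdisj _ _ _ hit)
    by_cases h2 : ∃ a, τ a x
    · obtain ⟨a, ha⟩ := h2
      refine ⟨.tag a x, ⟨tag_mem_matchingTable.2 ha, Or.inr rfl⟩, ?_⟩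
      rintro (y | ⟨a', c'⟩) ⟨hit, hcont⟩
      · obtain rfl : x = y := hcont
        exact absurd ha (untagged_mem_matchingTable.1 hit a).2
      · rw [tag_mem_matchingTable] at hit
        rcases hcont with rfl | rfl
        · exact absurd ⟨_, hit⟩ h1
        · rw [hhead _ _ _ ha hit]
    push Not at h1 h2
    refine ⟨.untagged x, ⟨untagged_mem_matchingTable.2 fun y => ⟨h1 y, h2 y⟩, rfl⟩, ?_⟩
    rintro (y | ⟨a', c'⟩) ⟨hit, hcont⟩
    · obtain rfl : x = y := hcont
      rfl
    · rw [tag_mem_matchingTable] at hit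
      rcases hcont with rfl | rfl
      · exact absurd hit (h1 _)
      · exact absurd hit (h2 _)
  head_iff x := by
    constructor
    · rintro ⟨y | ⟨a, c⟩, hit, rfl⟩
      · refine ⟨b _ y.2, hd₀ _ _ fun a => ?_, isLeading_self _ _⟩
        exact (untagged_mem_matchingTable.1 hit a).2
      · refine ⟨b _ a.2, hd₀ _ _ fun a' ha' => ?_, isLeading_self _ _⟩
        exact hdisj _ _ _ ha' (tag_mem_matchingTable.1 hit)
    · rintro ⟨z, hz, hl⟩
      by_cases h1 : ∃ c, τ x c
      · obtain ⟨c, hc⟩ := h1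
        exact ⟨.tag x c, tag_mem_matchingTable.2 hc, rfl⟩
      by_cases h2 : ∃ a, τ a x
      · exfalso
        obtain ⟨⟨u, a⟩, ha⟩ := h2
        obtain ⟨s, c⟩ := x
        obtain rfl : u = s + 1 := hdeg _ _ ha
        -- The coordinate of `d z` at `a` is that of `z` at `c`, so a cycle has no coefficient at a
        -- source.
        have key : (b (s + 1)).coord a ∘ₗ d s = (b s).coord c := by
          refine (b s).ext fun i => ?_
          simp only [LinearMap.comp_apply, Module.Basis.coord_apply]
          by_cases hi : ∃ a', τ a' ⟨s, i⟩
          · obtain ⟨⟨u, a'⟩, ha'⟩ := hi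
            obtain rfl : u = s + 1 := hdeg _ _ ha'
            rw [hd s a' i ha']
            by_cases hic : i = c
            · subst hic
              cases hhead _ _ _ ha ha'
              simp
            · have : a' ≠ a := by
                rintro rfl
                cases hsource _ _ _ ha ha'
                exact hic rfl
              simp [hic, this]
          · push Not at hi
            have : i ≠ c := by rintro rfl; exact hi _ ha
            simp [hd₀ s i hi, this]
        have h3 := LinearMap.congr_fun key z
        simp only [LinearMap.comp_apply, Module.Basis.coord_apply] at h3
        refine hl.1 (h3.symm.trans ?_)
        rw [show d s z = 0 from hz]
        simp
      push Not at h1 h2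
      exact ⟨.untagged x, untagged_mem_matchingTable.2 fun y => ⟨h1 y, h2 y⟩, rfl⟩
  tag_lift s a c h := by
    refine ⟨b s c, isLeading_self _ _, ?_⟩
    rw [hd s a c (tag_mem_matchingTable.1 h)]
    exact isLeading_self _ _

end Table

end CurtisAHSS

/-! ### Leading terms on the pages and in the limit of the spectral sequence -/

namespace CurtisAHSS

universe u w

namespace FilteredComplex

/-! ### Classes on the pages of the spectral sequence -/

section Pages

variable {C : FilteredComplex.{u}} {r n : ℤ} {s : ℕ}

theorem mem_Z {x : C.X s} : x ∈ C.Z r n s ↔ x ∈ C.fil n s ∧ C.d s x ∈ C.fil (n - r) (s + 1) :=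
  Iff.rfl

theorem d_eq_zero_of_mem_boundaries {W : ∀ s, Submodule (ZMod 2) (C.X s)} {x : C.X s}
    (h : x ∈ C.boundaries W s) : C.d s x = 0 := by
  cases s with
  | zero =>
    have : x = 0 := by simpa [boundaries] using h
    rw [this, map_zero]
  | succ s =>
    obtain ⟨y, -, rfl⟩ := h
    exact C.d_d s y

theorem boundaries_mono {W W' : ∀ s, Submodule (ZMod 2) (C.X s)} (h : ∀ s, W s ≤ W' s) (s : ℕ) :
    C.boundaries W s ≤ C.boundaries W' s := by
  cases s with
  | zero => exact le_rfl
  | succ s => exact Submodule.map_mono (h s)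

theorem mem_fil_of_mem_boundaries {x : C.X s}
    (h : x ∈ C.boundaries (C.Z (r - 1) (n + r - 1)) s) : x ∈ C.fil n s := by
  cases s with
  | zero =>
    have : x = 0 := by simpa [boundaries] using h
    rw [this]
    exact zero_mem _
  | succ s =>
    obtain ⟨y, hy, rfl⟩ := h
    have := (mem_Z.1 hy).2
    rwa [show n + r - 1 - (r - 1) = n by ring] at this

theorem mem_Z_of_cycle {x : C.X s} (hx : x ∈ C.fil n s) (hd : C.d s x = 0) : x ∈ C.Z r n s :=
  mem_Z.2 ⟨hx, by rw [hd]; exact zero_mem _⟩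

theorem Z_sub_one_le : C.Z (r - 1) (n - 1) s ≤ C.Z r n s := fun x hx =>
  mem_Z.2 ⟨C.fil_mono _ _ (by omega) s (mem_Z.1 hx).1, by
    have := (mem_Z.1 hx).2
    rwa [show n - 1 - (r - 1) = n - r by ring] at this⟩

theorem cls_eq_zero_iff (x : C.Z r n s) : C.cls r n s x = 0 ↔ x.1 ∈ C.D r n s := by
  rw [cls, LinearMap.comp_apply]
  constructor
  · intro h
    have h1 := DirectSum.of_injective (β := fun n => C.E r n s) n (h.trans (map_zero _).symm)
    rw [Submodule.mkQ_apply, Submodule.Quotient.mk_eq_zero] at h1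
    exact h1
  · intro h
    have h1 : Submodule.mkQ ((C.D r n s).submoduleOf (C.Z r n s)) x = 0 := by
      rw [Submodule.mkQ_apply, Submodule.Quotient.mk_eq_zero]
      exact h
    rw [h1, map_zero]

theorem cls_eq_iff (x y : C.Z r n s) :
    C.cls r n s x = C.cls r n s y ↔ x.1 - y.1 ∈ C.D r n s := by
  have h : C.cls r n s (x - y) = C.cls r n s x - C.cls r n s y :=
    LinearMap.map_sub (M₂ := C.Page r s) (C.cls r n s) x y
  rw [← sub_eq_zero, ← h, cls_eq_zero_iff]
  rfl

theorem cls_congr_degree {n' : ℤ} (hn : n = n') {x : C.X s} (hx : x ∈ C.Z r n s)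
    (hx' : x ∈ C.Z r n' s) : C.cls r n s ⟨x, hx⟩ = C.cls r n' s ⟨x, hx'⟩ := by
  subst hn
  rfl

theorem dPage_cls (x : C.Z r n s) :
    C.dPage r s (C.cls r n s x) = C.cls r (n - r) (s + 1) (C.dZ r n s x) := by
  rw [dPage, cls, LinearMap.comp_apply, DirectSum.toModule_lof]
  rfl

/-- The projection of a page onto its part of filtration degree `n`. -/
noncomputable def homogeneousPart (C : FilteredComplex.{u}) (r : ℤ) (s : ℕ) (n : ℤ) :
    C.Page r s →ₗ[ZMod 2] C.Page r s :=
  DirectSum.lof (ZMod 2) ℤ (fun n => C.E r n s) n ∘ₗ DirectSum.component (ZMod 2) ℤ _ n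

theorem homogeneousPart_cls_self (x : C.Z r n s) :
    C.homogeneousPart r s n (C.cls r n s x) = C.cls r n s x := by
  simp [homogeneousPart, cls, DirectSum.component.lof_self]

theorem homogeneousPart_cls_of_ne {m : ℤ} (h : n ≠ m) (x : C.Z r n s) :
    C.homogeneousPart r s m (C.cls r n s x) = 0 := by
  simp [homogeneousPart, cls, DirectSum.component.of, h]

theorem exists_homogeneousPart_eq_cls (y : C.Page r s) (n : ℤ) :
    ∃ x : C.Z r n s, C.homogeneousPart r s n y = C.cls r n s x := by
  obtain ⟨x, hx⟩ := Submodule.mkQ_surjective _ (DirectSum.component (ZMod 2) ℤ _ n y)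
  exact ⟨x, by rw [homogeneousPart, cls, LinearMap.comp_apply, LinearMap.comp_apply, hx]⟩

theorem page_ext {N : Type*} [AddCommGroup N] [Module (ZMod 2) N] {f g : C.Page r s →ₗ[ZMod 2] N}
    (h : ∀ n (x : C.Z r n s), f (C.cls r n s x) = g (C.cls r n s x)) : f = g := by
  refine DirectSum.linearMap_ext _ fun n => ?_
  refine LinearMap.ext fun q => ?_
  obtain ⟨x, rfl⟩ := Submodule.mkQ_surjective _ q
  exact h n x

theorem dPage_dPage (y : C.Page r s) : C.dPage r (s + 1) (C.dPage r s y) = 0 := by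
  have : C.dPage r (s + 1) ∘ₗ C.dPage r s = 0 := by
    refine page_ext (N := C.Page r (s + 1 + 1)) fun n x => ?_
    rw [LinearMap.comp_apply, dPage_cls, dPage_cls, LinearMap.zero_apply, cls_eq_zero_iff]
    change C.d (s + 1) (C.d s x.1) ∈ _
    rw [C.d_d]
    exact zero_mem _
  exact LinearMap.congr_fun this y

theorem dPage_homogeneousPart (y : C.Page r s) (n : ℤ) :
    C.dPage r s (C.homogeneousPart r s n y) =
      C.homogeneousPart r (s + 1) (n - r) (C.dPage r s y) := by
  have : C.dPage r s ∘ₗ C.homogeneousPart r s n =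
      C.homogeneousPart r (s + 1) (n - r) ∘ₗ C.dPage r s := by
    refine page_ext (N := C.Page r (s + 1)) fun m x => ?_
    simp only [LinearMap.comp_apply]
    by_cases hm : m = n
    · subst hm
      rw [homogeneousPart_cls_self, dPage_cls, homogeneousPart_cls_self]
    · rw [homogeneousPart_cls_of_ne hm, dPage_cls, map_zero,
        homogeneousPart_cls_of_ne (by omega)]
  exact LinearMap.congr_fun this y

theorem cls_smul {m : ℤ} {c : ZMod 2} (h : c ≠ 0 → m = n) {x : C.X s} (hx : x ∈ C.Z r m s)
    (hcx : c • x ∈ C.Z r n s) : C.cls r n s ⟨c • x, hcx⟩ = c • C.cls r m s ⟨x, hx⟩ := by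
  by_cases hc : c = 0
  · subst hc
    rw [zero_smul (ZMod 2) (C.cls r m s ⟨x, hx⟩), cls_eq_zero_iff]
    change (0 : ZMod 2) • x ∈ _
    rw [zero_smul]
    exact zero_mem _
  · obtain rfl := h hc
    rw [← map_smul]
    rfl

theorem smul_mem_Z {m : ℤ} {c : ZMod 2} (h : c ≠ 0 → m = n) {x : C.X s} (hx : x ∈ C.Z r m s) :
    c • x ∈ C.Z r n s := by
  by_cases hc : c = 0
  · rw [hc, zero_smul]
    exact zero_mem _
  · rw [← h hc]
    exact Submodule.smul_mem _ _ hx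

/-- The sum runs over elements of various filtration degrees; only those of degree `n` may have a
nonzero coefficient. -/
theorem exists_cls_sum {ι : Type*} [Fintype ι] {m : ι → ℤ} {c : ι → ZMod 2} {x : ι → C.X s}
    (hx : ∀ i, x i ∈ C.Z r (m i) s) (h : ∀ i, c i ≠ 0 → m i = n) :
    ∃ hmem : ∑ i, c i • x i ∈ C.Z r n s,
      C.cls r n s ⟨∑ i, c i • x i, hmem⟩ = ∑ i, c i • C.cls r (m i) s ⟨x i, hx i⟩ := by
  have hmem : ∑ i, c i • x i ∈ C.Z r n s :=
    Submodule.sum_mem _ fun i _ => smul_mem_Z (h i) (hx i)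
  refine ⟨hmem, ?_⟩
  have he : (⟨∑ i, c i • x i, hmem⟩ : C.Z r n s) =
      ∑ i, ⟨c i • x i, smul_mem_Z (h i) (hx i)⟩ := Subtype.ext (by simp)
  rw [he, map_sum]
  exact Finset.sum_congr rfl fun i _ => cls_smul (h i) (hx i) _

theorem repr_homogeneousPart_of_basis {ι : Type*} {m : ι → ℤ}
    {β : Module.Basis ι (ZMod 2) (C.Page r s)}
    (hβ : ∀ i, ∃ x : C.Z r (m i) s, β i = C.cls r (m i) s x) (n : ℤ) (y : C.Page r s) (i : ι) :
    β.repr (C.homogeneousPart r s n y) i = if m i = n then β.repr y i else 0 := by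
  have key : β.coord i ∘ₗ C.homogeneousPart r s n = if m i = n then β.coord i else 0 := by
    refine β.ext fun j => ?_
    obtain ⟨x, he⟩ := hβ j
    rw [LinearMap.comp_apply]
    by_cases hj : m j = n
    · subst hj
      conv_lhs => rw [he, homogeneousPart_cls_self, ← he]
      split_ifs with h
      · rfl
      · have : j ≠ i := by rintro rfl; exact h rfl
        simp [this]
    · conv_lhs => rw [he, homogeneousPart_cls_of_ne hj]
      split_ifs with h
      · have : j ≠ i := by rintro rfl; exact hj h
        simp [this]
      · simp
  have h1 := LinearMap.congr_fun key y
  rw [LinearMap.comp_apply, Module.Basis.coord_apply] at h1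
  rw [h1]
  split_ifs
  · rfl
  · rfl

theorem repr_cls_eq_zero_of_basis {ι : Type*} {m : ι → ℤ}
    {β : Module.Basis ι (ZMod 2) (C.Page r s)}
    (hβ : ∀ i, ∃ x : C.Z r (m i) s, β i = C.cls r (m i) s x) (x : C.Z r n s) {i : ι}
    (h : m i ≠ n) : β.repr (C.cls r n s x) i = 0 := by
  rw [← homogeneousPart_cls_self, repr_homogeneousPart_of_basis hβ, if_neg h]

end Pages

/-! ### Bases that are compatible with the filtration -/

/-- The filtration is spanned by basis elements, and the filtration degree `wt` of the basis
elements is monotone. -/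
structure IsFilteredBasis (C : FilteredComplex.{u}) {I : ℕ → Type w} [∀ s, LinearOrder (I s)]
    (b : ∀ s, Module.Basis (I s) (ZMod 2) (C.X s)) (wt : ∀ s, I s → ℤ) : Prop where
  mono : ∀ s, Monotone (wt s)
  mem_fil_iff : ∀ n s x, x ∈ C.fil n s ↔ ∀ i, n < wt s i → (b s).repr x i = 0

variable {C : FilteredComplex.{u}} {I : ℕ → Type w} [∀ s, LinearOrder (I s)]
  {b : ∀ s, Module.Basis (I s) (ZMod 2) (C.X s)} {wt : ∀ s, I s → ℤ}

namespace IsFilteredBasis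

/-- Since `wt` is monotone, the leading term has the largest weight among the terms of `x`. -/
theorem mem_fil_iff_of_isLeading (h : C.IsFilteredBasis b wt) {s : ℕ} {x : C.X s} {i : I s}
    (hi : IsLeading (b s) x i) {n : ℤ} : x ∈ C.fil n s ↔ wt s i ≤ n := by
  rw [h.mem_fil_iff]
  constructor
  · intro h1
    by_contra h2
    exact hi.1 (h1 i (not_le.1 h2))
  · intro h1 j hj
    refine hi.2 j ?_
    by_contra h2
    exact absurd (h.mono s (not_lt.1 h2)) (not_le.2 (h1.trans_lt hj))

theorem repr_eq_zero_of_mem_fil (h : C.IsFilteredBasis b wt) {s : ℕ} {x : C.X s} {n : ℤ}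
    (hx : x ∈ C.fil (n - 1) s) {i j : I s} (hi : wt s i = n) (hij : i ≤ j) :
    (b s).repr x j = 0 :=
  (h.mem_fil_iff _ _ _).1 hx j (by have := h.mono s hij; omega)

theorem basis_mem_fil (h : C.IsFilteredBasis b wt) (s : ℕ) (i : I s) :
    b s i ∈ C.fil (wt s i) s :=
  (h.mem_fil_iff_of_isLeading (isLeading_self (b s) i)).2 le_rfl

/-- This is what turns elements of `Z_r` with `r` large into cycles. -/
theorem exists_lower_bound [∀ s, Finite (I s)] (h : C.IsFilteredBasis b wt) (s : ℕ) :
    ∃ m : ℤ, ∀ n ≤ m, ∀ x ∈ C.fil n s, x = 0 := by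
  obtain ⟨m, hm⟩ := (Set.finite_range (wt s)).bddBelow
  refine ⟨m - 1, fun n hn x hx => ?_⟩
  refine (b s).ext_elem fun i => ?_
  rw [map_zero, Finsupp.zero_apply]
  refine (h.mem_fil_iff _ _ _).1 hx i ?_
  have := hm ⟨i, rfl⟩
  omega

end IsFilteredBasis

/-! ### Leading terms on the pages -/

namespace LabelledPages

variable (P : C.LabelledPages b wt)

theorem exists_eq_cls (r s : ℕ) (i : P.U r s) :
    ∃ x : C.Z r (wt s i) s, P.β r s i = C.cls r (wt s i) s x := by
  cases r with
  | zero =>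
    obtain ⟨h, he⟩ := P.β_zero s i
    exact ⟨⟨_, h⟩, he⟩
  | succ r =>
    obtain ⟨-, x, -, hx', -, he⟩ := P.β_succ r s i
    exact ⟨⟨x, hx'⟩, he⟩

theorem repr_homogeneousPart (r s : ℕ) (n : ℤ) (y : C.Page r s) (i : P.U r s) :
    (P.β r s).repr (C.homogeneousPart r s n y) i =
      if wt s i = n then (P.β r s).repr y i else 0 :=
  repr_homogeneousPart_of_basis (m := fun i : P.U r s => wt s i) (P.exists_eq_cls r s) n y i

theorem repr_cls_eq_zero {r s : ℕ} {n : ℤ} (x : C.Z r n s) {i : P.U r s} (h : wt s i ≠ n) :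
    (P.β r s).repr (C.cls r n s x) i = 0 :=
  repr_cls_eq_zero_of_basis (m := fun i : P.U r s => wt s i) (P.exists_eq_cls r s) x h

theorem wt_eq_of_isLeading {r s : ℕ} {n : ℤ} {x : C.Z r n s} {i : P.U r s}
    (h : IsLeading (P.β r s) (C.cls r n s x) i) : wt s i = n := by
  by_contra hne
  exact h.1 (P.repr_cls_eq_zero x hne)

/-- Each label of a page is the class of an element with this leading term. -/
def LeadingRepresentatives (r : ℕ) : Prop :=
  ∀ (s : ℕ) (i : P.U r s), ∃ (x : C.X s) (hx : x ∈ C.Z r (wt s i) s),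
    IsLeading (b s) x i ∧ P.β r s i = C.cls r (wt s i) s ⟨x, hx⟩

/-- The leading terms of boundaries that vanish on a page are not labels of the page. -/
def BoundaryLeadingDead (r : ℕ) : Prop :=
  ∀ (s : ℕ) (n : ℤ) (v : C.X s) (i : I s), v ∈ C.boundaries (C.Z (r - 1) (n + r - 1)) s →
    IsLeading (b s) v i → wt s i = n → i ∉ P.U r s

variable {P}

/-- Expand the class in the labels. The same combination of representatives has leading term `i` and
differs from `x` by an element of `D`. The part of that element in `Z_{r-1}^{n-1}` lies in lower
filtration and cannot disturb a leading term of weight `n`; the other part is the boundary `v`. -/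
theorem LeadingRepresentatives.exists_isLeading_add [∀ s, Finite (I s)] (hb : C.IsFilteredBasis b wt) {r : ℕ}
    (h1 : P.LeadingRepresentatives r) {s : ℕ} {n : ℤ} {x : C.X s} {hx : x ∈ C.Z r n s}
    {i : P.U r s} (hi : IsLeading (P.β r s) (C.cls r n s ⟨x, hx⟩) i) :
    ∃ v ∈ C.boundaries (C.Z (r - 1) (n + r - 1)) s, IsLeading (b s) (x + v) i := by
  have := Fintype.ofFinite (P.U r s)
  have hwt := P.wt_eq_of_isLeading hi
  choose X hX hXl hXβ using h1 s
  set c : P.U r s → ZMod 2 := fun j => (P.β r s).repr (C.cls r n s ⟨x, hx⟩) j with hc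
  have hcn : ∀ j, c j ≠ 0 → wt s j = n := fun j hj => by
    by_contra hne
    exact hj (P.repr_cls_eq_zero _ hne)
  have hlead : IsLeading (b s) (∑ j, c j • X j) i :=
    isLeading_sum (f := fun j : P.U r s => j.1) (Subtype.strictMono_coe _) hXl hi.1 hi.2
  obtain ⟨hmem, hcls⟩ := exists_cls_sum (c := c) hX hcn
  rw [← Finset.sum_congr rfl fun j _ => congrArg (c j • ·) (hXβ j), (P.β r s).sum_repr] at hcls
  rw [cls_eq_iff] at hcls
  obtain ⟨y, hy, v, hv, he⟩ := Submodule.mem_sup.1 hcls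
  refine ⟨v, hv, ?_⟩
  have he' : x + v = ∑ j, c j • X j + -y := by
    have : y + v = ∑ j, c j • X j - x := he
    rw [eq_sub_iff_add_eq] at this
    rw [← this]
    abel
  rw [he']
  refine hlead.add_of_forall_eq_zero fun j hj => ?_
  exact hb.repr_eq_zero_of_mem_fil (neg_mem (mem_Z.1 hy).1) hwt hj

/-- The correcting boundary is zero on `E_{r+1}` too, so adding it changes the leading term of a
representative but not its class. -/
theorem LeadingRepresentatives.succ [∀ s, Finite (I s)] (hb : C.IsFilteredBasis b wt) {r : ℕ}
    (h1 : P.LeadingRepresentatives r) : P.LeadingRepresentatives (r + 1) := by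
  intro s i
  obtain ⟨h, x, hx, hx', hl, he⟩ := P.β_succ r s i
  obtain ⟨v, hv, hvl⟩ := h1.exists_isLeading_add hb hl
  have hvD : v ∈ C.boundaries (C.Z ((r + 1 : ℕ) - 1) (wt s i + (r + 1 : ℕ) - 1)) s := by
    have e1 : ((r + 1 : ℕ) : ℤ) - 1 = r := by push_cast; ring
    have e2 : wt s i + ((r + 1 : ℕ) : ℤ) - 1 = wt s i + r := by push_cast; ring
    rw [e1, e2]
    exact boundaries_mono (fun _ => Z_sub_one_le) s hv
  have hvZ : v ∈ C.Z (r + 1 : ℕ) (wt s i) s :=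
    mem_Z_of_cycle (mem_fil_of_mem_boundaries hv) (d_eq_zero_of_mem_boundaries hv)
  refine ⟨x + v, add_mem hx' hvZ, hvl, ?_⟩
  rw [he, eq_comm, cls_eq_iff]
  change x + v - x ∈ _
  rw [add_sub_cancel_left]
  exact Submodule.mem_sup_right hvD

/-- If the class were zero or had another leading term `j`, the boundary relating the two would have
leading term `i`, or the larger of `i` and `j`, although these are labels of the page. -/
theorem isLeading_cls_aux [∀ s, Finite (I s)] (hb : C.IsFilteredBasis b wt) {r : ℕ}
    (h1 : P.LeadingRepresentatives r) (h2 : P.BoundaryLeadingDead r) {s : ℕ} {x : C.X s}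
    {i : P.U r s} {n : ℤ} (hn : wt s i = n) (hx : x ∈ C.Z r n s) (hi : IsLeading (b s) x i) :
    IsLeading (P.β r s) (C.cls r n s ⟨x, hx⟩) i := by
  by_cases h0 : C.cls r n s ⟨x, hx⟩ = 0
  · exfalso
    rw [cls_eq_zero_iff] at h0
    obtain ⟨y, hy, v, hv, he⟩ := Submodule.mem_sup.1 h0
    have he' : v = x + -y := by
      change y + v = x at he
      rw [← he]
      abel
    refine h2 s n v i hv ?_ hn i.2
    rw [he']
    exact hi.add_of_forall_eq_zero fun j hj =>
      hb.repr_eq_zero_of_mem_fil (neg_mem (mem_Z.1 hy).1) hn hj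
  obtain ⟨j, hj⟩ := exists_isLeading (P.β r s) h0
  obtain ⟨v, hv, hvl⟩ := h1.exists_isLeading_add hb hj
  have hwj := P.wt_eq_of_isLeading hj
  rcases lt_trichotomy j i with hji | rfl | hij
  · exfalso
    refine h2 s n v i hv ?_ hn i.2
    have he : v = -x + (x + v) := by abel
    rw [he]
    exact hi.neg.add_of_forall_eq_zero fun k hk => hvl.2 k (lt_of_lt_of_le hji hk)
  · exact hj
  · exfalso
    refine h2 s n v j hv ?_ hwj j.2
    have he : v = (x + v) + -x := by abel
    rw [he]
    exact hvl.add_of_forall_eq_zero fun k hk => hi.neg.2 k (lt_of_lt_of_le hij hk)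

/-- The boundary `d y` represents `d_r [y]`, so its leading term, if a label of `E_r`, is the head
of a tag there and does not pass to `E_{r+1}`. -/
theorem BoundaryLeadingDead.succ [∀ s, Finite (I s)] (hb : C.IsFilteredBasis b wt) {r : ℕ}
    (h1 : P.LeadingRepresentatives r) (h2 : P.BoundaryLeadingDead r) :
    P.BoundaryLeadingDead (r + 1) := by
  intro s n v i hv hi hn hU
  obtain ⟨hUr, hunt⟩ := (P.U_succ r s i).1 hU
  cases s with
  | zero =>
    have : v = 0 := by simpa [boundaries] using hv
    exact hi.ne_zero this
  | succ s =>
    obtain ⟨y, hy, rfl⟩ := hv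
    have e1 : ((r + 1 : ℕ) : ℤ) - 1 = r := by push_cast; ring
    have e2 : n + ((r + 1 : ℕ) : ℤ) - 1 = n + r := by push_cast; ring
    rw [e1, e2] at hy
    have e3 : n + (r : ℤ) - r = n := by ring
    have hmem : C.d s y ∈ C.Z r n (s + 1) := by
      refine mem_Z_of_cycle ?_ (C.d_d s y)
      have := (mem_Z.1 hy).2
      rwa [e3] at this
    have hl := isLeading_cls_aux hb h1 h2 (i := ⟨i, hUr⟩) hn hmem hi
    have hd : C.dPage r s (C.cls r (n + r) s ⟨y, hy⟩) = C.cls r n (s + 1) ⟨C.d s y, hmem⟩ := by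
      rw [dPage_cls]
      exact cls_congr_degree e3 _ _
    rw [← hd] at hl
    obtain ⟨c, hc⟩ := IsCurtisTable.exists_tag_of_isLeading_d (X := C.Page r) (P.isCurtisTable r) (fun _ => dPage_dPage) hl
    exact IsCurtisTable.not_untagged_head (X := C.Page r) (P.isCurtisTable r) hc hunt

theorem leadingRepresentatives [∀ s, Finite (I s)] (hb : C.IsFilteredBasis b wt) (r : ℕ) :
    P.LeadingRepresentatives r := by
  induction r with
  | zero =>
    intro s i
    obtain ⟨h, he⟩ := P.β_zero s i
    exact ⟨_, h, isLeading_self _ _, he⟩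
  | succ r ih => exact ih.succ hb

theorem boundaryLeadingDead [∀ s, Finite (I s)] (hb : C.IsFilteredBasis b wt) (r : ℕ) :
    P.BoundaryLeadingDead r := by
  induction r with
  | zero =>
    intro s n v i hv hi hn
    exfalso
    -- For `r = 0` the boundary comes from `G_{n-1}`, so its leading term cannot have weight `n`.
    have hfil : v ∈ C.fil (n - 1) s := by
      cases s with
      | zero =>
        have : v = 0 := by simpa [boundaries] using hv
        rw [this]
        exact zero_mem _
      | succ s =>
        obtain ⟨y, hy, rfl⟩ := hv
        refine C.d_mem _ _ _ (C.fil_mono _ _ ?_ _ (mem_Z.1 hy).1)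
        push_cast
        omega
    have := (hb.mem_fil_iff_of_isLeading hi).1 hfil
    omega
  | succ r ih => exact ih.succ hb (leadingRepresentatives hb r)

/-- An element of `Z_r` whose leading term is a label of the page `E_r` has the same leading term
on the page. -/
theorem isLeading_cls [∀ s, Finite (I s)] (hb : C.IsFilteredBasis b wt) {r s : ℕ} {x : C.X s}
    {i : P.U r s} {n : ℤ} (hn : wt s i = n) (hx : x ∈ C.Z r n s) (hi : IsLeading (b s) x i) :
    IsLeading (P.β r s) (C.cls r n s ⟨x, hx⟩) i :=
  isLeading_cls_aux hb (leadingRepresentatives hb r) (boundaryLeadingDead hb r) hn hx hi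

/-! ### The Curtis table assembled from the pages -/

theorem U_antitone (s : ℕ) : Antitone fun r => P.U r s :=
  antitone_nat_of_succ_le fun r i hi => ((P.U_succ r s i).1 hi).1

/-- A lift `y` need not be homogeneous, but its part of degree `wt c` keeps the leading term `c`,
and the higher parts vanish. The image of this part is nonzero, because the source `c` leads no
cycle, and is the top part of `d_r y`; so both have the leading term `a`. -/
theorem exists_homogeneous_lift (hb : C.IsFilteredBasis b wt) {r s : ℕ} {a : P.U r (s + 1)}
    {c : P.U r s} (h : Item.tag ⟨s + 1, a⟩ ⟨s, c⟩ ∈ P.T r) :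
    wt (s + 1) a = wt s c - r ∧ ∃ x : C.Z r (wt s c) s,
      IsLeading (P.β r s) (C.cls r (wt s c) s x) c ∧
      IsLeading (P.β r (s + 1)) (C.dPage r s (C.cls r (wt s c) s x)) a := by
  obtain ⟨y, hyc, hya⟩ := (P.isCurtisTable r).tag_lift s a c h
  have hmono : ∀ s (i j : P.U r s), i ≤ j → wt s i ≤ wt s j := fun s i j hij => hb.mono s hij
  obtain ⟨x, hx⟩ := exists_homogeneousPart_eq_cls y (wt s c)
  have hxc : IsLeading (P.β r s) (C.cls r (wt s c) s x) c := by
    rw [← hx]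
    refine ⟨?_, fun j hj => ?_⟩
    · rw [P.repr_homogeneousPart, if_pos rfl]
      exact hyc.1
    · rw [P.repr_homogeneousPart, hyc.2 j hj, ite_self]
  have hne : C.dPage r s (C.cls r (wt s c) s x) ≠ 0 := by
    intro h0
    obtain ⟨it, hit, he⟩ := ((P.isCurtisTable r).head_iff ⟨s, c⟩).2 ⟨_, h0, hxc⟩
    exact IsCurtisTable.head_ne_source (X := C.Page r) (P.isCurtisTable r) h hit he
  have hzero : ∀ n, wt s c < n → C.homogeneousPart r s n y = 0 := by
    intro n hn
    refine (P.β r s).ext_elem fun j => ?_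
    rw [P.repr_homogeneousPart, map_zero, Finsupp.zero_apply]
    split_ifs with hj
    · refine hyc.2 j ?_
      by_contra hjc
      have := hmono s j c (not_lt.1 hjc)
      omega
    · rfl
  have hrepr : ∀ j : P.U r (s + 1), wt (s + 1) j = wt s c - r →
      (P.β r (s + 1)).repr (C.dPage r s (C.cls r (wt s c) s x)) j =
        (P.β r (s + 1)).repr (C.dPage r s y) j := by
    intro j hj
    rw [← hx, dPage_homogeneousPart, P.repr_homogeneousPart, if_pos hj]
  have hrepr' : ∀ j : P.U r (s + 1), wt s c - r < wt (s + 1) j →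
      (P.β r (s + 1)).repr (C.dPage r s y) j = 0 := by
    intro j hj
    have h1 := P.repr_homogeneousPart r (s + 1) (wt (s + 1) j) (C.dPage r s y) j
    rw [if_pos rfl] at h1
    have h2 := dPage_homogeneousPart y (wt (s + 1) j + r)
    rw [hzero _ (by omega), map_zero, add_sub_cancel_right] at h2
    rw [← h1, ← h2, map_zero, Finsupp.zero_apply]
  obtain ⟨a', ha'⟩ := exists_isLeading (P.β r (s + 1)) hne
  have hwa' : wt (s + 1) a' = wt s c - r := by
    rw [dPage_cls] at ha'
    exact P.wt_eq_of_isLeading ha'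
  have haa' : IsLeading (P.β r (s + 1)) (C.dPage r s y) a' := by
    refine ⟨hrepr a' hwa' ▸ ha'.1, fun j hj => ?_⟩
    have hle := hmono _ _ _ hj.le
    rcases eq_or_ne (wt (s + 1) j) (wt s c - r) with hj' | hj'
    · rw [← hrepr j hj']
      exact ha'.2 j hj
    · exact hrepr' j (by omega)
  rw [IsLeading.unique (X := C.Page r (s + 1)) hya haa']
  exact ⟨hwa', x, hxc, ha'⟩

/-- Two corrections by boundaries are needed. The one for the source is a cycle and does not affect
`d x`. The one for the head is `d y'` with `y'` in lower filtration, so adding `y'` leaves the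
leading term `c` intact. -/
theorem exists_lift_of_tag [∀ s, Finite (I s)] (hb : C.IsFilteredBasis b wt) {r s : ℕ} {a : P.U r (s + 1)}
    {c : P.U r s} (h : Item.tag ⟨s + 1, a⟩ ⟨s, c⟩ ∈ P.T r) :
    ∃ y : C.X s, IsLeading (b s) y c ∧ IsLeading (b (s + 1)) (C.d s y) a := by
  obtain ⟨hwt, x, hxc, hxa⟩ := exists_homogeneous_lift hb h
  rw [dPage_cls] at hxa
  have hL := leadingRepresentatives (P := P) hb r
  obtain ⟨v, hv, hvl⟩ := hL.exists_isLeading_add hb hxc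
  obtain ⟨v', hv', hvl'⟩ := hL.exists_isLeading_add hb hxa
  obtain ⟨y', hy', rfl⟩ := hv'
  have hy'f : y' ∈ C.fil (wt s c - 1) s := by
    have := (mem_Z.1 hy').1
    rwa [sub_add_cancel] at this
  refine ⟨x + v + y', ?_, ?_⟩
  · exact hvl.add_of_forall_eq_zero fun j hj => hb.repr_eq_zero_of_mem_fil hy'f rfl hj
  · rw [map_add, map_add, d_eq_zero_of_mem_boundaries hv, add_zero]
    exact hvl'

variable (P) in
/-- The Curtis table assembled from the tags of all pages. -/
def totalTable : Set (Item (Σ s, I s)) :=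
  {it | (∃ x, it = .untagged x ∧ ∀ r, x.2 ∈ P.U r x.1) ∨ ∃ r, it ∈ P.tags r}

theorem exists_of_mem_tags {r : ℕ} {it : Item (Σ s, I s)} (h : it ∈ P.tags r) {x : Σ s, I s}
    (hx : it.Contains x) : ∃ (hU : x.2 ∈ P.U r x.1) (a c : Σ s, P.U r s),
      Item.tag a c ∈ P.T r ∧ it = .tag ⟨a.1, a.2.1⟩ ⟨c.1, c.2.1⟩ ∧
      (Item.tag a c).Contains ⟨x.1, x.2, hU⟩ := by
  obtain ⟨a, c, hac, rfl⟩ := h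
  rcases hx with rfl | rfl
  · exact ⟨a.2.2, a, c, hac, rfl, Or.inl rfl⟩
  · exact ⟨c.2.2, a, c, hac, rfl, Or.inr rfl⟩

theorem not_mem_U_succ_of_mem_tags {r : ℕ} {it : Item (Σ s, I s)} (h : it ∈ P.tags r)
    {x : Σ s, I s} (hx : it.Contains x) : x.2 ∉ P.U (r + 1) x.1 := by
  obtain ⟨hU, a, c, hac, -, hcont⟩ := exists_of_mem_tags h hx
  intro hU'
  obtain ⟨_, hunt⟩ := (P.U_succ r x.1 x.2).1 hU'
  have := IsCurtisTable.eq_of_contains (X := C.Page r) (P.isCurtisTable r) hac hcont hunt rfl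
  cases this

theorem exists_mem_tags {x : Σ s, I s} {r : ℕ} (h : x.2 ∉ P.U r x.1) :
    ∃ q < r, ∃ it ∈ P.tags q, it.Contains x := by
  induction r with
  | zero => exact absurd (by rw [P.U_zero]; trivial) h
  | succ r ih =>
    by_cases hU : x.2 ∈ P.U r x.1
    · have hunt : Item.untagged ⟨x.1, x.2, hU⟩ ∉ P.T r := fun hu =>
        h ((P.U_succ r x.1 x.2).2 ⟨hU, hu⟩)
      refine ⟨r, Nat.lt_succ_self r, ?_⟩
      rcases IsCurtisTable.cases_label (X := C.Page r) (P.isCurtisTable r) ⟨x.1, x.2, hU⟩ with h' | ⟨c, h'⟩ | ⟨a, h'⟩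
      · exact absurd h' hunt
      · exact ⟨_, ⟨_, _, h', rfl⟩, Or.inl rfl⟩
      · exact ⟨_, ⟨_, _, h', rfl⟩, Or.inr rfl⟩
    · obtain ⟨q, hq, h'⟩ := ih hU
      exact ⟨q, hq.trans (Nat.lt_succ_self r), h'⟩

/-- A label in a tag of `E_q` is absent from all later pages, so all tags that contain it belong to
one page. -/
theorem eq_of_mem_tags {q r : ℕ} {it it' : Item (Σ s, I s)} (h : it ∈ P.tags q)
    (h' : it' ∈ P.tags r) {x : Σ s, I s} (hx : it.Contains x) (hx' : it'.Contains x) :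
    q = r ∧ it = it' := by
  have key : ∀ {q r : ℕ} {it it' : Item (Σ s, I s)}, it ∈ P.tags q → it' ∈ P.tags r →
      it.Contains x → it'.Contains x → ¬ q < r := by
    intro q r it it' h h' hx hx' hlt
    obtain ⟨hU, -⟩ := exists_of_mem_tags h' hx'
    exact not_mem_U_succ_of_mem_tags h hx (U_antitone x.1 hlt hU)
  obtain rfl : q = r := le_antisymm (not_lt.1 (key h' h hx' hx)) (not_lt.1 (key h h' hx hx'))
  obtain ⟨hU, a, c, hac, rfl, hcont⟩ := exists_of_mem_tags h hx
  obtain ⟨hU', a', c', hac', rfl, hcont'⟩ := exists_of_mem_tags h' hx'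
  cases IsCurtisTable.eq_of_contains (X := C.Page q) (P.isCurtisTable q) hac hcont hac' hcont'
  exact ⟨rfl, rfl⟩

theorem degree_of_mem_tags {r : ℕ} {a c : Σ s, I s} (h : Item.tag a c ∈ P.tags r) :
    a.1 = c.1 + 1 := by
  obtain ⟨a', c', hac, he⟩ := h
  cases he
  exact (P.isCurtisTable r).degree _ _ hac

theorem exists_page_tag {r s : ℕ} {a : I (s + 1)} {c : I s}
    (h : Item.tag ⟨s + 1, a⟩ ⟨s, c⟩ ∈ P.tags r) :
    ∃ (ha : a ∈ P.U r (s + 1)) (hc : c ∈ P.U r s),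
      Item.tag ⟨s + 1, a, ha⟩ ⟨s, c, hc⟩ ∈ P.T r := by
  obtain ⟨⟨u, a'⟩, ⟨v, c'⟩, hac, he⟩ := h
  cases he
  exact ⟨a'.2, c'.2, hac⟩

theorem wt_of_mem_tags (hb : C.IsFilteredBasis b wt) {r : ℕ} {a c : Σ s, I s}
    (h : Item.tag a c ∈ P.tags r) : wt a.1 a.2 = wt c.1 c.2 - r := by
  obtain ⟨s, c⟩ := c
  obtain ⟨u, a⟩ := a
  obtain rfl : u = s + 1 := degree_of_mem_tags h
  obtain ⟨ha, hc, hT⟩ := exists_page_tag h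
  exact (exists_homogeneous_lift hb hT).1

theorem isCurtisTable_totalTable [∀ s, Finite (I s)] (hb : C.IsFilteredBasis b wt) :
    IsCurtisTable C.d b P.totalTable where
  degree a c h := by
    rcases h with ⟨x, he, -⟩ | ⟨r, h⟩
    · cases he
    · exact degree_of_mem_tags h
  once x := by
    by_cases hx : ∀ r, x.2 ∈ P.U r x.1
    · refine ⟨.untagged x, ⟨Or.inl ⟨x, rfl, hx⟩, rfl⟩, ?_⟩
      rintro it ⟨⟨y, rfl, -⟩ | ⟨r, h⟩, hcont⟩
      · obtain rfl : x = y := hcont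
        rfl
      · exact absurd (hx (r + 1)) (not_mem_U_succ_of_mem_tags h hcont)
    · push Not at hx
      obtain ⟨r, hr⟩ := hx
      obtain ⟨q, -, it, hit, hcont⟩ := exists_mem_tags hr
      refine ⟨it, ⟨Or.inr ⟨q, hit⟩, hcont⟩, ?_⟩
      rintro it' ⟨⟨y, rfl, hy⟩ | ⟨r, h⟩, hcont'⟩
      · obtain rfl : x = y := hcont'
        exact absurd (hy r) hr
      · exact (eq_of_mem_tags h hit hcont' hcont).2
  head_iff x := by
    constructor
    · rintro ⟨it, ⟨y, rfl, hy⟩ | ⟨r, h⟩, rfl⟩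
      · obtain ⟨s, i⟩ := y
        change ∀ r, i ∈ P.U r s at hy
        change ∃ z : C.X s, C.d s z = 0 ∧ IsLeading (b s) z i
        -- For `r` large, the representative in `Z_r` has its boundary in a zero stage of the
        -- filtration, so it is a cycle.
        obtain ⟨m, hm⟩ := hb.exists_lower_bound (s + 1)
        obtain ⟨r, hr⟩ : ∃ r : ℕ, wt s i - r ≤ m := ⟨(wt s i - m).toNat, by omega⟩
        obtain ⟨z, hz, hl, -⟩ := leadingRepresentatives (P := P) hb r s ⟨i, hy r⟩
        exact ⟨z, hm _ hr _ (mem_Z.1 hz).2, hl⟩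
      · obtain ⟨⟨u, a⟩, ⟨s, c⟩, hac, rfl⟩ := h
        obtain rfl : u = s + 1 := (P.isCurtisTable r).degree _ _ hac
        obtain ⟨y, -, hy⟩ := exists_lift_of_tag hb hac
        exact ⟨C.d s y, C.d_d s y, hy⟩
    · rintro ⟨z, hz, hl⟩
      by_cases hx : ∀ r, x.2 ∈ P.U r x.1
      · exact ⟨.untagged x, Or.inl ⟨x, rfl, hx⟩, rfl⟩
      push Not at hx
      obtain ⟨r, hr⟩ := hx
      obtain ⟨q, -, it, hit, hcont⟩ := exists_mem_tags hr
      refine ⟨it, Or.inr ⟨q, hit⟩, ?_⟩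
      obtain ⟨hU, a, c, hac, rfl, hcont'⟩ := exists_of_mem_tags hit hcont
      rcases hcont' with rfl | rfl
      · rfl
      exfalso
      -- If `x` were a source on `E_q`, the class of `z` would be a `d_q`-cycle led by a source.
      have hzZ : z ∈ C.Z q (wt x.1 x.2) x.1 :=
        mem_Z_of_cycle ((hb.mem_fil_iff_of_isLeading hl).2 le_rfl) hz
      have hlead := isLeading_cls (P := P) (i := ⟨x.2, hU⟩) hb rfl hzZ hl
      have h0 : C.dPage q x.1 (C.cls q (wt x.1 x.2) x.1 ⟨z, hzZ⟩) = 0 := by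
        rw [dPage_cls, cls_eq_zero_iff]
        change C.d x.1 z ∈ _
        rw [hz]
        exact zero_mem _
      obtain ⟨it, hit', he⟩ :=
        ((P.isCurtisTable q).head_iff ⟨x.1, x.2, hU⟩).2 ⟨_, h0, hlead⟩
      exact IsCurtisTable.head_ne_source (X := C.Page q) (P.isCurtisTable q) hac hit' he
  tag_lift s a c h := by
    rcases h with ⟨x, he, -⟩ | ⟨r, h⟩
    · cases he
    · obtain ⟨ha, hc, hT⟩ := exists_page_tag h
      exact exists_lift_of_tag hb hT

theorem eq_totalTable [∀ s, Finite (I s)] (hb : C.IsFilteredBasis b wt) {T : Set (Item (Σ s, I s))}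
    (hT : IsCurtisTable C.d b T) : T = P.totalTable :=
  hT.unique (isCurtisTable_totalTable hb) C.d_d

theorem untagged_mem_totalTable {x : Σ s, I s} :
    Item.untagged x ∈ P.totalTable ↔ ∀ r, x.2 ∈ P.U r x.1 := by
  constructor
  · rintro (⟨y, he, h⟩ | ⟨r, a, c, -, he⟩)
    · cases he
      exact h
    · cases he
  · exact fun h => Or.inl ⟨x, rfl, h⟩

theorem tag_mem_totalTable {a c : Σ s, I s} :
    Item.tag a c ∈ P.totalTable ↔ ∃ r, Item.tag a c ∈ P.tags r := by
  constructor
  · rintro (⟨y, he, h⟩ | h)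
    · cases he
    · exact h
  · exact fun h => Or.inr h

end LabelledPages

/-! ### The limit page -/

theorem not_untagged_of_mem_boundaries [∀ s, Finite (I s)] {T : Set (Item (Σ s, I s))}
    (hT : IsCurtisTable C.d b T) {s : ℕ} {W : ∀ s, Submodule (ZMod 2) (C.X s)} {v : C.X s}
    (hv : v ∈ C.boundaries W s) {i : I s} (hi : IsLeading (b s) v i) :
    Item.untagged ⟨s, i⟩ ∉ T := by
  cases s with
  | zero =>
    have : v = 0 := by simpa [boundaries] using hv
    exact absurd this hi.ne_zero
  | succ s =>
    obtain ⟨w, -, rfl⟩ := hv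
    obtain ⟨c, hc⟩ := hT.exists_tag_of_isLeading_d C.d_d hi
    exact hT.not_untagged_head hc

/-- Cycles with the untagged labels as leading terms form a basis of `E_∞`. -/
theorem exists_basis_Einf [∀ s, Finite (I s)] (hb : C.IsFilteredBasis b wt)
    {T : Set (Item (Σ s, I s))} (hT : IsCurtisTable C.d b T) (s : ℕ)
    (z : {x : I s // Item.untagged ⟨s, x⟩ ∈ T} → C.X s)
    (hz : ∀ x, C.d s (z x) = 0 ∧ IsLeading (b s) (z x) x.1) (n : ℤ) :
    ∃ B : Module.Basis {x : {x : I s // Item.untagged ⟨s, x⟩ ∈ T} // wt s x.1 = n} (ZMod 2)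
        (C.Einf n s),
      ∀ x, ∃ h : z x.1 ∈ C.Zinf n s, B x = Submodule.Quotient.mk ⟨z x.1, h⟩ := by
  set ι := {x : {x : I s // Item.untagged ⟨s, x⟩ ∈ T} // wt s x.1 = n}
  have := Fintype.ofFinite ι
  set N := C.Zinf (n - 1) s ⊔ C.fil n s ⊓ C.boundaries (fun _ => ⊤) s with hN
  have hmem : ∀ x : ι, z x.1 ∈ C.Zinf n s := fun x =>
    ⟨(hb.mem_fil_iff_of_isLeading (hz x.1).2).2 x.2.le, (hz x.1).1⟩
  set v : ι → C.Einf n s := fun x => Submodule.Quotient.mk ⟨z x.1, hmem x⟩ with hv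
  have hmk : ∀ {x : C.X s} (hx : x ∈ C.Zinf n s), x ∈ N →
      (Submodule.Quotient.mk ⟨x, hx⟩ : C.Einf n s) = 0 := fun hx hxN =>
    (Submodule.Quotient.mk_eq_zero _).2 hxN
  have hli : LinearIndependent (ZMod 2) v := by
    rw [Fintype.linearIndependent_iff]
    intro c hc
    by_contra! hne
    obtain ⟨i₀, hi₀⟩ := hne
    obtain ⟨i, hi, hmax⟩ := exists_last_ne_zero (c := c) (by rintro rfl; exact hi₀ rfl)
    have hlead : IsLeading (b s) (∑ j, c j • z j.1) i.1.1 :=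
      isLeading_sum (f := fun j : ι => j.1.1) (fun _ _ h => h) (fun j => (hz j.1).2) hi hmax
    have hsum : ∑ j, c j • z j.1 ∈ N := by
      have he : ∑ j, c j • v j =
          Submodule.mkQ (N.submoduleOf (C.Zinf n s)) (∑ j, c j • ⟨z j.1, hmem j⟩) := by
        rw [map_sum]
        rfl
      rw [he, Submodule.mkQ_apply, Submodule.Quotient.mk_eq_zero] at hc
      have hc' : ((∑ j, c j • (⟨z j.1, hmem j⟩ : C.Zinf n s) : C.Zinf n s) : C.X s) ∈ N := hc
      simpa using hc'
    -- Removing the part in `G_{n-1}` keeps the leading term, which has weight `n`. So an untagged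
    -- label would lead a boundary.
    obtain ⟨y, hy, d, hd, he⟩ := Submodule.mem_sup.1 hsum
    have hdl : IsLeading (b s) d i.1.1 := by
      have : d = ∑ j, c j • z j.1 + -y := by rw [← he]; abel
      rw [this]
      exact hlead.add_of_forall_eq_zero fun j hj =>
        hb.repr_eq_zero_of_mem_fil (neg_mem hy.1) i.2 hj
    exact not_untagged_of_mem_boundaries hT hd.2 hdl i.1.2
  have hspan : ⊤ ≤ Submodule.span (ZMod 2) (Set.range v) := by
    -- Induction on the leading term: a chosen cycle or a boundary with the same leading term is
    -- subtracted, according to whether the label is untagged or a head.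
    have key : ∀ i : I s, ∀ (x : C.X s) (hx : x ∈ C.Zinf n s), IsLeading (b s) x i →
        (Submodule.Quotient.mk ⟨x, hx⟩ : C.Einf n s) ∈ Submodule.span (ZMod 2) (Set.range v) := by
      intro i
      induction i using WellFoundedLT.induction with
      | ind i ih =>
        intro x hx hi
        have hwt := (hb.mem_fil_iff_of_isLeading hi).1 hx.1
        rcases hwt.lt_or_eq with hlt | heq
        · rw [hmk hx (Submodule.mem_sup_left
            ⟨(hb.mem_fil_iff_of_isLeading hi).2 (by omega), hx.2⟩)]
          exact zero_mem _
        obtain ⟨y, hyl, hy, hys⟩ : ∃ y, IsLeading (b s) y i ∧ ∃ hy : y ∈ C.Zinf n s,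
            (Submodule.Quotient.mk ⟨y, hy⟩ : C.Einf n s) ∈
              Submodule.span (ZMod 2) (Set.range v) := by
          obtain ⟨it, hit, he⟩ := (hT.head_iff ⟨s, i⟩).2 ⟨x, hx.2, hi⟩
          cases it with
          | untagged j =>
            obtain rfl : j = ⟨s, i⟩ := he
            exact ⟨z ⟨i, hit⟩, (hz _).2, hmem ⟨⟨i, hit⟩, heq⟩,
              Submodule.subset_span ⟨⟨⟨i, hit⟩, heq⟩, rfl⟩⟩
          | tag a c =>
            obtain rfl : a = ⟨s, i⟩ := he
            obtain ⟨u, c⟩ := c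
            obtain rfl : s = u + 1 := hT.degree _ _ hit
            obtain ⟨y, -, hy⟩ := hT.tag_lift u i c hit
            have hyf : C.d u y ∈ C.fil n (u + 1) := (hb.mem_fil_iff_of_isLeading hy).2 hwt
            have hyZ : C.d u y ∈ C.Zinf n (u + 1) := ⟨hyf, C.d_d u y⟩
            refine ⟨C.d u y, hy, hyZ, ?_⟩
            rw [hmk hyZ (Submodule.mem_sup_right ⟨hyf, y, trivial, rfl⟩)]
            exact zero_mem _
        have hsplit : (Submodule.Quotient.mk ⟨x, hx⟩ : C.Einf n s) =
            Submodule.Quotient.mk ⟨x + -y, add_mem hx (neg_mem hy)⟩ +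
              Submodule.Quotient.mk ⟨y, hy⟩ := by
          rw [← Submodule.Quotient.mk_add]
          congr 1
          exact Subtype.ext (by simp)
        rw [hsplit]
        refine add_mem ?_ hys
        by_cases h0 : x + -y = 0
        · rw [hmk _ (by rw [h0]; exact zero_mem _)]
          exact zero_mem _
        · obtain ⟨j, hj⟩ := exists_isLeading (b s) h0
          refine ih j ?_ _ _ hj
          by_contra hij
          exact hj.1 (hi.repr_add_eq_zero hyl.neg (not_lt.1 hij))
    rintro q -
    obtain ⟨⟨x, hx⟩, rfl⟩ := Submodule.Quotient.mk_surjective _ q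
    by_cases h0 : x = 0
    · rw [hmk _ (by rw [h0]; exact zero_mem _)]
      exact zero_mem _
    · obtain ⟨i, hi⟩ := exists_isLeading (b s) h0
      exact key i x hx hi
  exact ⟨Module.Basis.mk hli hspan, fun x => ⟨hmem x, Module.Basis.mk_apply hli hspan x⟩⟩

end FilteredComplex

end CurtisAHSS

/-! ### Construction of labels on the pages from an adapted basis -/

namespace CurtisAHSS

universe u w

namespace FilteredComplex

variable {C : FilteredComplex.{u}} {I : ℕ → Type w} [∀ s, LinearOrder (I s)]
  {b : ∀ s, Module.Basis (I s) (ZMod 2) (C.X s)} {wt : ∀ s, I s → ℤ}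
  {T : Set (Item (Σ s, I s))} {g : ∀ s, Module.Basis (I s) (ZMod 2) (C.X s)}

/-! ### Existence of labels on the pages -/

/-- The amount by which a tag lowers the filtration degree. -/
def drop (wt : ∀ s, I s → ℤ) (a c : Σ s, I s) : ℤ := wt c.1 c.2 - wt a.1 a.2

/-- The labels that are in no tag lowering the filtration degree by less than `r`. -/
def aliveLabels (T : Set (Item (Σ s, I s))) (wt : ∀ s, I s → ℤ) (r s : ℕ) : Set (I s) :=
  {i | ∀ a c, Item.tag a c ∈ T → (Item.tag a c).Contains ⟨s, i⟩ → (r : ℤ) ≤ drop wt a c}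

theorem IsFilteredBasis.of_isAdapted [∀ s, Finite (I s)] (hb : C.IsFilteredBasis b wt)
    (hg : IsAdapted C.d b T g) : C.IsFilteredBasis g wt where
  mono := hb.mono
  mem_fil_iff n s x := by
    by_cases hx : x = 0
    · subst hx
      simp
    obtain ⟨i, hi⟩ := exists_isLeading (b s) hx
    have hi' := hg.isLeading_iff.2 hi
    rw [hb.mem_fil_iff_of_isLeading hi]
    constructor
    · intro h1 j hj
      refine hi'.2 j ?_
      by_contra h2
      exact absurd (hb.mono s (not_lt.1 h2)) (not_le.2 (h1.trans_lt hj))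
    · intro h1
      by_contra h2
      exact hi'.1 (h1 i (not_le.1 h2))

theorem drop_nonneg (hb : C.IsFilteredBasis b wt) (hT : IsCurtisTable C.d b T) {a c : Σ s, I s}
    (h : Item.tag a c ∈ T) : 0 ≤ drop wt a c := by
  obtain ⟨s, c⟩ := c
  obtain ⟨a, rfl⟩ := hT.exists_head_eq h
  obtain ⟨y, hy, hya⟩ := hT.tag_lift s a c h
  have h1 := C.d_mem _ _ _ ((hb.mem_fil_iff_of_isLeading hy).2 le_rfl)
  have h2 := (hb.mem_fil_iff_of_isLeading hya).1 h1
  simpa [drop] using h2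

section Adapted

variable {r s : ℕ} {n : ℤ}

theorem adapted_mem_Z (hT : IsCurtisTable C.d b T) (hg : IsAdapted C.d b T g)
    (hgb : C.IsFilteredBasis g wt) {i : I s} (hi : i ∈ aliveLabels T wt r s) :
    g s i ∈ C.Z r (wt s i) s := by
  refine mem_Z.2 ⟨hgb.basis_mem_fil s i, ?_⟩
  rcases hT.cases_label ⟨s, i⟩ with h | ⟨c, h⟩ | ⟨a, h⟩
  · rw [hg.untagged s i h]
    exact zero_mem _
  · rw [hg.head s i c h]
    exact zero_mem _
  · obtain ⟨a, rfl⟩ := hT.exists_head_eq h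
    rw [hg.tag s a i h]
    refine C.fil_mono _ _ ?_ _ (hgb.basis_mem_fil _ a)
    have := hi _ _ h (Or.inr rfl)
    simp only [drop] at this
    omega

/-- At a head `i` of weight `n`, the coordinate of `d w` is that of `w` at the source, whose weight
is at least `n + r` as long as `i` is alive; but `w` has filtration `n + r - 1`. -/
theorem repr_eq_zero_of_mem_D (hT : IsCurtisTable C.d b T) (hg : IsAdapted C.d b T g)
    (hgb : C.IsFilteredBasis g wt) {x : C.X s} (hx : x ∈ C.D r n s) {i : I s}
    (hi : i ∈ aliveLabels T wt r s) (hn : wt s i = n) : (g s).repr x i = 0 := by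
  obtain ⟨y, hy, v, hv, rfl⟩ := Submodule.mem_sup.1 hx
  rw [map_add, Finsupp.add_apply, hgb.repr_eq_zero_of_mem_fil (mem_Z.1 hy).1 hn le_rfl, zero_add]
  cases s with
  | zero =>
    have : v = 0 := by simpa [boundaries] using hv
    simp [this]
  | succ s =>
    obtain ⟨w, hw, rfl⟩ := hv
    by_cases h : ∃ c : I s, Item.tag ⟨s + 1, i⟩ ⟨s, c⟩ ∈ T
    · obtain ⟨c, hc⟩ := h
      rw [hg.repr_d_of_tag hT hc]
      refine (hgb.mem_fil_iff _ _ _).1 (mem_Z.1 hw).1 c ?_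
      have := hi _ _ hc (Or.inl rfl)
      simp only [drop] at this
      omega
    · push Not at h
      exact hg.repr_d_of_not_head hT h w

/-- Each adapted basis element that occurs in `x` is treated separately. Those of weight below `n`
lie in `Z_{r-1}^{n-1}`. A dead one of weight `n` must be a head whose source drops by less than `r`,
hence a boundary in `D`; a dead source is excluded by `x ∈ Z_r`. -/
theorem mem_D_sup_span [∀ s, Finite (I s)] (hT : IsCurtisTable C.d b T)
    (hg : IsAdapted C.d b T g) (hgb : C.IsFilteredBasis g wt) {x : C.X s}
    (hx : x ∈ C.Z r n s) :
    x ∈ C.D r n s ⊔ Submodule.span (ZMod 2)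
      (Set.range fun i : {i : aliveLabels T wt r s // wt s i = n} => g s i.1) := by
  have := Fintype.ofFinite (I s)
  rw [← (g s).sum_repr x]
  refine Submodule.sum_mem _ fun i _ => ?_
  by_cases h0 : (g s).repr x i = 0
  · rw [h0, zero_smul]
    exact zero_mem _
  refine Submodule.smul_mem _ _ ?_
  have hwt : wt s i ≤ n := by
    by_contra h
    exact h0 ((hgb.mem_fil_iff _ _ _).1 (mem_Z.1 hx).1 i (not_le.1 h))
  have hsrc : ∀ a, Item.tag ⟨s + 1, a⟩ ⟨s, i⟩ ∈ T → wt (s + 1) a ≤ n - r := by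
    intro a ha
    by_contra h
    refine h0 ?_
    rw [← hg.repr_d_of_tag hT ha]
    exact (hgb.mem_fil_iff _ _ _).1 (mem_Z.1 hx).2 a (not_le.1 h)
  rcases hwt.lt_or_eq with hlt | heq
  · refine Submodule.mem_sup_left (Submodule.mem_sup_left (mem_Z.2 ⟨?_, ?_⟩))
    · exact C.fil_mono _ _ (by omega) _ (hgb.basis_mem_fil s i)
    · rcases hT.cases_label ⟨s, i⟩ with h | ⟨c, h⟩ | ⟨a, h⟩
      · rw [hg.untagged s i h]
        exact zero_mem _
      · rw [hg.head s i c h]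
        exact zero_mem _
      · obtain ⟨a, rfl⟩ := hT.exists_head_eq h
        rw [hg.tag s a i h]
        have := hsrc a h
        exact C.fil_mono _ _ (by omega) _ (hgb.basis_mem_fil _ a)
  · by_cases hU : i ∈ aliveLabels T wt r s
    · exact Submodule.mem_sup_right (Submodule.subset_span ⟨⟨⟨i, hU⟩, heq⟩, rfl⟩)
    · refine Submodule.mem_sup_left (Submodule.mem_sup_right ?_)
      simp only [aliveLabels, Set.mem_ofPred_eq, not_forall, not_le] at hU
      obtain ⟨a, c, h, hcont, hdrop⟩ := hU
      rcases hcont with rfl | rfl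
      · obtain ⟨u, c⟩ := c
        obtain rfl : s = u + 1 := hT.degree _ _ h
        simp only [drop] at hdrop
        refine ⟨g u c, mem_Z.2 ⟨?_, ?_⟩, hg.tag u i c h⟩
        · exact C.fil_mono _ _ (by omega) _ (hgb.basis_mem_fil u c)
        · rw [hg.tag u i c h]
          exact C.fil_mono _ _ (by omega) _ (hgb.basis_mem_fil _ i)
      · exfalso
        obtain ⟨a, rfl⟩ := hT.exists_head_eq h
        have := hsrc a h
        simp only [drop] at hdrop
        omega

theorem exists_page_basis [∀ s, Finite (I s)] (hT : IsCurtisTable C.d b T)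
    (hg : IsAdapted C.d b T g) (hgb : C.IsFilteredBasis g wt) (r s : ℕ) :
    ∃ β : Module.Basis (aliveLabels T wt r s) (ZMod 2) (C.Page r s),
      ∀ i, β i = C.cls r (wt s i) s ⟨g s i, adapted_mem_Z hT hg hgb i.2⟩ := by
  have := Fintype.ofFinite (aliveLabels T wt r s)
  set v : aliveLabels T wt r s → C.Page r s := fun i =>
    C.cls r (wt s i) s ⟨g s i, adapted_mem_Z hT hg hgb i.2⟩ with hv
  have hli : LinearIndependent (ZMod 2) v := by
    refine (Fintype.linearIndependent_iff (M := C.Page r s)).2 fun c hc i => ?_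
    set c' : aliveLabels T wt r s → ZMod 2 := fun j => if wt s j = wt s i then c j else 0 with hc'
    obtain ⟨hmem, he⟩ := exists_cls_sum (c := c') (n := wt s i)
      (fun j : aliveLabels T wt r s => adapted_mem_Z hT hg hgb j.2)
      (fun j hj => by by_contra h; exact hj (if_neg h))
    have h0 : ∑ j, c' j • v j = 0 := by
      have h1 := congrArg (C.homogeneousPart r s (wt s i)) hc
      rw [map_zero, map_sum] at h1
      rw [← h1]
      refine Finset.sum_congr rfl fun j _ => ?_
      rw [map_smul, hc']
      by_cases hj : wt s j = wt s i
      · simp only [hj, if_true, hv]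
        congr 1
        rw [← hj]
        exact (homogeneousPart_cls_self _).symm
      · simp only [hj, if_false, hv]
        rw [homogeneousPart_cls_of_ne hj, zero_smul, smul_zero]
    rw [h0, cls_eq_zero_iff] at he
    have h2 := repr_eq_zero_of_mem_D hT hg hgb he i.2 rfl
    rw [map_sum, Finsupp.finsetSum_apply, Finset.sum_eq_single i] at h2
    · simpa [hc'] using h2
    · intro j _ hj
      have : j.1 ≠ i.1 := fun h => hj (Subtype.ext h)
      simp [this]
    · simp
  have hcls : ∀ n (x : C.Z r n s), C.cls r n s x ∈ Submodule.span (ZMod 2) (Set.range v) := by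
    intro n x
    have := Fintype.ofFinite {i : aliveLabels T wt r s // wt s i = n}
    obtain ⟨y, hy, z, hz, he⟩ := Submodule.mem_sup.1 (mem_D_sup_span hT hg hgb x.2)
    obtain ⟨c, rfl⟩ := (Submodule.mem_span_range_iff_exists_fun _).1 hz
    obtain ⟨hmem, hs⟩ := exists_cls_sum (c := c) (n := n)
      (fun j : {i : aliveLabels T wt r s // wt s i = n} => adapted_mem_Z hT hg hgb j.1.2)
      (fun j _ => j.2)
    have hx : C.cls r n s x = C.cls r n s ⟨_, hmem⟩ := by
      rw [cls_eq_iff, ← he]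
      simpa using hy
    rw [hx, hs]
    exact Submodule.sum_mem _ fun j _ => Submodule.smul_mem _ _ (Submodule.subset_span ⟨j.1, rfl⟩)
  have hspan : ⊤ ≤ Submodule.span (ZMod 2) (Set.range v) := by
    rintro y -
    induction y using DirectSum.induction_on with
    | zero => exact zero_mem _
    | of n q =>
      obtain ⟨x, rfl⟩ := Submodule.mkQ_surjective _ q
      exact hcls n x
    | add x y hx hy => exact add_mem hx hy
  exact ⟨Module.Basis.mk hli hspan, fun i => Module.Basis.mk_apply hli hspan i⟩

theorem repr_cls_adapted [∀ s, Finite (I s)] (hT : IsCurtisTable C.d b T)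
    (hg : IsAdapted C.d b T g) (hgb : C.IsFilteredBasis g wt)
    {β : Module.Basis (aliveLabels T wt r s) (ZMod 2) (C.Page r s)}
    (hβ : ∀ i, β i = C.cls r (wt s i) s ⟨g s i, adapted_mem_Z hT hg hgb i.2⟩)
    (x : C.Z r n s) {i : aliveLabels T wt r s} (hi : wt s i = n) :
    β.repr (C.cls r n s x) i = (g s).repr x.1 i := by
  have := Fintype.ofFinite {i : aliveLabels T wt r s // wt s i = n}
  obtain ⟨y, hy, z, hz, he⟩ := Submodule.mem_sup.1 (mem_D_sup_span hT hg hgb x.2)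
  obtain ⟨c, rfl⟩ := (Submodule.mem_span_range_iff_exists_fun _).1 hz
  obtain ⟨hmem, hs⟩ := exists_cls_sum (c := c) (n := n)
    (fun j : {i : aliveLabels T wt r s // wt s i = n} => adapted_mem_Z hT hg hgb j.1.2)
    (fun j _ => j.2)
  have hx : C.cls r n s x = ∑ j, c j • β j.1 := by
    have h1 : C.cls r n s x = C.cls r n s ⟨_, hmem⟩ := by
      rw [cls_eq_iff, ← he]
      simpa using hy
    rw [h1, hs]
    exact Finset.sum_congr rfl fun j _ => by rw [hβ]
  have h2 : β.repr (C.cls r n s x) i = c ⟨i, hi⟩ := by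
    rw [hx, map_sum, Finsupp.finsetSum_apply, Finset.sum_eq_single ⟨i, hi⟩]
    · simp
    · intro j _ hj
      have : j.1 ≠ i := fun h => hj (Subtype.ext h)
      simp [this]
    · simp
  have h3 : (g s).repr x.1 i = c ⟨i, hi⟩ := by
    rw [← he, map_add, Finsupp.add_apply, repr_eq_zero_of_mem_D hT hg hgb hy i.2 hi, zero_add,
      map_sum, Finsupp.finsetSum_apply, Finset.sum_eq_single ⟨i, hi⟩]
    · simp
    · intro j _ hj
      have : j.1.1 ≠ i.1 := fun h => hj (Subtype.ext (Subtype.ext h))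
      simp [this]
    · simp
  rw [h2, h3]

/-- The tags in the table of the page `E_r`: those which lower the filtration degree by `r`. -/
def pageTag (T : Set (Item (Σ s, I s))) (wt : ∀ s, I s → ℤ) (r : ℕ)
    (a c : Σ s, aliveLabels T wt r s) : Prop :=
  Item.tag (⟨a.1, a.2.1⟩ : Σ s, I s) ⟨c.1, c.2.1⟩ ∈ T ∧
    drop wt (⟨a.1, a.2.1⟩ : Σ s, I s) ⟨c.1, c.2.1⟩ = r

theorem sigma_subtype_ext {L : ℕ → Type*} {U : ∀ s, Set (L s)} {a c : Σ s, U s}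
    (h : (⟨a.1, a.2.1⟩ : Σ s, L s) = ⟨c.1, c.2.1⟩) : a = c := by
  obtain ⟨s, a, ha⟩ := a
  obtain ⟨u, c, hc⟩ := c
  cases h
  rfl

/-- On `E_r` the class at a source goes to the class at its head if the drop is exactly `r`. If the
drop is larger, the head has filtration below the target degree and its class vanishes. -/
theorem isCurtisTable_pageTag [∀ s, Finite (I s)] (hT : IsCurtisTable C.d b T)
    (hg : IsAdapted C.d b T g) (hgb : C.IsFilteredBasis g wt)
    {β : ∀ s, Module.Basis (aliveLabels T wt r s) (ZMod 2) (C.Page r s)}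
    (hβ : ∀ s i, β s i = C.cls r (wt s i) s ⟨g s i, adapted_mem_Z hT hg hgb i.2⟩) :
    IsCurtisTable (C.dPage r) β (matchingTable (pageTag T wt r)) := by
  refine isCurtisTable_matchingTable (X := C.Page r) (fun a c h => hT.degree _ _ h.1)
    (fun a a' c h h' => sigma_subtype_ext (hT.head_unique h.1 h'.1))
    (fun a c c' h h' => sigma_subtype_ext (hT.source_unique h.1 h'.1))
    (fun a c c' h h' => hT.head_ne_source h.1 h'.1 rfl) (fun s a c h => ?_) (fun s c h => ?_)
  · rw [hβ, hβ, dPage_cls]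
    have hd : C.d s (g s c) = g (s + 1) a := hg.tag s a c h.1
    have hw : wt s c - r = wt (s + 1) a := by
      have := h.2
      simp only [drop] at this
      omega
    have hm := adapted_mem_Z hT hg hgb a.2
    have hm' : g (s + 1) a ∈ C.Z r (wt s c - r) (s + 1) := by rwa [hw]
    rw [← cls_congr_degree hw hm' hm]
    exact congrArg (C.cls r (wt s c - r) (s + 1)) (Subtype.ext hd)
  · rw [hβ, dPage_cls, cls_eq_zero_iff]
    change C.d s (g s c) ∈ _
    rcases hT.cases_label ⟨s, c⟩ with h' | ⟨c', h'⟩ | ⟨a, h'⟩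
    · rw [hg.untagged s c h']
      exact zero_mem _
    · rw [hg.head s c c' h']
      exact zero_mem _
    · obtain ⟨a, rfl⟩ := hT.exists_head_eq h'
      have hle := c.2 _ _ h' (Or.inr rfl)
      have ha : a ∈ aliveLabels T wt r (s + 1) := by
        intro x y hxy hcont
        cases hT.eq_of_contains h' (Or.inl rfl) hxy hcont
        exact hle
      have hne : drop wt (⟨s + 1, a⟩ : Σ s, I s) ⟨s, c⟩ ≠ r := fun he =>
        h ⟨s + 1, a, ha⟩ ⟨h', he⟩
      rw [hg.tag s a c h']
      refine Submodule.mem_sup_left (mem_Z_of_cycle ?_ (hg.head _ _ _ h'))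
      refine C.fil_mono _ _ ?_ _ (hgb.basis_mem_fil _ a)
      simp only [drop] at hle hne
      omega

theorem aliveLabels_zero (hb : C.IsFilteredBasis b wt) (hT : IsCurtisTable C.d b T) (s : ℕ) :
    aliveLabels T wt 0 s = Set.univ := by
  refine Set.eq_univ_of_forall fun i a c h _ => ?_
  simpa using drop_nonneg hb hT h

theorem mem_aliveLabels_succ (hT : IsCurtisTable C.d b T) (i : I s) :
    i ∈ aliveLabels T wt (r + 1) s ↔ ∃ h : i ∈ aliveLabels T wt r s,
      Item.untagged ⟨s, i, h⟩ ∈ matchingTable (pageTag T wt r) := by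
  constructor
  · intro hi
    have h : i ∈ aliveLabels T wt r s := fun a c h hc => by
      have := hi a c h hc
      push_cast at this
      omega
    refine ⟨h, untagged_mem_matchingTable.2 fun y => ⟨fun hy => ?_, fun hy => ?_⟩⟩
    · have h1 := hi _ _ hy.1 (Or.inl rfl)
      have h2 : drop wt (⟨s, i⟩ : Σ s, I s) ⟨y.1, y.2.1⟩ = r := hy.2
      push_cast at h1
      omega
    · have h1 := hi _ _ hy.1 (Or.inr rfl)
      have h2 : drop wt ⟨y.1, y.2.1⟩ (⟨s, i⟩ : Σ s, I s) = r := hy.2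
      push_cast at h1
      omega
  · rintro ⟨h, hunt⟩ a c hac hcont
    rw [untagged_mem_matchingTable] at hunt
    have hle := h a c hac hcont
    have hmem : ∀ x : Σ s, I s, (Item.tag a c).Contains x → x.2 ∈ aliveLabels T wt r x.1 := by
      intro x hx a' c' hac' hcont'
      cases hT.eq_of_contains hac hx hac' hcont'
      exact hle
    have hne : drop wt a c ≠ r := by
      intro he
      rcases hcont with rfl | rfl
      · exact (hunt ⟨c.1, c.2, hmem c (Or.inr rfl)⟩).1 ⟨hac, he⟩
      · exact (hunt ⟨a.1, a.2, hmem a (Or.inl rfl)⟩).2 ⟨hac, he⟩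
    push_cast
    omega

end Adapted

/-- Labels on the pages exist. -/
theorem nonempty_labelledPages [∀ s, Finite (I s)] (hb : C.IsFilteredBasis b wt) :
    Nonempty (C.LabelledPages b wt) := by
  obtain ⟨T, hT⟩ := exists_isCurtisTable b C.d_d
  obtain ⟨g, hg⟩ := hT.exists_isAdapted C.d_d
  have hgb := hb.of_isAdapted hg
  choose γ hγ using exists_page_basis hT hg hgb
  have hbZ : ∀ s i, b s i ∈ C.Z (0 : ℕ) (wt s i) s := fun s i =>
    mem_Z.2 ⟨hb.basis_mem_fil s i, C.d_mem _ _ _ (by simpa using hb.basis_mem_fil s i)⟩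
  have h0 : ∀ s (i : aliveLabels T wt 0 s),
      IsLeading (γ 0 s) (C.cls (0 : ℕ) (wt s i) s ⟨b s i, hbZ s i⟩) i := by
    intro s i
    have hi := hg.isLeading_iff.2 (isLeading_self (b s) i.1)
    refine ⟨?_, fun j hj => ?_⟩
    · rw [repr_cls_adapted hT hg hgb (hγ 0 s) _ rfl]
      exact hi.1
    · by_cases hij : wt s j = wt s i
      · rw [repr_cls_adapted hT hg hgb (hγ 0 s) _ hij]
        exact hi.2 j hj
      · exact repr_cls_eq_zero_of_basis (m := fun i : aliveLabels T wt 0 s => wt s i)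
          (fun i => ⟨_, hγ 0 s i⟩) _ hij
  -- On `E₀` the labels must denote the given basis elements and not the adapted ones. The two bases
  -- of `E₀` differ by a triangular change, so the table serves both; on later pages the adapted
  -- classes are used.
  have hβ : ∀ r s, ∃ β : Module.Basis (aliveLabels T wt r s) (ZMod 2) (C.Page r s),
      (∀ x i, IsLeading β x i ↔ IsLeading (γ r s) x i) ∧ (r ≠ 0 → β = γ r s) ∧
      (r = 0 → ∀ i : aliveLabels T wt r s, ∃ h : b s i ∈ C.Z r (wt s i) s, β i = C.cls r (wt s i) s ⟨b s i, h⟩) := by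
    intro r s
    rcases Nat.eq_zero_or_pos r with rfl | hr
    · obtain ⟨β, hβ⟩ := exists_basis_of_isLeading (X := C.Page (0 : ℕ) s) (h0 s)
      refine ⟨β, fun x i => ?_, fun h => absurd rfl h, fun _ i => ⟨hbZ s i, hβ i⟩⟩
      exact isLeading_iff_of_triangular (X := C.Page (0 : ℕ) s) fun i => by rw [hβ]; exact h0 s i
    · exact ⟨γ r s, fun _ _ => Iff.rfl, fun _ => rfl, fun h => absurd h hr.ne'⟩
  choose β hlead hne hzero using hβ
  refine ⟨⟨aliveLabels T wt, β, fun r => matchingTable (pageTag T wt r),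
    aliveLabels_zero hb hT, fun s i => hzero 0 s rfl i, fun r => ?_,
    fun r s i => mem_aliveLabels_succ hT i, fun r s i => ?_⟩⟩
  · exact IsCurtisTable.congr (X := C.Page r) (fun s x i => (hlead r s x i).symm)
      (isCurtisTable_pageTag hT hg hgb (hγ r))
  · obtain ⟨h, -⟩ := (mem_aliveLabels_succ hT i.1).1 i.2
    refine ⟨h, g s i, adapted_mem_Z hT hg hgb h, adapted_mem_Z hT hg hgb i.2, ?_, ?_⟩
    · rw [hlead, ← hγ r s ⟨i.1, h⟩]
      exact isLeading_self (X := C.Page r s) _ _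
    · rw [hne _ _ (Nat.succ_ne_zero r), hγ]

end FilteredComplex

end CurtisAHSS

/-! ### The page `E₀` as copies of the complex of the resolution -/

namespace CurtisAHSS

universe u w

/-! ### Curtis tables of direct sums -/

/-- The action of a map of labels on items. -/
def Item.map {P Q : Type*} (f : P → Q) : Item P → Item Q
  | .untagged x => .untagged (f x)
  | .tag a c => .tag (f a) (f c)

theorem Item.head_map {P Q : Type*} (f : P → Q) (it : Item P) :
    (it.map f).head = f it.head := by
  cases it <;> rfl

theorem Item.contains_map {P Q : Type*} {f : P → Q} {it : Item P} {y : Q} :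
    (it.map f).Contains y ↔ ∃ x, it.Contains x ∧ f x = y := by
  cases it with
  | untagged x => exact ⟨fun h => ⟨x, rfl, h.symm⟩, by rintro ⟨x, rfl, rfl⟩; rfl⟩
  | tag a c =>
    constructor
    · rintro (rfl | rfl)
      · exact ⟨a, Or.inl rfl, rfl⟩
      · exact ⟨c, Or.inr rfl, rfl⟩
    · rintro ⟨x, rfl | rfl, rfl⟩
      · exact Or.inl rfl
      · exact Or.inr rfl

section Blocks

variable {X : ℕ → Type*} [∀ s, AddCommGroup (X s)] [∀ s, Module (ZMod 2) (X s)]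
  {d : ∀ s, X s →ₗ[ZMod 2] X (s + 1)} {I : ℕ → Type*} [∀ s, LinearOrder (I s)]
  [∀ s, Finite (I s)] {b : ∀ s, Module.Basis (I s) (ZMod 2) (X s)}
  {K : Type*} {Y : K → ℕ → Type*} [∀ k s, AddCommGroup (Y k s)]
  [∀ k s, Module (ZMod 2) (Y k s)] {δ : ∀ k s, Y k s →ₗ[ZMod 2] Y k (s + 1)}
  {L : K → ℕ → Type*} [∀ k s, LinearOrder (L k s)] [∀ k s, Finite (L k s)]
  {β : ∀ k s, Module.Basis (L k s) (ZMod 2) (Y k s)}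

/-- The table of a direct sum of complexes. -/
def blockTable (ι : ∀ k s, L k s → I s) (T : ∀ k, Set (Item (Σ s, L k s))) :
    Set (Item (Σ s, I s)) :=
  {it | ∃ k, ∃ it' ∈ T k, it = it'.map fun x => ⟨x.1, ι k x.1 x.2⟩}

/-- If the matrix of the differential is block diagonal, then the Curtis tables of the blocks
form a Curtis table. -/
theorem isCurtisTable_blockTable {ι : ∀ k s, L k s → I s} (hmono : ∀ k s, StrictMono (ι k s))
    (hsurj : ∀ s i, ∃ k j, ι k s j = i)
    (hinj : ∀ k k' s (j : L k s) (j' : L k' s), ι k s j = ι k' s j' → k = k')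
    (hdiag : ∀ k s a c, (b (s + 1)).repr (d s (b s (ι k s c))) (ι k (s + 1) a) =
      (β k (s + 1)).repr (δ k s (β k s c)) a)
    (hoff : ∀ k k' s a c, k ≠ k' → (b (s + 1)).repr (d s (b s (ι k s c))) (ι k' (s + 1) a) = 0)
    {T : ∀ k, Set (Item (Σ s, L k s))} (hT : ∀ k, IsCurtisTable (δ k) (β k) (T k)) :
    IsCurtisTable d b (blockTable ι T) := by
  have hrepr_ne : ∀ {k k' : K} {s : ℕ} (j : L k s) (j' : L k' s), k ≠ k' →
      (b s).repr (b s (ι k s j)) (ι k' s j') = 0 := by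
    intro k k' s j j' hk
    have : ι k s j ≠ ι k' s j' := fun h => hk (hinj _ _ _ _ _ h)
    simp [this]
  have hrepr_eq : ∀ {k : K} {s : ℕ} (j j' : L k s),
      (b s).repr (b s (ι k s j)) (ι k s j') = (β k s).repr (β k s j) j' := by
    intro k s j j'
    simp only [Module.Basis.repr_self]
    by_cases h : j = j'
    · subst h
      simp
    · have : ι k s j ≠ ι k s j' := fun h' => h ((hmono k s).injective h')
      simp [h, this]
  -- the inclusions of the blocks and the projections to the blocks
  set E : ∀ k s, Y k s →ₗ[ZMod 2] X s := fun k s =>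
    (β k s).constr (ZMod 2) fun j => b s (ι k s j) with hE
  have hEβ : ∀ k s j, E k s (β k s j) = b s (ι k s j) := fun k s j => by
    simp only [hE, Module.Basis.constr_basis]
  have hErepr : ∀ k s y j, (b s).repr (E k s y) (ι k s j) = (β k s).repr y j := by
    intro k s y j
    have : (b s).coord (ι k s j) ∘ₗ E k s = (β k s).coord j := by
      refine (β k s).ext fun i => ?_
      rw [LinearMap.comp_apply, hEβ]
      exact hrepr_eq i j
    exact LinearMap.congr_fun this y
  have hErepr_ne : ∀ k k' s y j, k ≠ k' → (b s).repr (E k s y) (ι k' s j) = 0 := by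
    intro k k' s y j hk
    have : (b s).coord (ι k' s j) ∘ₗ E k s = 0 := by
      refine (β k s).ext fun i => ?_
      rw [LinearMap.comp_apply, hEβ]
      exact hrepr_ne i j hk
    exact LinearMap.congr_fun this y
  set Q : ∀ k s, X s →ₗ[ZMod 2] Y k s := fun k s =>
    (β k s).equivFun.symm.toLinearMap ∘ₗ LinearMap.funLeft (ZMod 2) (ZMod 2) (ι k s) ∘ₗ
      (b s).equivFun.toLinearMap with hQ
  have hQrepr : ∀ k s x j, (β k s).repr (Q k s x) j = (b s).repr x (ι k s j) := by
    intro k s x j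
    rw [← Module.Basis.equivFun_apply]
    simp [hQ, LinearMap.funLeft]
  have hdE : ∀ k s y, d s (E k s y) = E k (s + 1) (δ k s y) := by
    intro k s y
    have : d s ∘ₗ E k s = E k (s + 1) ∘ₗ δ k s := by
      refine (β k s).ext fun c => (b (s + 1)).ext_elem fun i => ?_
      rw [LinearMap.comp_apply, LinearMap.comp_apply, hEβ]
      obtain ⟨k', a, rfl⟩ := hsurj _ i
      by_cases hk : k = k'
      · subst hk
        rw [hdiag, hErepr]
      · rw [hoff _ _ _ _ _ hk, hErepr_ne _ _ _ _ _ hk]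
    exact LinearMap.congr_fun this y
  have hdQ : ∀ k s x, δ k s (Q k s x) = Q k (s + 1) (d s x) := by
    intro k s x
    have : δ k s ∘ₗ Q k s = Q k (s + 1) ∘ₗ d s := by
      refine (b s).ext fun i => (β k (s + 1)).ext_elem fun a => ?_
      change (β k (s + 1)).repr (δ k s (Q k s (b s i))) a =
        (β k (s + 1)).repr (Q k (s + 1) (d s (b s i))) a
      rw [hQrepr]
      obtain ⟨k', c, rfl⟩ := hsurj _ i
      by_cases hk : k' = k
      · subst hk
        have : Q k' s (b s (ι k' s c)) = β k' s c :=
          (β k' s).ext_elem fun j => by rw [hQrepr, hrepr_eq]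
        rw [this, hdiag]
      · have : Q k s (b s (ι k' s c)) = 0 :=
          (β k s).ext_elem fun j => by rw [hQrepr, hrepr_ne _ _ hk, map_zero, Finsupp.zero_apply]
        rw [this, hoff _ _ _ _ _ hk, map_zero, map_zero, Finsupp.zero_apply]
    exact LinearMap.congr_fun this x
  have hElead : ∀ k s y j, IsLeading (β k s) y j → IsLeading (b s) (E k s y) (ι k s j) := by
    intro k s y j h
    refine ⟨by rw [hErepr]; exact h.1, fun i hi => ?_⟩
    obtain ⟨k', j', rfl⟩ := hsurj _ i
    by_cases hk : k = k'
    · subst hk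
      rw [hErepr]
      exact h.2 _ ((hmono k s).lt_iff_lt.1 hi)
    · exact hErepr_ne _ _ _ _ _ hk
  have hQlead : ∀ k s x j, IsLeading (b s) x (ι k s j) → IsLeading (β k s) (Q k s x) j :=
    fun k s x j h => ⟨by rw [hQrepr]; exact h.1, fun i hi => by
      rw [hQrepr]; exact h.2 _ (hmono k s hi)⟩
  have hlift : ∀ x : Σ s, I s, ∃ k, ∃ y : Σ s, L k s,
      (⟨y.1, ι k y.1 y.2⟩ : Σ s, I s) = x := by
    rintro ⟨s, i⟩
    obtain ⟨k, j, rfl⟩ := hsurj s i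
    exact ⟨k, ⟨s, j⟩, rfl⟩
  have hliftinj : ∀ k k' (y : Σ s, L k s) (y' : Σ s, L k' s),
      (⟨y.1, ι k y.1 y.2⟩ : Σ s, I s) = ⟨y'.1, ι k' y'.1 y'.2⟩ →
      (⟨k, y⟩ : Σ k, Σ s, L k s) = ⟨k', y'⟩ := by
    rintro k k' ⟨s, j⟩ ⟨s', j'⟩ h
    obtain rfl : s = s' := congrArg Sigma.fst h
    have h1 : ι k s j = ι k' s j' := eq_of_heq (Sigma.mk.inj h).2
    obtain rfl := hinj _ _ _ _ _ h1
    rw [(hmono k s).injective h1]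
  refine ⟨?_, ?_, ?_, ?_⟩
  · rintro a c ⟨k, it, hit, he⟩
    cases it with
    | untagged x => cases he
    | tag a' c' =>
      cases he
      exact (hT k).degree _ _ hit
  · intro x
    obtain ⟨k, y, rfl⟩ := hlift x
    obtain ⟨it, ⟨hit, hcont⟩, huniq⟩ := (hT k).once y
    refine ⟨_, ⟨⟨k, it, hit, rfl⟩, Item.contains_map.2 ⟨y, hcont, rfl⟩⟩, ?_⟩
    rintro _ ⟨⟨k', it', hit', rfl⟩, hcont'⟩
    obtain ⟨y', hy', he⟩ := Item.contains_map.1 hcont'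
    cases hliftinj _ _ _ _ he
    rw [huniq it' ⟨hit', hy'⟩]
  · intro x
    obtain ⟨k, ⟨s, j⟩, rfl⟩ := hlift x
    constructor
    · rintro ⟨_, ⟨k', it, hit, rfl⟩, he⟩
      rw [Item.head_map] at he
      have he' := hliftinj _ _ _ _ he
      obtain rfl : k' = k := congrArg Sigma.fst he'
      have he'' : it.head = ⟨s, j⟩ := eq_of_heq (Sigma.mk.inj he').2
      obtain ⟨z, hz, hl⟩ := ((hT k').head_iff ⟨s, j⟩).1 ⟨it, hit, he''⟩
      refine ⟨E k' s z, ?_, hElead _ _ _ _ hl⟩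
      change d s (E k' s z) = 0
      rw [hdE, show δ k' s z = 0 from hz, map_zero]
    · rintro ⟨z, hz, hl⟩
      have h0 : δ k s (Q k s z) = 0 := by
        rw [hdQ, show d s z = 0 from hz, map_zero]
      obtain ⟨it, hit, he⟩ := ((hT k).head_iff ⟨s, j⟩).2 ⟨Q k s z, h0, hQlead _ _ _ _ hl⟩
      refine ⟨_, ⟨k, it, hit, rfl⟩, ?_⟩
      rw [Item.head_map, he]
  · rintro s a c ⟨k, it, hit, he⟩
    cases it with
    | untagged x => cases he
    | tag a' c' =>
      obtain ⟨u, c'⟩ := c'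
      obtain ⟨a', rfl⟩ := (hT k).exists_head_eq hit
      cases he
      obtain ⟨y, hy, hya⟩ := (hT k).tag_lift _ _ _ hit
      refine ⟨E k s y, hElead _ _ _ _ hy, ?_⟩
      rw [hdE]
      exact hElead _ _ _ _ hya

end Blocks

/-! ### The page `E₀` -/

namespace FilteredComplex.LabelledPages

variable {C : FilteredComplex.{u}} {I : ℕ → Type w} [∀ s, LinearOrder (I s)]
  {b : ∀ s, Module.Basis (I s) (ZMod 2) (C.X s)} {wt : ∀ s, I s → ℤ}
  (P : C.LabelledPages b wt)

theorem mem_U_zero {s : ℕ} (i : I s) : i ∈ P.U 0 s := by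
  rw [P.U_zero]
  exact Set.mem_univ i

/-- The coordinates of a class on the page `E₀` are those of a representative. -/
theorem repr_cls_zero [∀ s, Finite (I s)] (hb : C.IsFilteredBasis b wt) {s : ℕ} {n : ℤ}
    (x : C.Z (0 : ℕ) n s) {i : P.U 0 s} (hi : wt s i = n) :
    (P.β 0 s).repr (C.cls (0 : ℕ) n s x) i = (b s).repr x.1 i := by
  classical
  have := Fintype.ofFinite (P.U 0 s)
  have hZ : ∀ i : P.U 0 s, b s i ∈ C.Z (0 : ℕ) (wt s i) s := fun i => (P.β_zero s i).1
  -- Discarding the terms of weight other than `n` changes `x` by an element of `G_{n-1}`, which is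
  -- zero in `E₀^n`.
  set c : P.U 0 s → ZMod 2 := fun j => if wt s j = n then (b s).repr x.1 j else 0 with hc
  have hcoef : ∀ j : P.U 0 s, (b s).repr (∑ l, c l • b s l) j = c j := by
    intro j
    rw [map_sum, Finsupp.finsetSum_apply, Finset.sum_eq_single j]
    · simp
    · intro l _ hl
      have : l.1 ≠ j.1 := fun h => hl (Subtype.ext h)
      simp [this]
    · simp
  obtain ⟨hmem, hs⟩ := exists_cls_sum (c := c) (n := n) hZ
    (fun j hj => by by_contra h; exact hj (if_neg h))
  have hx : C.cls (0 : ℕ) n s x = ∑ j, c j • P.β 0 s j := by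
    have h1 : C.cls (0 : ℕ) n s x = C.cls (0 : ℕ) n s ⟨_, hmem⟩ := by
      rw [cls_eq_iff]
      have hfil : x.1 - ∑ j, c j • b s j ∈ C.fil (n - 1) s := by
        rw [hb.mem_fil_iff]
        intro j hj
        have hjU : j ∈ P.U 0 s := P.mem_U_zero _
        rw [map_sub, Finsupp.sub_apply, hcoef ⟨j, hjU⟩, hc]
        by_cases hjn : wt s j = n
        · simp only [hjn, if_true, sub_self]
        · simp only [hjn, if_false, sub_zero]
          exact (hb.mem_fil_iff _ _ _).1 (mem_Z.1 x.2).1 j (by omega)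
      refine Submodule.mem_sup_left (mem_Z.2 ⟨hfil, ?_⟩)
      exact C.fil_mono _ _ (by push_cast; omega) _ (C.d_mem _ _ _ hfil)
    rw [h1, hs]
    refine Finset.sum_congr rfl fun j _ => ?_
    obtain ⟨h, he⟩ := P.β_zero s j
    rw [he]
  rw [hx, map_sum, Finsupp.finsetSum_apply, Finset.sum_eq_single i]
  · simp [hc, hi]
  · intro j _ hj
    simp [hj]
  · simp

theorem repr_dPage_zero [∀ s, Finite (I s)] (hb : C.IsFilteredBasis b wt) {s : ℕ}
    (c : P.U 0 s) (a : P.U 0 (s + 1)) :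
    (P.β 0 (s + 1)).repr (C.dPage (0 : ℕ) s (P.β 0 s c)) a =
      if wt (s + 1) a = wt s c then (b (s + 1)).repr (C.d s (b s c)) a else 0 := by
  obtain ⟨h, he⟩ := P.β_zero s c
  rw [he, dPage_cls]
  split_ifs with hw
  · rw [P.repr_cls_zero hb _ (by rw [hw]; simp)]
    rfl
  · exact P.repr_cls_eq_zero _ (by simpa using hw)

end FilteredComplex.LabelledPages

namespace FreeResolution

variable (R : FreeResolution) {M : Type*} [AddCommGroup M] [Module (ZMod 2) M]
  [Module SteenrodAlgebra M] [IsScalarTower (ZMod 2) SteenrodAlgebra M]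
  {𝓜 : ℤ → Submodule (ZMod 2) M} (h𝓜 : IsGradedModule 𝓜)
  {K : Type*} [Finite K] [LinearOrder K] (e : Module.Basis K (ZMod 2) M)
  {degM : K → ℤ} (he : ∀ k, e k ∈ 𝓜 (degM k)) (t : ℤ)

theorem isFilteredBasis_cochainBasis (hmono : Monotone degM) :
    (R.ahComplex 𝓜 t).IsFilteredBasis (fun s => R.cochainBasis h𝓜 e he t s) (R.wt degM t) where
  mono _ _ _ hpq := hmono (Prod.Lex.monotone_fst _ _ hpq)
  mem_fil_iff n s φ := R.mem_fil_iff h𝓜 e he t s n φ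

/-- The label `e_k ⊗ r_j` for a label `r_j`. -/
def tensorLabel (degM : K → ℤ) (k : K) (s : ℕ) (j : R.HomIndex (t - degM k) s) :
    R.Index degM t s :=
  ⟨toLex (k, j.1), by
    change degM k + R.deg s j.1 = t
    rw [j.2]
    ring⟩

variable {R h𝓜 e he t} in
/-- The table of the page `E₀` consists of copies of the table of the resolution. -/
theorem pageZero_table (hmono : Monotone degM)
    (P : (R.ahComplex 𝓜 t).LabelledPages (fun s => R.cochainBasis h𝓜 e he t s) (R.wt degM t))
    {TF : ∀ n, Set (Item (Σ s, R.HomIndex n s))}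
    (hTF : ∀ n, IsCurtisTable (R.homD n) (R.homBasis n) (TF n)) :
    P.T 0 = blockTable (fun k s j => ⟨R.tensorLabel t degM k s j, P.mem_U_zero _⟩) fun k => TF (t - degM k) := by
  have hb := R.isFilteredBasis_cochainBasis h𝓜 e he t hmono
  refine IsCurtisTable.unique (X := (R.ahComplex 𝓜 t).Page (0 : ℕ)) (P.isCurtisTable 0) ?_
    (fun s x => FilteredComplex.dPage_dPage x)
  refine isCurtisTable_blockTable (X := (R.ahComplex 𝓜 t).Page (0 : ℕ))
    (Y := fun k s => R.hom (t - degM k) s) (δ := fun k => R.homD (t - degM k))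
    (β := fun k => R.homBasis (t - degM k)) ?_ ?_ ?_ ?_ ?_ fun k => hTF (t - degM k)
  · intro k s j j' h
    exact Prod.Lex.toLex_lt_toLex.2 (Or.inr ⟨rfl, h⟩)
  · rintro s ⟨⟨p, hp⟩, hU⟩
    exact ⟨(ofLex p).1, ⟨(ofLex p).2, by rw [← hp]; ring⟩, rfl⟩
  · intro k k' s j j' h
    have h1 := congrArg (fun x => (ofLex x.1.1).1) h
    exact h1
  · intro k s a c
    rw [P.repr_dPage_zero hb]
    refine (if_pos rfl).trans ?_
    rw [homBasis_repr_homD, cochainBasis_repr_d]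
    change e.coord k (conj (R.coeffMap s c.1 (R.bd s (R.basis (s + 1) a.1))) • e k) = _
    -- Between equal degrees the conjugate acts through the augmentation, so the diagonal block is
    -- the matrix of the resolution; the same fact makes the blocks with `k ≠ k'` vanish.
    rw [coord_conj_smul h𝓜 he le_rfl]
    simp
  · intro k k' s a c hk
    rw [P.repr_dPage_zero hb]
    split_ifs with hw
    · rw [cochainBasis_repr_d]
      change e.coord k (conj (R.coeffMap s c.1 (R.bd s (R.basis (s + 1) a.1))) • e k') = 0
      have hw' : degM k' = degM k := hw
      rw [coord_conj_smul h𝓜 he hw'.ge]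
      simp [Ne.symm hk]
    · rfl

variable {R h𝓜 e he t} in
theorem tags_zero_eq_resolutionTags (hmono : Monotone degM)
    (P : (R.ahComplex 𝓜 t).LabelledPages (fun s => R.cochainBasis h𝓜 e he t s) (R.wt degM t))
    {TF : ∀ n, Set (Item (Σ s, R.HomIndex n s))}
    (hTF : ∀ n, IsCurtisTable (R.homD n) (R.homBasis n) (TF n)) :
    P.tags 0 = R.resolutionTags degM TF t := by
  have hT := pageZero_table hmono P hTF
  ext it
  constructor
  · rintro ⟨a, c, hac, rfl⟩
    rw [hT] at hac
    obtain ⟨k, it, hit, he⟩ := hac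
    cases it with
    | untagged x => cases he
    | tag a' c' =>
      cases he
      exact ⟨k, t - degM k, by ring, a', c', hit, rfl⟩
  · rintro ⟨k, n, h, a, c, hac, rfl⟩
    obtain rfl : n = t - degM k := by omega
    refine ⟨⟨a.1, R.tensorLabel t degM k a.1 a.2, P.mem_U_zero _⟩,
      ⟨c.1, R.tensorLabel t degM k c.1 c.2, P.mem_U_zero _⟩, ?_, rfl⟩
    rw [hT]
    exact ⟨k, .tag a c, hac, rfl⟩

end FreeResolution

end CurtisAHSS

/-! ### Assembly of the theorem -/

open CurtisAHSS in
theorem mainTheorem4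
    {M : Type*} [AddCommGroup M] [Module (ZMod 2) M] [Module SteenrodAlgebra M]
    [IsScalarTower (ZMod 2) SteenrodAlgebra M]
    (𝓜 : ℤ → Submodule (ZMod 2) M) (h𝓜 : IsGradedModule 𝓜)
    {K : Type*} [Finite K] [LinearOrder K] (e : Module.Basis K (ZMod 2) M)
    (degM : K → ℤ) (he : ∀ k, e k ∈ 𝓜 (degM k)) (hmono : Monotone degM)
    (R : FreeResolution) :
    ∃ (ρ : ∀ n s, Module.Basis (R.HomIndex n s) (ZMod 2) (R.hom n s))
      (β : ∀ t s, Module.Basis (R.Index degM t s) (ZMod 2) ((R.ahComplex 𝓜 t).X s)),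
      R.IsDualHomBasis ρ ∧ R.IsDualBasis 𝓜 e degM β ∧
      (∀ n, ∃! T, IsCurtisTable (R.homD n) (ρ n) T) ∧
      (∀ t, ∃! T, IsCurtisTable (R.ahComplex 𝓜 t).d (β t) T) ∧
      (∀ t, Nonempty ((R.ahComplex 𝓜 t).LabelledPages (β t) (R.wt degM t))) ∧
      ∀ (TF : ∀ n, Set (Item (Σ s, R.HomIndex n s)))
        (_ : ∀ n, IsCurtisTable (R.homD n) (ρ n) (TF n))
        (t : ℤ) (T : Set (Item (Σ s, R.Index degM t s)))
        (_ : IsCurtisTable (R.ahComplex 𝓜 t).d (β t) T)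
        (P : (R.ahComplex 𝓜 t).LabelledPages (β t) (R.wt degM t)),
        -- the tags coming from the resolution; they are the tags of the page `E₀`
        (R.resolutionTags degM TF t ⊆ T ∧ P.tags 0 = R.resolutionTags degM TF t) ∧
        -- the other tags form the table of the differentials `d_r`, `r ≥ 1`
        ({it | it ∈ T ∧ (∃ a c, it = Item.tag a c) ∧ it ∉ R.resolutionTags degM TF t} =
            {it | ∃ r : ℕ, 1 ≤ r ∧ it ∈ P.tags r} ∧
          ∀ (r : ℕ) (a c : Σ s, R.Index degM t s), Item.tag a c ∈ P.tags r →
            R.wt degM t a.1 a.2 = R.wt degM t c.1 c.2 - r) ∧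
        -- the labels in none of these tags are the untagged items; they survive to all pages
        (∀ x : Σ s, R.Index degM t s,
          (Item.untagged x ∈ T ↔ ¬ ∃ it : Item (Σ s, R.Index degM t s), it.Contains x ∧
            (it ∈ R.resolutionTags degM TF t ∨ ∃ r : ℕ, 1 ≤ r ∧ it ∈ P.tags r)) ∧
          (Item.untagged x ∈ T ↔ ∀ r, x.2 ∈ P.U r x.1)) ∧
        -- a cycle with untagged leading term `x` is a permanent cycle with the name `x` on
        -- all pages, and such cycles give a basis of `E_∞`
        ∀ (s : ℕ) (z : {x : R.Index degM t s // Item.untagged ⟨s, x⟩ ∈ T} →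
            (R.ahComplex 𝓜 t).X s),
          (∀ x, (R.ahComplex 𝓜 t).d s (z x) = 0 ∧ IsLeading (β t s) (z x) x.1) →
          (∀ (x) (r : ℕ), ∃ (hx : x.1 ∈ P.U r s)
            (hz : z x ∈ (R.ahComplex 𝓜 t).Z r (R.wt degM t s x.1) s),
            IsLeading (P.β r s) ((R.ahComplex 𝓜 t).cls r (R.wt degM t s x.1) s ⟨z x, hz⟩)
              ⟨x.1, hx⟩) ∧
          ∀ n : ℤ, ∃ B : Module.Basis
              {x : {x : R.Index degM t s // Item.untagged ⟨s, x⟩ ∈ T} //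
                R.wt degM t s x.1 = n} (ZMod 2) ((R.ahComplex 𝓜 t).Einf n s),
            ∀ x, ∃ hz : z x.1 ∈ (R.ahComplex 𝓜 t).Zinf n s,
              B x = Submodule.Quotient.mk ⟨z x.1, hz⟩ := by
  have hb := fun t => R.isFilteredBasis_cochainBasis h𝓜 e he t hmono
  refine ⟨R.homBasis, fun t s => R.cochainBasis h𝓜 e he t s, R.isDualHomBasis_homBasis,
    R.isDualBasis_cochainBasis h𝓜 e he,
    fun n => existsUnique_isCurtisTable (X := fun s => R.hom n s) _ (R.homD_homD n),
    fun t => existsUnique_isCurtisTable _ (R.ahComplex 𝓜 t).d_d,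
    fun t => FilteredComplex.nonempty_labelledPages (hb t), ?_⟩
  intro TF hTF t T hT P
  have htags : P.tags 0 = R.resolutionTags degM TF t :=
    FreeResolution.tags_zero_eq_resolutionTags hmono P hTF
  -- By uniqueness of Curtis tables, everything about `T` can be read off from the pages.
  have hPT : T = P.totalTable := FilteredComplex.LabelledPages.eq_totalTable (hb t) hT
  have htag : ∀ a c, Item.tag a c ∈ T ↔ ∃ r, Item.tag a c ∈ P.tags r := fun a c => by
    rw [hPT, FilteredComplex.LabelledPages.tag_mem_totalTable]
  have hunt : ∀ x, Item.untagged x ∈ T ↔ ∀ r, x.2 ∈ P.U r x.1 := fun x => by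
    rw [hPT, FilteredComplex.LabelledPages.untagged_mem_totalTable]
  rw [← htags]
  refine ⟨⟨?_, rfl⟩, ⟨?_, fun r a c h => FilteredComplex.LabelledPages.wt_of_mem_tags (hb t) h⟩,
    fun x => ⟨?_, hunt x⟩, fun s z hz => ⟨fun x r => ?_, ?_⟩⟩
  · rw [hPT]
    exact fun it hit => Or.inr ⟨0, hit⟩
  · ext it
    constructor
    · rintro ⟨hit, ⟨a, c, rfl⟩, h0⟩
      obtain ⟨r, hr⟩ := (htag a c).1 hit
      refine ⟨r, Nat.one_le_iff_ne_zero.2 ?_, hr⟩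
      rintro rfl
      exact h0 hr
    · rintro ⟨r, hr, h⟩
      obtain ⟨a, c, -, rfl⟩ := id h
      refine ⟨(htag _ _).2 ⟨r, h⟩, ⟨_, _, rfl⟩, fun h0 => ?_⟩
      have := (FilteredComplex.LabelledPages.eq_of_mem_tags h h0 (Or.inl rfl) (Or.inl rfl)).1
      omega
  · rw [hunt]
    constructor
    · rintro hx ⟨it, hcont, h⟩
      obtain ⟨r, hr⟩ : ∃ r, it ∈ P.tags r := by
        rcases h with h | ⟨r, -, h⟩
        · exact ⟨0, h⟩
        · exact ⟨r, h⟩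
      exact FilteredComplex.LabelledPages.not_mem_U_succ_of_mem_tags hr hcont (hx (r + 1))
    · intro hx r
      by_contra hr
      obtain ⟨q, -, it, hit, hcont⟩ := FilteredComplex.LabelledPages.exists_mem_tags hr
      refine hx ⟨it, hcont, ?_⟩
      rcases Nat.eq_zero_or_pos q with rfl | hq
      · exact Or.inl hit
      · exact Or.inr ⟨q, hq, hit⟩
  · have hU : x.1 ∈ P.U r s := (hunt ⟨s, x.1⟩).1 x.2 r
    have hZ := FilteredComplex.mem_Z_of_cycle (r := r)
      (((hb t).mem_fil_iff_of_isLeading (hz x).2).2 le_rfl) (hz x).1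
    exact ⟨hU, hZ, FilteredComplex.LabelledPages.isLeading_cls (P := P) (i := ⟨x.1, hU⟩) (hb t)
      rfl hZ (hz x).2⟩
  · exact FilteredComplex.exists_basis_Einf (hb t) hT s z hz
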